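/- Let $f(s)=1+\sum_{n\ge 1}a_n e^{-\lambda_n s}$ be a non-constant Dirichlet series ($a_n\in\mathbb C$, $0<\lambda_1<\lambda_2<\cdots$, $\lambda_n\to+\infty$; finitely many terms are allowed by taking $a_n=0$ for large $n$) with $\sum_n|a_n|e^{-\lambda_n\bar\sigma}<\infty$ for some $\bar\sigma\in\mathbb R$, and suppose that $f$ has a meromorphic extension of finite order to $\mathbb C$. Let $n_\rho\in\mathbb Z$ be the multiplicity of $\rho$ in the divisor of $f$ (positive at zeros, negative at poles, $0$ otherwise), and let $d$ be the convergence exponent of $f$, the least integer $d\ge 0$ with $\sum_{\rho\ne0}|n_\rho||\rho|^{-d}<\infty$. Fix $\sigma\in\mathbb C$. Notation. * Newton–Cramer distribution: $W_\sigma(f)=e^{\sigma t}\,\frac{D^d}{Dt^d}\big((K_{d,\sigma}(t)-K_{d,\sigma}(0))\mathbf 1_{t\ge 0}\big)$, with distributional derivatives and $K_{d,\sigma}(t)=n_\sigma\frac{t^d}{d!}+\sum_{\rho\ne\sigma}\frac{n_\rho}{(\rho-\sigma)^d}e^{(\rho-\sigma)t}$ for $t\ge0$. * Discrepancy polynomial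 and genus: with $m=d-1$ and $E_m(z)=(1-z)e^{z+z^2/2+\cdots+z^m/m}$, let $Q_{f,\sigma}$ be the polynomial (unique up to adding a multiple of $2\pi i$) in the Hadamard factorization $f(s)=(s-\sigma)^{n_\sigma}e^{Q_{f,\sigma}(s)}\prod_{\rho\ne\sigma}E_m\big(\tfrac{s-\sigma}{\rho-\sigma}\big)^{n_\rho}$. Put $g=\max(\deg Q_{f,0},\,m)$ and $-Q_{f,\sigma}'(s)=\sum_{k=0}^{g-1}c_k(\sigma)s^k$. * $\Lambda$ is the set of non-zero sequences $\mathbf k=(k_n)_{n\ge1}$ of non-negative integers with finitely many non-zero terms, $\|\mathbf k\|=\sum k_n$, $\langle\lambda,\mathbf k\rangle=\sum\lambda_nk_n$, and $b_{\mathbf k}=\frac{(-1)^{\|\mathbf k\|}}{\|\mathbf k\|}\frac{\|\mathbf k\|!}{\prod k_j!}\prod a_j^{k_j}$. * A distribution $W$ on $\mathbb R$ is Laplace transformable if its support lies in some $]-M,\infty[$ and $e^{-ct}W$ is tempered for some $c\in\mathbb R$; $W_i\to W$ as Laplace transformable distributions if this holds with common $M,c$ for $W$ and all $W_i$, and $e^{-ct}W_i\to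 e^{-ct}W$ in $\mathcal S'$. Then a convergence exponent $d$ exists, $f$ has a Hadamard factorization as above centred at every point of $\mathbb C$, the series defining $K_{d,\sigma}(t)$ converges absolutely for $t\ge0$, and for $\Re s$ large enough $-\log f(s)=\sum_{\mathbf k\in\Lambda}b_{\mathbf k}e^{-\langle\lambda,\mathbf k\rangle s}$ (absolutely convergent series, principal branch of the logarithm). Moreover $W_\sigma(f)$ is Laplace transformable, the series $\sum_{\mathbf k\in\Lambda}\langle\lambda,\mathbf k\rangle b_{\mathbf k}\delta_{\langle\lambda,\mathbf k\rangle}$ converges (over the filter of finite subsets of $\Lambda$) as Laplace transformable distributions, and, as distributions on $\mathbb R$, $$W_\sigma(f)=\sum_{k=0}^{g-1}c_k(\sigma)\,\delta_0^{(k)}+\sum_{\mathbf k\in\Lambda}\langle\lambda,\mathbf k\rangle\, b_{\mathbf k}\,\delta_{\langle\lambda,\mathbf k\rangle}.$$ On $\mathbb R_+^*=\,]0,\infty[$ this reads $$\sum_\rho n_\rho e^{\rho t}=W_\sigma(f)|_{\mathbb R_+^*}=\sum_{\mathbf k\in\Lambda}\langle\lambda,\mathbf k\rangle\, b_{\mathbf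 k}\,\delta_{\langle\lambda,\mathbf k\rangle},$$ where both series converge unconditionally when tested against any test function supported in $]0,\infty[$. -/

import Mathlib

open scoped Distributions SchwartzMap Topology ContDiff

noncomputable section

namespace PoissonNewton

/-! ### Distributions on the real line -/

/-- Complex-valued distributions on the real line. -/
abbrev Dist : Type := 𝓓'((⊤ : TopologicalSpace.Opens ℝ), ℂ)

/-- Multiplication of test functions by a smooth real function `g`. -/
def mulTest (g : ℝ → ℝ) (hg : ContDiff ℝ ∞ g) :
    𝓓((⊤ : TopologicalSpace.Opens ℝ), ℝ) →L[ℝ] 𝓓((⊤ : TopologicalSpace.Opens ℝ), ℝ) :=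
  TestFunction.limitCLM ℝ
    (fun φ => ⟨fun t => φ t * g t, φ.contDiff.mul hg, φ.hasCompactSupport.mul_right,
      fun _ _ => trivial⟩)
    (fun _ hK => TestFunction.ofSupportedInCLM ℝ hK ∘L
      ContDiffMapSupportedIn.bilinLeftCLM (ContinuousLinearMap.mul ℝ ℝ) hg)
    (fun _ _ _ => by ext; rfl)

theorem mulTest_apply (g : ℝ → ℝ) (hg : ContDiff ℝ ∞ g)
    (φ : 𝓓((⊤ : TopologicalSpace.Opens ℝ), ℝ)) (t : ℝ) : mulTest g hg φ t = φ t * g t := rfl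

theorem contDiff_re_exp (z : ℂ) : ContDiff ℝ ∞ fun t : ℝ => (Complex.exp (z * t)).re :=
  Complex.reCLM.contDiff.comp
    (Complex.contDiff_exp.comp (contDiff_const.mul Complex.ofRealCLM.contDiff))

theorem contDiff_im_exp (z : ℂ) : ContDiff ℝ ∞ fun t : ℝ => (Complex.exp (z * t)).im :=
  Complex.imCLM.contDiff.comp
    (Complex.contDiff_exp.comp (contDiff_const.mul Complex.ofRealCLM.contDiff))

/-- The product `e^{z t} W` of a distribution `W` with the smooth function `t ↦ e^{z t}`.
Distributions are tested against real test functions `φ`, so `⟨e^{z t} W, φ⟩ = ⟨W, e^{z t} φ⟩`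
is split into the real and the imaginary part of `e^{z t}`. -/
def expMul (z : ℂ) (W : Dist) : Dist :=
  ContinuousLinearMap.precompCompactConvergenceCLM ℂ (mulTest _ (contDiff_re_exp z)) W +
    Complex.I •
      ContinuousLinearMap.precompCompactConvergenceCLM ℂ (mulTest _ (contDiff_im_exp z)) W

theorem expMul_apply (z : ℂ) (W : Dist) (φ : 𝓓((⊤ : TopologicalSpace.Opens ℝ), ℝ)) :
    expMul z W φ = W (mulTest _ (contDiff_re_exp z) φ) +
      Complex.I * W (mulTest _ (contDiff_im_exp z) φ) := rfl

/-- The distribution `φ ↦ ∫ F φ` of a locally integrable function `F`. -/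
def ofFun (F : ℝ → ℂ) : Dist :=
  UniformConvergenceCLM.ofFun _ _ _ <|
  TestFunction.integralAgainstBilinCLM (ContinuousLinearMap.lsmul ℝ ℝ) MeasureTheory.volume F

/-- The Dirac distribution `δ_x`, as a complex-valued distribution. -/
def dirac (x : ℝ) : Dist := Distribution.mapCLM Complex.ofRealCLM (Distribution.delta x)

/-- The distributional derivative `D/Dt`. -/
def distDeriv (W : Dist) : Dist := Distribution.lineDerivCLM (1 : ℝ) W

/-- A real test function, seen as a complex-valued Schwartz function. -/
def toSchwartz (φ : 𝓓((⊤ : TopologicalSpace.Opens ℝ), ℝ)) : 𝓢(ℝ, ℂ) :=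
  HasCompactSupport.toSchwartzMap (f := fun t => (φ t : ℂ))
    (φ.hasCompactSupport.comp_left Complex.ofReal_zero)
    (Complex.ofRealCLM.contDiff.comp φ.contDiff)

/-- The distribution `W` is (the restriction to test functions of) the tempered distribution
`T`. -/
def IsTemperedBy (W : Dist) (T : 𝓢'(ℝ, ℂ)) : Prop :=
  ∀ φ : 𝓓((⊤ : TopologicalSpace.Opens ℝ), ℝ), T (toSchwartz φ) = W φ

/-- `W` is (right) Laplace transformable: its support lies in some `]-M, ∞[` and `e^{-ct} W` is
tempered for some real `c`. -/
def IsLaplaceTransformable (W : Dist) : Prop :=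
  (∃ M : ℝ, Distribution.dsupport W ⊆ Set.Ioi (-M)) ∧
    ∃ (c : ℝ) (T : 𝓢'(ℝ, ℂ)), IsTemperedBy (expMul (-c) W) T

/-- Convergence `W i → V` along the filter `l` in the space of Laplace transformable
distributions: with uniform `M` and `c`, all supports lie in `]-M, ∞[`, all `e^{-ct} W i` are
tempered, and `e^{-ct} W i → e^{-ct} V` in the space of tempered distributions. -/
def TendstoLaplace {ι : Type*} (W : ι → Dist) (l : Filter ι) (V : Dist) : Prop :=
  ∃ M c : ℝ, (∀ i, Distribution.dsupport (W i) ⊆ Set.Ioi (-M)) ∧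
    Distribution.dsupport V ⊆ Set.Ioi (-M) ∧
    ∃ (S : ι → 𝓢'(ℝ, ℂ)) (T : 𝓢'(ℝ, ℂ)), (∀ i, IsTemperedBy (expMul (-c) (W i)) (S i)) ∧
      IsTemperedBy (expMul (-c) V) T ∧ Filter.Tendsto S l (𝓝 T)

/-- The (unordered) series `∑ W k` converges to `V` as Laplace transformable distributions. -/
def HasLaplaceSum {κ : Type*} (W : κ → Dist) (V : Dist) : Prop :=
  TendstoLaplace (fun A : Finset κ => ∑ k ∈ A, W k) Filter.atTop V

/-! ### Meromorphic functions of finite order -/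

/-- A meromorphic function on the plane has finite order: its Nevanlinna characteristic has at
most polynomial growth. -/
def HasFiniteOrder (f : ℂ → ℂ) : Prop :=
  ∃ A : ℕ, ValueDistribution.characteristic f ⊤ =O[Filter.atTop] fun r : ℝ => r ^ A

/-- The multiplicity `n_ρ` of `ρ` in the divisor of `f`: positive at zeros, negative at poles. -/
def mult (f : ℂ → ℂ) (ρ : ℂ) : ℤ := (meromorphicOrderAt f ρ).untop₀

/-- The exponents `d` with `∑_{ρ ≠ 0} |n_ρ| |ρ|^{-d} < ∞`. -/
def convergenceExponents (f : ℂ → ℂ) : Set ℕ :=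
  {d | Summable fun ρ : {ρ : ℂ // ρ ≠ 0} => |(mult f ρ : ℝ)| * (‖(ρ : ℂ)‖ ^ d)⁻¹}

/-- The convergence exponent `d` of `f`, the least element of `convergenceExponents f`. -/
def convergenceExponent (f : ℂ → ℂ) : ℕ := sInf (convergenceExponents f)

/-- The Weierstrass factor `E_m(z) = (1 - z) exp (z + z²/2 + ⋯ + zᵐ/m)`. -/
def weierstrassFactor (m : ℕ) (z : ℂ) : ℂ :=
  (1 - z) * Complex.exp (∑ j ∈ Finset.Icc 1 m, z ^ j / j)

/-- `Q` is an exponent of the Hadamard factorization of `f` centred at `σ`: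
`f(s) = (s-σ)^{n_σ} e^{Q(s)} ∏_{ρ ≠ σ} E_m((s-σ)/(ρ-σ))^{n_ρ}` with `m = d - 1`, as an equality
of meromorphic functions, that is, outside a closed discrete set. -/
def IsHadamardExponent (f : ℂ → ℂ) (σ : ℂ) (Q : Polynomial ℂ) : Prop :=
  ∀ᶠ s in Filter.codiscrete ℂ, ∃ p : ℂ,
    HasProd (fun ρ : {ρ : ℂ // ρ ≠ σ} =>
      weierstrassFactor (convergenceExponent f - 1) ((s - σ) / (ρ - σ)) ^ mult f ρ) p ∧
    f s = (s - σ) ^ mult f σ * Complex.exp (Q.eval s) * p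

/-- The polynomial `Q_{f,σ}` of the Hadamard factorization centred at `σ` (unique up to
an integer multiple of `2πi`; one choice is made). -/
def hadamardPolynomial (f : ℂ → ℂ) (σ : ℂ) : Polynomial ℂ :=
  Classical.epsilon (IsHadamardExponent f σ)

/-- The genus `g = max (deg Q_f, d - 1)`, where `Q_f = Q_{f,0}`. -/
def genus (f : ℂ → ℂ) : ℕ :=
  max (hadamardPolynomial f 0).natDegree (convergenceExponent f - 1)

/-- The discrepancy polynomial `P_{f,σ} = -Q_{f,σ}'`; its coefficients are the `c_k(σ)`. -/
def discrepancyPolynomial (f : ℂ → ℂ) (σ : ℂ) : Polynomial ℂ :=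
  -Polynomial.derivative (hadamardPolynomial f σ)

/-! ### The Newton-Cramer distribution -/

/-- `K_{d,σ}(t) = n_σ t^d / d! + ∑_{ρ ≠ σ} n_ρ (ρ-σ)^{-d} e^{(ρ-σ)t}`, for `t ≥ 0`. -/
def newtonCramerPrimitive (f : ℂ → ℂ) (σ : ℂ) (t : ℝ) : ℂ :=
  mult f σ * (t : ℂ) ^ convergenceExponent f / (convergenceExponent f).factorial +
    ∑' ρ : {ρ : ℂ // ρ ≠ σ},
      mult f ρ / ((ρ : ℂ) - σ) ^ convergenceExponent f * Complex.exp ((ρ - σ) * t)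

/-- The Newton-Cramer distribution
`W_σ(f) = e^{σt} (D/Dt)^d ((K_{d,σ}(t) - K_{d,σ}(0)) 𝟏_{t ≥ 0})`. -/
def newtonCramer (f : ℂ → ℂ) (σ : ℂ) : Dist :=
  expMul σ (distDeriv^[convergenceExponent f] (ofFun ((Set.Ici (0 : ℝ)).indicator fun t =>
    newtonCramerPrimitive f σ t - newtonCramerPrimitive f σ 0)))

/-! ### Dirichlet series -/

/-- The index set `Λ` of non-zero finitely supported sequences of natural numbers. -/
abbrev Index : Type := {k : ℕ →₀ ℕ // k ≠ 0}

/-- `⟨λ, k⟩ = ∑ λ_n k_n`. -/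
def pairing (lam : ℕ → ℝ) (k : Index) : ℝ := k.1.sum fun n j => lam n * j

/-- The coefficient
`b_k = ((-1)^{|k|} / |k|) (|k|! / ∏ k_n!) ∏ a_n^{k_n}` of `e^{-⟨λ,k⟩s}` in `-log f`. -/
def logCoeff (a : ℕ → ℂ) (k : Index) : ℂ :=
  (-1) ^ k.1.degree / k.1.degree *
    ((k.1.degree.factorial : ℂ) / (k.1.prod fun _ j => (j.factorial : ℂ))) *
    k.1.prod fun n j => a n ^ j

end PoissonNewton

end

/-!
The formula compares two expansions of the logarithmic derivative `f' / f` on a half plane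
`Re s > c` and transfers them to distributions with the Laplace transform.

*The divisor side.* The Nevanlinna characteristics of `f` and `1 / f` bound the number of zeros and
poles in a disk of radius `R` by a power of `R` (`exists_sum_mult_le`), so convergence exponents
exist (`convergenceExponents_nonempty`). Dividing `f` by the canonical products over its zeros and
poles leaves a zero-free entire function of finite order, which is the exponential of a polynomial
(`exists_polynomial_of_hasFiniteOrder_exp`): this is the Hadamard factorization
(`exists_hadamard`). Its logarithmic derivative (`hasSum_logDeriv`) reads, with `m = d - 1`,
`f' / f - Q' = ∑ n_ρ (1 / (s - ρ) + ∑_{j < m} (s - σ)^j / (ρ - σ)^{j+1})`. A comparison of two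
centres shows that `Q'` changes by a polynomial of degree less than `m`
(`degree_derivative_sub_lt`), hence has degree less than the genus at every centre.

*The Dirichlet side.* Where `∑ |a_n e^{-λ_n s}| ≤ 1/2`, the multinomial theorem expands `-log f`
over `Λ` (`hasSum_logCoeff`), and termwise differentiation gives
`f' / f = ∑ ⟨λ, k⟩ b_k e^{-⟨λ, k⟩ s}`, absolutely convergent on a half plane (`exists_halfPlane`).
This sum decays exponentially as `Re s → ∞`, which a non-zero logarithmic derivative with finite
divisor cannot do. Hence the divisor is infinite and `d ≥ 1` (`zero_notMem_convergenceExponents`).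

*The comparison.* Every zero and pole satisfies `Re ρ ≤ c`, so `K_{d,σ}(t)` converges absolutely
and grows at most exponentially. Integrating it term by term turns the partial fraction expansion
into the statement that the Laplace transform of `K_{d,σ} - K_{d,σ}(0)` at `z` is
`z^{-d} (f' / f - Q')(z + σ)` (`pow_mul_integral_newtonCramerPrimitive`). Parseval's formula on a
vertical line (`integral_mul_eq_integral_laplace`) then writes `⟨W_σ(f), φ⟩` as the integral of
`f' / f - Q'` against the Laplace transform of `φ`
(`IsAdmissible.newtonCramer_eq_integral_laplace`).
Inserting the Dirichlet expansion and inverting the Laplace transform (`laplace_inversion`) gives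
the Dirac masses at the `⟨λ, k⟩`, while the polynomial `-Q'` gives the derivatives of `δ_0`
(`IsAdmissible.hasSum_newtonCramer`).

The weights `⟨λ, k⟩ b_k e^{-c⟨λ, k⟩}` are absolutely summable and the frequencies are positive,
which gives convergence as Laplace transformable distributions (`hasLaplaceSum_dirac`,
`isLaplaceTransformable_of_hasSum`). For test functions supported in `]0, ∞[` the constant
`K_{d,σ}(0)` plays no role, and `d` integrations by parts in each term of `K_{d,σ}` give
`∑ n_ρ e^{ρt}` (`IsAdmissible.hasSum_mult_mul_laplace`).
-/

namespace PoissonNewton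

/-! ### Weierstrass factors -/

theorem weierstrassFactor_eq_zero_iff {m : ℕ} {z : ℂ} : weierstrassFactor m z = 0 ↔ z = 1 := by
  rw [weierstrassFactor, mul_eq_zero, or_iff_left (Complex.exp_ne_zero _), sub_eq_zero, eq_comm]

theorem differentiable_weierstrassFactor (m : ℕ) : Differentiable ℂ (weierstrassFactor m) := by
  unfold weierstrassFactor
  fun_prop

/-- Near the origin `E_m = e^L`, where `L` is `log (1 - z)` with its Taylor polynomial of degree `m`
removed and hence vanishes to order `m + 1`. -/
theorem exists_exp_eq_weierstrassFactor (m : ℕ) {z : ℂ} (hz : ‖z‖ ≤ 1 / 2) :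
    ∃ L : ℂ, weierstrassFactor m z = Complex.exp L ∧ ‖L‖ ≤ 2 * ‖z‖ ^ (m + 1) := by
  have hz1 : ‖-z‖ < 1 := by rw [norm_neg]; linarith
  refine ⟨Complex.log (1 + -z) - Complex.logTaylor (m + 1) (-z), ?_, ?_⟩
  · have h1 : (1 : ℂ) + -z ≠ 0 := by
      intro h
      have : z = 1 := by linear_combination -h
      rw [this] at hz
      norm_num at hz
    have h2 : Complex.logTaylor (m + 1) (-z) = -∑ j ∈ Finset.Icc 1 m, z ^ j / j := by
      rw [Complex.logTaylor, ← Finset.sum_neg_distrib, Finset.range_eq_Ico,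
        Finset.sum_eq_sum_Ico_succ_bot (by omega)]
      have : Finset.Ico (0 + 1) (m + 1) = Finset.Icc 1 m := by ext; simp
      rw [this]
      simp only [CharP.cast_eq_zero, div_zero, zero_add]
      refine Finset.sum_congr rfl fun j _ => ?_
      rw [neg_pow z j, pow_succ]
      have : ((-1 : ℂ) ^ j * -1) * ((-1) ^ j * z ^ j) = -(((-1) ^ j * (-1) ^ j) * z ^ j) := by ring
      rw [this, ← mul_pow]
      simp [neg_div]
    rw [Complex.exp_sub, Complex.exp_log h1, h2, Complex.exp_neg, weierstrassFactor, div_inv_eq_mul,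
      sub_eq_add_neg]
  · refine (Complex.norm_log_sub_logTaylor_le m hz1).trans ?_
    rw [norm_neg]
    have h3 : (1 - ‖z‖)⁻¹ ≤ 2 := by
      rw [inv_le_comm₀ (by linarith) (by norm_num)]; linarith
    have h4 : ‖z‖ ^ (m + 1) * (1 - ‖z‖)⁻¹ / (m + 1) ≤ ‖z‖ ^ (m + 1) * (1 - ‖z‖)⁻¹ := by
      apply div_le_self
      · have : 0 < 1 - ‖z‖ := by linarith
        positivity
      · simp
    refine h4.trans ?_
    rw [mul_comm]
    gcongr

/-- Weierstrass factors of genus `m` have order at most `m + 1`, with a bound that vanishes to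
order `m + 1` at the origin. -/
theorem norm_weierstrassFactor_le (m : ℕ) (z : ℂ) :
    ‖weierstrassFactor m z‖ ≤ Real.exp ((m + 2) * 2 ^ (m + 1) * ‖z‖ ^ (m + 1)) := by
  rcases le_or_gt ‖z‖ (1 / 2) with hz | hz
  · obtain ⟨L, h1, h2⟩ := exists_exp_eq_weierstrassFactor m hz
    rw [h1]
    refine (Complex.norm_exp_le_exp_norm L).trans (Real.exp_le_exp.2 (h2.trans ?_))
    gcongr
    have : (1 : ℝ) ≤ 2 ^ (m + 1) := one_le_pow₀ (by norm_num)
    have hm : (0 : ℝ) ≤ m := by positivity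
    nlinarith
  · -- every power `‖z‖ ^ j` with `j ≤ m + 1` is at most `(2 ‖z‖) ^ (m + 1)`
    have key : ∀ j ≤ m + 1, ‖z‖ ^ j ≤ 2 ^ (m + 1) * ‖z‖ ^ (m + 1) := by
      intro j hj
      rw [← mul_pow]
      calc ‖z‖ ^ j ≤ (2 * ‖z‖) ^ j := by gcongr; linarith [norm_nonneg z]
        _ ≤ (2 * ‖z‖) ^ (m + 1) := pow_le_pow_right₀ (by linarith) hj
    have h1 : ‖1 - z‖ ≤ Real.exp (2 ^ (m + 1) * ‖z‖ ^ (m + 1)) := by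
      have := key 1 (by omega)
      rw [pow_one] at this
      calc ‖1 - z‖ ≤ ‖z‖ + 1 := by simpa [add_comm] using norm_sub_le (1 : ℂ) z
        _ ≤ Real.exp ‖z‖ := Real.add_one_le_exp _
        _ ≤ _ := Real.exp_le_exp.2 this
    have h2 : ‖∑ j ∈ Finset.Icc 1 m, z ^ j / (j : ℂ)‖ ≤ m * (2 ^ (m + 1) * ‖z‖ ^ (m + 1)) := by
      refine (norm_sum_le_of_le _ (f := fun j : ℕ => z ^ j / (j : ℂ))
        (n := fun _ => 2 ^ (m + 1) * ‖z‖ ^ (m + 1)) fun j hj => ?_).trans ?_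
      · rw [Finset.mem_Icc] at hj
        rw [norm_div, norm_pow, Complex.norm_natCast]
        refine (div_le_self (by positivity) ?_).trans (key j (by omega))
        exact_mod_cast hj.1
      · simp
    rw [weierstrassFactor, norm_mul]
    calc ‖1 - z‖ * ‖Complex.exp (∑ j ∈ Finset.Icc 1 m, z ^ j / (j : ℂ))‖
        ≤ Real.exp (2 ^ (m + 1) * ‖z‖ ^ (m + 1)) *
          Real.exp (m * (2 ^ (m + 1) * ‖z‖ ^ (m + 1))) := by
          gcongr
          exact (Complex.norm_exp_le_exp_norm _).trans (Real.exp_le_exp.2 h2)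
      _ ≤ _ := by
          rw [← Real.exp_add]
          refine Real.exp_le_exp.2 ?_
          have : 0 ≤ 2 ^ (m + 1) * ‖z‖ ^ (m + 1) := by positivity
          linarith

theorem logDeriv_weierstrassFactor (m : ℕ) {z : ℂ} (hz : z ≠ 1) :
    logDeriv (weierstrassFactor m) z = (z - 1)⁻¹ + ∑ j ∈ Finset.range m, z ^ j := by
  have h1 : (1 : ℂ) - z ≠ 0 := sub_ne_zero.2 hz.symm
  have hsum : HasDerivAt (fun z : ℂ => ∑ j ∈ Finset.Icc 1 m, z ^ j / (j : ℂ))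
      (∑ j ∈ Finset.range m, z ^ j) z := by
    have : ∑ j ∈ Finset.range m, z ^ j = ∑ j ∈ Finset.Icc 1 m, ((j : ℂ) * z ^ (j - 1)) / j := by
      have h : Finset.Icc 1 m = Finset.Ico 1 (m + 1) := by ext; simp
      rw [h, Finset.sum_Ico_eq_sum_range]
      refine Finset.sum_congr (by simp) fun j _ => ?_
      have : ((1 + j : ℕ) : ℂ) ≠ 0 := by norm_cast; omega
      rw [mul_div_cancel_left₀ _ this]
      simp
    rw [this]
    exact HasDerivAt.fun_sum fun j _ => (hasDerivAt_pow j z).div_const _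
  have h2 := ((hasDerivAt_id z).const_sub 1).mul hsum.cexp
  have h3 : HasDerivAt (weierstrassFactor m) _ z := h2
  rw [logDeriv_apply, h3.deriv, weierstrassFactor]
  have h4 : z - 1 ≠ 0 := sub_ne_zero.2 hz
  have h5 := Complex.exp_ne_zero (∑ j ∈ Finset.Icc 1 m, z ^ j / (j : ℂ))
  simp only [id]
  field_simp
  ring

/-! ### Canonical products -/

section CanonicalProduct

variable {ι : Type*} {m : ℕ} {a : ι → ℂ} {k : ι → ℤ}

/-- The bound that makes the canonical product converge locally uniformly. It can fail only for the
finitely many factors with `|a_i| ≤ 2 R` and `k_i ≠ 0`; the exponents `k_i` may have either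
sign. -/
theorem eventually_norm_factor_sub_one_le (ha : ∀ i, a i ≠ 0)
    (hs : Summable fun i => |(k i : ℝ)| * (‖a i‖ ^ (m + 1))⁻¹) {R : ℝ} (hR : 0 < R) :
    ∀ᶠ i in Filter.cofinite, ∀ s : ℂ, ‖s‖ ≤ R →
      ‖weierstrassFactor m (s / a i) ^ k i - 1‖ ≤
        4 * R ^ (m + 1) * (|(k i : ℝ)| * (‖a i‖ ^ (m + 1))⁻¹) := by
  have h0 := hs.tendsto_cofinite_zero
  have h1 : ∀ᶠ i in Filter.cofinite,
      |(k i : ℝ)| * (‖a i‖ ^ (m + 1))⁻¹ < ((2 * R) ^ (m + 1))⁻¹ :=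
    h0.eventually (gt_mem_nhds (by positivity))
  filter_upwards [h1] with i hi s hsR
  rcases eq_or_ne (k i) 0 with hk | hk
  · simp [hk]
  have hapos : 0 < ‖a i‖ := norm_pos_iff.2 (ha i)
  have hk1 : (1 : ℝ) ≤ |(k i : ℝ)| := by exact_mod_cast Int.one_le_abs hk
  have h2 : (‖a i‖ ^ (m + 1))⁻¹ < ((2 * R) ^ (m + 1))⁻¹ := by
    refine lt_of_le_of_lt ?_ hi
    exact le_mul_of_one_le_left (by positivity) hk1
  have h3 : 2 * R < ‖a i‖ := by
    rw [inv_lt_inv₀ (by positivity) (by positivity)] at h2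
    exact lt_of_pow_lt_pow_left₀ _ (by positivity) h2
  have h4 : ‖s / a i‖ ≤ 1 / 2 := by
    rw [norm_div, div_le_iff₀ hapos]; linarith
  obtain ⟨L, hL, hL2⟩ := exists_exp_eq_weierstrassFactor m h4
  have h5 : ‖(k i : ℂ) * L‖ ≤ 2 * R ^ (m + 1) * (|(k i : ℝ)| * (‖a i‖ ^ (m + 1))⁻¹) := by
    have hn : ‖(k i : ℂ)‖ = |(k i : ℝ)| := by
      rw [← Complex.ofReal_intCast, Complex.norm_real, Real.norm_eq_abs]
    rw [norm_mul, hn]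
    calc |(k i : ℝ)| * ‖L‖ ≤ |(k i : ℝ)| * (2 * (R / ‖a i‖) ^ (m + 1)) := by
          gcongr
          refine hL2.trans ?_
          rw [norm_div]
          gcongr
      _ = _ := by rw [div_pow]; ring
  have h6 : ‖(k i : ℂ) * L‖ ≤ 1 := by
    refine h5.trans ?_
    have : 2 * R ^ (m + 1) * ((2 * R) ^ (m + 1))⁻¹ ≤ 1 := by
      rw [mul_inv_le_iff₀ (by positivity), one_mul, mul_pow]
      gcongr
      exact le_self_pow₀ (by norm_num) (by omega)
    refine le_trans ?_ this
    gcongr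
  rw [hL, ← Complex.exp_int_mul]
  refine (Complex.norm_exp_sub_one_le h6).trans ?_
  linarith

theorem summable_norm_factor_sub_one (ha : ∀ i, a i ≠ 0)
    (hs : Summable fun i => |(k i : ℝ)| * (‖a i‖ ^ (m + 1))⁻¹) (s : ℂ) :
    Summable fun i => ‖weierstrassFactor m (s / a i) ^ k i - 1‖ := by
  refine Summable.of_norm_bounded_eventually
    (hs.mul_left (4 * (‖s‖ + 1) ^ (m + 1))) ?_
  filter_upwards [eventually_norm_factor_sub_one_le ha hs (R := ‖s‖ + 1) (by positivity)] with i hi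
  rw [norm_norm]
  exact hi s (by linarith)

theorem multipliable_factor (ha : ∀ i, a i ≠ 0)
    (hs : Summable fun i => |(k i : ℝ)| * (‖a i‖ ^ (m + 1))⁻¹) (s : ℂ) :
    Multipliable fun i => weierstrassFactor m (s / a i) ^ k i := by
  simpa using multipliable_one_add_of_summable (summable_norm_factor_sub_one ha hs s)

/-- The canonical product `s ↦ ∏ E_m(s / a_i) ^ k_i`. -/
noncomputable def canonicalProduct (m : ℕ) (a : ι → ℂ) (k : ι → ℤ) (s : ℂ) : ℂ :=
  ∏' i, weierstrassFactor m (s / a i) ^ k i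

theorem factor_ne_zero (ha : ∀ i, a i ≠ 0) {s : ℂ} {i : ι} (h : k i ≠ 0 → s ≠ a i) :
    weierstrassFactor m (s / a i) ^ k i ≠ 0 := by
  rcases eq_or_ne (k i) 0 with hk | hk
  · simp [hk]
  · refine zpow_ne_zero _ fun h0 => h hk ?_
    rw [weierstrassFactor_eq_zero_iff, div_eq_one_iff_eq (ha i)] at h0
    exact h0

theorem canonicalProduct_ne_zero (ha : ∀ i, a i ≠ 0)
    (hs : Summable fun i => |(k i : ℝ)| * (‖a i‖ ^ (m + 1))⁻¹) {s : ℂ}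
    (h : ∀ i, k i ≠ 0 → s ≠ a i) : canonicalProduct m a k s ≠ 0 := by
  have := tprod_one_add_ne_zero_of_summable (f := fun i => weierstrassFactor m (s / a i) ^ k i - 1)
    (fun i => by simpa using factor_ne_zero ha (h i)) (summable_norm_factor_sub_one ha hs s)
  simpa [canonicalProduct] using this

theorem differentiableOn_factor (ha : ∀ i, a i ≠ 0) {U : Set ℂ} {i : ι}
    (hU : k i < 0 → ∀ s ∈ U, s ≠ a i) :
    DifferentiableOn ℂ (fun s => weierstrassFactor m (s / a i) ^ k i) U := by
  have hd : Differentiable ℂ fun s => weierstrassFactor m (s / a i) :=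
    (differentiable_weierstrassFactor m).comp (differentiable_id.div_const _)
  intro s hs
  refine (DifferentiableAt.zpow (hd s) ?_).differentiableWithinAt
  rcases lt_or_ge (k i) 0 with hk | hk
  · left
    rw [Ne, weierstrassFactor_eq_zero_iff, div_eq_one_iff_eq (ha i)]
    exact hU hk s hs
  · exact Or.inr hk

theorem hasProdLocallyUniformlyOn_factor (ha : ∀ i, a i ≠ 0)
    (hs : Summable fun i => |(k i : ℝ)| * (‖a i‖ ^ (m + 1))⁻¹) {U : Set ℂ} (hUo : IsOpen U)
    (hU : ∀ i, k i < 0 → ∀ s ∈ U, s ≠ a i) {R : ℝ} (hR : 0 < R) (hUR : ∀ s ∈ U, ‖s‖ ≤ R) :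
    HasProdLocallyUniformlyOn (fun i s => weierstrassFactor m (s / a i) ^ k i)
      (canonicalProduct m a k) U := by
  have h1 : ∀ᶠ i in Filter.cofinite, ∀ s ∈ U,
      ‖(fun s => weierstrassFactor m (s / a i) ^ k i - 1) s‖ ≤
        4 * R ^ (m + 1) * (|(k i : ℝ)| * (‖a i‖ ^ (m + 1))⁻¹) := by
    filter_upwards [eventually_norm_factor_sub_one_le ha hs hR] with i hi s hs using hi s (hUR s hs)
  have := Summable.hasProdLocallyUniformlyOn_one_add hUo
    (hs.mul_left (4 * R ^ (m + 1))) h1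
    (fun i => ((differentiableOn_factor (k := k) (m := m) ha (hU i)).sub_const 1).continuousOn)
  simp only [add_sub_cancel] at this
  exact this

/-- A canonical product is holomorphic away from its poles, the points `a_i` with `k_i < 0`. -/
theorem differentiableAt_canonicalProduct (ha : ∀ i, a i ≠ 0)
    (hs : Summable fun i => |(k i : ℝ)| * (‖a i‖ ^ (m + 1))⁻¹) {U : Set ℂ} (hUo : IsOpen U)
    (hU : ∀ i, k i < 0 → ∀ s ∈ U, s ≠ a i) {s : ℂ} (hsU : s ∈ U) :
    DifferentiableAt ℂ (canonicalProduct m a k) s := by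
  have hVo : IsOpen (U ∩ Metric.ball 0 (‖s‖ + 1)) := hUo.inter Metric.isOpen_ball
  have h1 := hasProdLocallyUniformlyOn_factor (U := U ∩ Metric.ball 0 (‖s‖ + 1)) ha hs hVo
    (fun i hi s hs => hU i hi s hs.1) (R := ‖s‖ + 1) (by positivity)
    (fun s hs => (mem_ball_zero_iff.1 hs.2).le)
  rw [hasProdLocallyUniformlyOn_iff_tendstoLocallyUniformlyOn] at h1
  have h2 := h1.differentiableOn (Filter.Eventually.of_forall fun A => by
    refine DifferentiableOn.fun_finsetProd fun i _ => ?_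
    exact differentiableOn_factor ha (fun hi s hs => hU i hi s hs.1)) hVo
  exact h2.differentiableAt (hVo.mem_nhds ⟨hsU, by simp⟩)

theorem differentiable_canonicalProduct (ha : ∀ i, a i ≠ 0)
    (hs : Summable fun i => |(k i : ℝ)| * (‖a i‖ ^ (m + 1))⁻¹) (hk : ∀ i, 0 ≤ k i) :
    Differentiable ℂ (canonicalProduct m a k) := fun s =>
  differentiableAt_canonicalProduct ha hs isOpen_univ
    (fun i hi => absurd hi (not_lt.2 (hk i))) (Set.mem_univ s)

theorem norm_canonicalProduct_le (ha : ∀ i, a i ≠ 0)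
    (hs : Summable fun i => |(k i : ℝ)| * (‖a i‖ ^ (m + 1))⁻¹) (hk : ∀ i, 0 ≤ k i) (s : ℂ) :
    ‖canonicalProduct m a k s‖ ≤ Real.exp ((m + 2) * 2 ^ (m + 1) *
      (∑' i, |(k i : ℝ)| * (‖a i‖ ^ (m + 1))⁻¹) * ‖s‖ ^ (m + 1)) := by
  have h1 := (multipliable_factor ha hs s).hasProd.norm
  refine le_of_tendsto h1 (Filter.Eventually.of_forall fun A => ?_)
  calc ∏ i ∈ A, ‖weierstrassFactor m (s / a i) ^ k i‖
      ≤ ∏ i ∈ A, Real.exp ((m + 2) * 2 ^ (m + 1) * ‖s‖ ^ (m + 1) *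
          (|(k i : ℝ)| * (‖a i‖ ^ (m + 1))⁻¹)) := by
        refine Finset.prod_le_prod (fun _ _ => norm_nonneg _) fun i _ => ?_
        obtain ⟨n, hn⟩ := Int.eq_ofNat_of_zero_le (hk i)
        rw [hn, zpow_natCast, norm_pow]
        refine (pow_le_pow_left₀ (norm_nonneg _) (norm_weierstrassFactor_le m _) n).trans ?_
        rw [← Real.exp_nat_mul, norm_div, div_pow]
        refine Real.exp_le_exp.2 (le_of_eq ?_)
        simp
        ring
    _ = Real.exp ((m + 2) * 2 ^ (m + 1) * ‖s‖ ^ (m + 1) *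
          ∑ i ∈ A, (|(k i : ℝ)| * (‖a i‖ ^ (m + 1))⁻¹)) := by
        rw [← Real.exp_sum, Finset.mul_sum]
    _ ≤ _ := by
        refine Real.exp_le_exp.2 ?_
        have := hs.sum_le_tsum A fun _ _ => by positivity
        calc _ ≤ (m + 2) * 2 ^ (m + 1) * ‖s‖ ^ (m + 1) *
            ∑' i, (|(k i : ℝ)| * (‖a i‖ ^ (m + 1))⁻¹) := by gcongr
          _ = _ := by ring

theorem logDeriv_factor (ha : ∀ i, a i ≠ 0) {s : ℂ} {i : ι} (h : k i ≠ 0 → s ≠ a i) :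
    logDeriv (fun s => weierstrassFactor m (s / a i) ^ k i) s =
      k i * ((s - a i)⁻¹ + ∑ j ∈ Finset.range m, s ^ j / a i ^ (j + 1)) := by
  rcases eq_or_ne (k i) 0 with hk | hk
  · simp [hk]
  have hd : DifferentiableAt ℂ (fun s => weierstrassFactor m (s / a i)) s :=
    ((differentiable_weierstrassFactor m).comp (differentiable_id.div_const _)) s
  have h1 : s / a i ≠ 1 := by rw [Ne, div_eq_one_iff_eq (ha i)]; exact h hk
  have h2 : logDeriv (fun s => weierstrassFactor m (s / a i)) s =
      logDeriv (weierstrassFactor m) (s / a i) * (a i)⁻¹ := by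
    have := logDeriv_comp (f := weierstrassFactor m) (g := fun s => s / a i) (x := s)
      (differentiable_weierstrassFactor m _) (differentiableAt_id.div_const _)
    rw [Function.comp_def] at this
    rw [this]
    simp
  rw [logDeriv_fun_zpow hd, h2, logDeriv_weierstrassFactor m h1]
  congr 1
  rw [add_mul, Finset.sum_mul]
  have hai := ha i
  have hsa : s - a i ≠ 0 := sub_ne_zero.2 (h hk)
  congr 1
  · rw [← mul_inv]
    congr 1
    field_simp
  · refine Finset.sum_congr rfl fun j _ => ?_
    rw [div_pow, pow_succ]
    field_simp

theorem hasSum_logDeriv_canonicalProduct (ha : ∀ i, a i ≠ 0)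
    (hs : Summable fun i => |(k i : ℝ)| * (‖a i‖ ^ (m + 1))⁻¹) {U : Set ℂ} (hUo : IsOpen U)
    (hU : ∀ i, k i ≠ 0 → ∀ s ∈ U, s ≠ a i) {s : ℂ} (hsU : s ∈ U) :
    HasSum (fun i => k i * ((s - a i)⁻¹ + ∑ j ∈ Finset.range m, s ^ j / a i ^ (j + 1)))
      (logDeriv (canonicalProduct m a k) s) := by
  have hVo : IsOpen (U ∩ Metric.ball 0 (‖s‖ + 1)) := hUo.inter Metric.isOpen_ball
  have hsV : s ∈ U ∩ Metric.ball 0 (‖s‖ + 1) := ⟨hsU, by simp⟩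
  have h1 := hasProdLocallyUniformlyOn_factor (U := U ∩ Metric.ball 0 (‖s‖ + 1)) ha hs hVo
    (fun i hi s hs => hU i hi.ne s hs.1) (R := ‖s‖ + 1) (by positivity)
    (fun s hs => (mem_ball_zero_iff.1 hs.2).le)
  rw [hasProdLocallyUniformlyOn_iff_tendstoLocallyUniformlyOn] at h1
  have hd : ∀ i, DifferentiableOn ℂ (fun s => weierstrassFactor m (s / a i) ^ k i)
      (U ∩ Metric.ball 0 (‖s‖ + 1)) := fun i =>
    differentiableOn_factor ha (fun hi s hs => hU i hi.ne s hs.1)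
  have h2 := Complex.logDeriv_tendsto hVo hsV h1 (Filter.Eventually.of_forall fun A =>
    DifferentiableOn.fun_finsetProd fun i _ => hd i)
    (canonicalProduct_ne_zero ha hs fun i hi => hU i hi s hsU)
  refine h2.congr fun A => ?_
  have h3 := logDeriv_prod (f := fun i s => weierstrassFactor m (s / a i) ^ k i) (s := A)
    (x := s) (fun i _ => factor_ne_zero ha fun hi => hU i hi s hsU)
    (fun i _ => (hd i s hsV).differentiableAt (hVo.mem_nhds hsV))
  rw [h3]
  exact Finset.sum_congr rfl fun i _ => logDeriv_factor ha fun hi => hU i hi s hsU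

/-- Splitting off the factor of index `i₀`. -/
theorem canonicalProduct_eq_mul_update [DecidableEq ι] (ha : ∀ i, a i ≠ 0)
    (hs : Summable fun i => |(k i : ℝ)| * (‖a i‖ ^ (m + 1))⁻¹) (i₀ : ι) (s : ℂ) :
    canonicalProduct m a k s =
      weierstrassFactor m (s / a i₀) ^ k i₀ *
        canonicalProduct m a (Function.update k i₀ 0) s := by
  have hs' : Summable fun i => |((Function.update k i₀ 0 i : ℤ) : ℝ)| * (‖a i‖ ^ (m + 1))⁻¹ := by
    refine hs.of_nonneg_of_le (fun _ => by positivity) fun i => ?_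
    rcases eq_or_ne i i₀ with rfl | h
    · simp; positivity
    · simp [Function.update_of_ne h]
  have h1 := (hasProd_ite_eq i₀ (weierstrassFactor m (s / a i₀) ^ k i₀)).mul
    (multipliable_factor ha hs' s).hasProd
  refine HasProd.tprod_eq ?_
  convert h1 using 2 with i
  swap
  · rfl
  rcases eq_or_ne i i₀ with rfl | h
  · simp
  · simp [h]

/-- A canonical product has a zero of order `k_i` at `a_i`. -/
theorem meromorphicOrderAt_canonicalProduct (ha : ∀ i, a i ≠ 0)
    (hs : Summable fun i => |(k i : ℝ)| * (‖a i‖ ^ (m + 1))⁻¹) (hk : ∀ i, 0 ≤ k i)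
    (hinj : Function.Injective a) (i₀ : ι) :
    meromorphicOrderAt (canonicalProduct m a k) (a i₀) = k i₀ := by
  classical
  have hs' : Summable fun i => |((Function.update k i₀ 0 i : ℤ) : ℝ)| * (‖a i‖ ^ (m + 1))⁻¹ := by
    refine hs.of_nonneg_of_le (fun _ => by positivity) fun i => ?_
    rcases eq_or_ne i i₀ with rfl | h
    · simp; positivity
    · simp [Function.update_of_ne h]
  have hk' : ∀ i, 0 ≤ Function.update k i₀ 0 i := fun i => by
    rcases eq_or_ne i i₀ with rfl | h
    · simp
    · simpa [Function.update_of_ne h] using hk i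
  have h1 : canonicalProduct m a k = (fun s => weierstrassFactor m (s / a i₀)) ^ k i₀ *
      canonicalProduct m a (Function.update k i₀ 0) := by
    ext s
    simp [canonicalProduct_eq_mul_update ha hs i₀ s]
  have hd : Differentiable ℂ fun s => weierstrassFactor m (s / a i₀) :=
    (differentiable_weierstrassFactor m).comp (differentiable_id.div_const _)
  have hE : AnalyticAt ℂ (fun s => weierstrassFactor m (s / a i₀)) (a i₀) := hd.analyticAt _
  have hP := (differentiable_canonicalProduct ha hs' hk').analyticAt (a i₀)
  have hP0 : meromorphicOrderAt (canonicalProduct m a (Function.update k i₀ 0)) (a i₀) = 0 := by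
    rw [hP.meromorphicOrderAt_eq, hP.analyticOrderAt_eq_zero.2]
    · rfl
    · refine canonicalProduct_ne_zero ha hs' fun i hi h => hi ?_
      rw [← hinj h]; simp
  have hE1 : meromorphicOrderAt (fun s => weierstrassFactor m (s / a i₀)) (a i₀) = (1 : ℤ) := by
    rw [meromorphicOrderAt_eq_int_iff hE.meromorphicAt]
    refine ⟨fun s => -(a i₀)⁻¹ * Complex.exp (∑ j ∈ Finset.Icc 1 m, (s / a i₀) ^ j / j), ?_, ?_, ?_⟩
    · refine Differentiable.analyticAt ?_ _
      fun_prop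
    · simpa using ha i₀
    · refine Filter.Eventually.of_forall fun s => ?_
      have := ha i₀
      simp only [weierstrassFactor, zpow_one, smul_eq_mul]
      field_simp
      ring
  rw [h1, meromorphicOrderAt_mul (hE.meromorphicAt.zpow _) hP.meromorphicAt, hP0, add_zero,
    meromorphicOrderAt_zpow hE.meromorphicAt, hE1]
  norm_cast
  simp

theorem meromorphicOrderAt_canonicalProduct_of_notMem (ha : ∀ i, a i ≠ 0)
    (hs : Summable fun i => |(k i : ℝ)| * (‖a i‖ ^ (m + 1))⁻¹) (hk : ∀ i, 0 ≤ k i)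
    {s : ℂ} (h : ∀ i, s ≠ a i) :
    meromorphicOrderAt (canonicalProduct m a k) s = 0 := by
  have hP := (differentiable_canonicalProduct ha hs hk).analyticAt s
  rw [hP.meromorphicOrderAt_eq, hP.analyticOrderAt_eq_zero.2
    (canonicalProduct_ne_zero ha hs fun i _ => h i)]
  rfl

end CanonicalProduct


/-! ### Functions of finite order -/

theorem mult_eq_divisor {f : ℂ → ℂ} (hf : Meromorphic f) (ρ : ℂ) :
    mult f ρ = MeromorphicOn.divisor f Set.univ ρ := by
  rw [MeromorphicOn.divisor_apply (hf.meromorphicOn) (Set.mem_univ ρ), mult]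

theorem finite_mult_ne_zero {f : ℂ → ℂ} (hf : Meromorphic f) (τ : ℂ) (R : ℝ) :
    {ρ : ℂ | mult f ρ ≠ 0 ∧ ‖ρ - τ‖ ≤ R}.Finite := by
  refine ((MeromorphicOn.divisor f (Metric.closedBall τ R)).finiteSupport
    (isCompact_closedBall τ R)).subset fun ρ hρ => ?_
  have h : ρ ∈ Metric.closedBall τ R := by simpa [dist_eq_norm] using hρ.2
  rw [Function.mem_support, MeromorphicOn.divisor_apply hf.meromorphicOn h]
  exact hρ.1

theorem HasFiniteOrder.inv {f : ℂ → ℂ} (hf : Meromorphic f) (h : HasFiniteOrder f) :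
    HasFiniteOrder f⁻¹ := by
  obtain ⟨A, hA⟩ := h
  refine ⟨A, ?_⟩
  have h1 := ValueDistribution.isBigO_characteristic_sub_characteristic_inv hf
  have h2 : (1 : ℝ → ℝ) =O[Filter.atTop] fun r : ℝ => r ^ A := by
    rw [Asymptotics.isBigO_iff]
    refine ⟨1, ?_⟩
    filter_upwards [Filter.eventually_ge_atTop 1] with r hr
    have : 1 ≤ r ^ A := one_le_pow₀ hr
    simp only [Pi.one_apply, norm_one, one_mul, Real.norm_eq_abs]
    exact this.trans (le_abs_self _)
  have h3 := hA.sub (h1.trans h2)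
  refine h3.congr_left fun r => ?_
  simp

theorem isBigO_pow_pow_of_le {A B : ℕ} (h : A ≤ B) :
    (fun r : ℝ => r ^ A) =O[Filter.atTop] fun r : ℝ => r ^ B := by
  rw [Asymptotics.isBigO_iff]
  refine ⟨1, ?_⟩
  filter_upwards [Filter.eventually_ge_atTop 1] with r hr
  rw [one_mul, norm_pow, norm_pow]
  refine pow_le_pow_right₀ ?_ h
  rw [Real.norm_eq_abs]
  exact hr.trans (le_abs_self r)

theorem HasFiniteOrder.mul {f g : ℂ → ℂ} (hf : Meromorphic f) (hg : Meromorphic g)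
    (hf0 : ∀ z, meromorphicOrderAt f z ≠ ⊤) (hg0 : ∀ z, meromorphicOrderAt g z ≠ ⊤)
    (h : HasFiniteOrder f) (h' : HasFiniteOrder g) : HasFiniteOrder (f * g) := by
  obtain ⟨A, hA⟩ := h
  obtain ⟨B, hB⟩ := h'
  refine ⟨max A B, ?_⟩
  have h1 := (hA.trans (isBigO_pow_pow_of_le (le_max_left A B))).add
    (hB.trans (isBigO_pow_pow_of_le (le_max_right A B)))
  refine Asymptotics.IsBigO.trans ?_ h1
  rw [Asymptotics.isBigO_iff]
  refine ⟨1, ?_⟩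
  filter_upwards [Filter.eventually_ge_atTop 1] with r hr
  rw [one_mul, Real.norm_of_nonneg (ValueDistribution.characteristic_nonneg hr)]
  exact (ValueDistribution.characteristic_mul_top_le hr hf hf0 hg hg0).trans (le_abs_self _)

theorem HasFiniteOrder.congr {f g : ℂ → ℂ} (h : HasFiniteOrder f)
    (hfg : f =ᶠ[Filter.codiscrete ℂ] g) : HasFiniteOrder g := by
  obtain ⟨A, hA⟩ := h
  refine ⟨A, hA.congr' ?_ Filter.EventuallyEq.rfl⟩
  filter_upwards [Filter.eventually_gt_atTop 0] with r hr
  exact ValueDistribution.characteristic_congr_codiscrete hfg hr.ne'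

theorem logCounting_top_eq_zero {f : ℂ → ℂ} (hf : Differentiable ℂ f) :
    ValueDistribution.logCounting f ⊤ = 0 := by
  have h : AnalyticOnNhd ℂ f Set.univ := fun z _ => hf.analyticAt z
  have h1 := MeromorphicOn.AnalyticOnNhd.divisor_nonneg h
  rw [ValueDistribution.logCounting_top, negPart_eq_zero.2 h1, map_zero]

/-- An entire function with `log |f(s)| = O(|s| ^ A)` has finite order: its characteristic is the
circle average of `log⁺ |f|`. -/
theorem HasFiniteOrder.of_norm_le {f : ℂ → ℂ} (hf : Differentiable ℂ f) {C : ℝ} {A : ℕ}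
    (h : ∀ s, ‖f s‖ ≤ Real.exp (C * (1 + ‖s‖) ^ A)) : HasFiniteOrder f := by
  have hC : 0 ≤ max C 0 := le_max_right _ _
  refine ⟨A, ?_⟩
  rw [Asymptotics.isBigO_iff]
  refine ⟨max C 0 * 2 ^ A, ?_⟩
  filter_upwards [Filter.eventually_ge_atTop 1] with r hr
  have hm : Meromorphic f := fun z => (hf.analyticAt z).meromorphicAt
  rw [Real.norm_of_nonneg (ValueDistribution.characteristic_nonneg hr),
    ValueDistribution.characteristic, logCounting_top_eq_zero hf, add_zero,
    ValueDistribution.proximity_top]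
  refine Real.circleAverage_mono_on_of_le_circle ?_ fun x hx => ?_
  · exact hm.meromorphicOn.circleIntegrable_posLog_norm
  · have hx' : ‖x‖ = r := by
      rw [mem_sphere_zero_iff_norm, abs_of_nonneg (by linarith)] at hx
      exact hx
    have h1 : ‖f x‖ ≤ Real.exp (max C 0 * (1 + ‖x‖) ^ A) := (h x).trans (by
      refine Real.exp_le_exp.2 ?_
      gcongr
      exact le_max_left _ _)
    have h2 : Real.posLog ‖f x‖ ≤ max C 0 * (1 + ‖x‖) ^ A := by
      refine (Real.posLog_le_posLog (norm_nonneg _) h1).trans ?_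
      rw [Real.posLog_eq_log, Real.log_exp]
      rw [abs_of_pos (Real.exp_pos _)]
      exact Real.one_le_exp (by positivity)
    refine h2.trans ?_
    rw [hx', Real.norm_of_nonneg (by positivity), mul_assoc, ← mul_pow]
    gcongr
    linarith

/-- The number of zeros and poles of a function of finite order in a disk of radius `R`, counted
with multiplicity, grows at most polynomially in `R`. -/
theorem exists_sum_mult_le {f : ℂ → ℂ} (hf : Meromorphic f) (h : HasFiniteOrder f) :
    ∃ (A : ℕ) (C R₀ : ℝ), ∀ R ≥ R₀, ∀ F : Finset ℂ, (∀ ρ ∈ F, ρ ≠ 0 ∧ ‖ρ‖ ≤ R) →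
      ∑ ρ ∈ F, |(mult f ρ : ℝ)| ≤ C * R ^ A := by
  obtain ⟨A, hA⟩ := h
  obtain ⟨B, hB⟩ := HasFiniteOrder.inv hf ⟨A, hA⟩
  obtain ⟨a, ha⟩ := (hA.trans (isBigO_pow_pow_of_le (le_max_left A B))).bound
  obtain ⟨b, hb⟩ := (hB.trans (isBigO_pow_pow_of_le (le_max_right A B))).bound
  obtain ⟨R₁, hR₁⟩ := Filter.eventually_atTop.1 (ha.and hb)
  -- a divisor `D ≥ 0` satisfies `log 2 * ∑_{‖ρ‖ ≤ R} D ρ ≤ N(2 R)`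
  have key : ∀ D : Function.locallyFinsupp ℂ ℤ, 0 ≤ D → ∀ R ≥ (1 : ℝ), ∀ F : Finset ℂ,
      (∀ ρ ∈ F, ρ ≠ 0 ∧ ‖ρ‖ ≤ R) →
      Real.log 2 * ∑ ρ ∈ F, (D ρ : ℝ) ≤ Function.locallyFinsuppWithin.logCounting D (2 * R) := by
    intro D hD R hR F hF
    have hD' : ∀ z, (0 : ℝ) ≤ D z := fun z => by exact_mod_cast hD z
    set g : ℂ → ℝ := fun z => (Function.locallyFinsuppWithin.toClosedBall (2 * R) D z : ℝ) *
      Real.log (2 * R * ‖z‖⁻¹) with hg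
    have hgnn : ∀ z, 0 ≤ g z := by
      intro z
      by_cases hz : z ∈ Metric.closedBall (0 : ℂ) |2 * R|
      · rw [hg]
        simp only
        rw [Function.locallyFinsuppWithin.toClosedBall_eval_within D hz]
        rcases eq_or_ne z 0 with rfl | hz0
        · simp
        refine mul_nonneg (hD' z) (Real.log_nonneg ?_)
        rw [mem_closedBall_zero_iff, abs_of_nonneg (by linarith)] at hz
        rw [← div_eq_mul_inv, one_le_div (norm_pos_iff.2 hz0)]
        exact hz
      · rw [hg]
        simp only
        rw [Function.locallyFinsuppWithin.apply_eq_zero_of_notMem _ hz]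
        simp
    have hfin : g.support.Finite := by
      refine ((Function.locallyFinsuppWithin.toClosedBall (2 * R) D).finiteSupport
        (isCompact_closedBall 0 |2 * R|)).subset fun z hz => ?_
      rw [Function.mem_support] at hz ⊢
      intro h0
      exact hz (by simp [hg, h0])
    have h1 : Function.locallyFinsuppWithin.logCounting D (2 * R) =
        ∑ᶠ z, g z + (D 0) * Real.log (2 * R) := rfl
    rw [h1, finsum_eq_sum_of_support_subset (s := hfin.toFinset ∪ F) g
      (by intro z hz; simp only [Finset.coe_union, Set.mem_union]; left; simpa using hz)]
    have h2 : Real.log 2 * ∑ ρ ∈ F, (D ρ : ℝ) ≤ ∑ ρ ∈ F, g ρ := by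
      rw [Finset.mul_sum]
      refine Finset.sum_le_sum fun ρ hρ => ?_
      obtain ⟨h0, hle⟩ := hF ρ hρ
      have hpos := norm_pos_iff.2 h0
      have hz : ρ ∈ Metric.closedBall (0 : ℂ) |2 * R| := by
        rw [mem_closedBall_zero_iff, abs_of_nonneg (by linarith)]; linarith
      simp only [hg]
      rw [Function.locallyFinsuppWithin.toClosedBall_eval_within D hz, mul_comm]
      refine mul_le_mul_of_nonneg_left (Real.log_le_log (by norm_num) ?_) (hD' ρ)
      rw [← div_eq_mul_inv, le_div_iff₀ hpos]
      linarith
    have h3 : ∑ ρ ∈ F, g ρ ≤ ∑ z ∈ hfin.toFinset ∪ F, g z :=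
      Finset.sum_le_sum_of_subset_of_nonneg Finset.subset_union_right fun z _ _ => hgnn z
    have h4 : 0 ≤ (D 0 : ℝ) * Real.log (2 * R) :=
      mul_nonneg (hD' 0) (Real.log_nonneg (by linarith))
    linarith
  set D := MeromorphicOn.divisor f Set.univ with hDdef
  have hlog2 : 0 < Real.log 2 := Real.log_pos (by norm_num)
  refine ⟨max A B, (a + b) * 2 ^ max A B / Real.log 2, max R₁ 1, fun R hR F hF => ?_⟩
  have hR1 : 1 ≤ R := (le_max_right _ _).trans hR
  have hR2 : R₁ ≤ 2 * R := ((le_max_left _ _).trans hR).trans (by linarith)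
  have e1 := key D⁺ (posPart_nonneg D) R hR1 F hF
  have e2 := key D⁻ (negPart_nonneg D) R hR1 F hF
  have t1 : Function.locallyFinsuppWithin.logCounting D⁻ (2 * R) ≤ a * (2 * R) ^ max A B := by
    have := (hR₁ _ hR2).1
    rw [Real.norm_of_nonneg (by positivity : 0 ≤ (2 * R) ^ max A B)] at this
    refine le_trans ?_ ((le_abs_self _).trans this)
    rw [ValueDistribution.characteristic, ValueDistribution.logCounting_top, Pi.add_apply]
    have := ValueDistribution.proximity_nonneg (f := f) (a := ⊤) (2 * R)
    simp only [Pi.zero_apply] at this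
    linarith
  have t2 : Function.locallyFinsuppWithin.logCounting D⁺ (2 * R) ≤ b * (2 * R) ^ max A B := by
    have := (hR₁ _ hR2).2
    rw [Real.norm_of_nonneg (by positivity : 0 ≤ (2 * R) ^ max A B)] at this
    refine le_trans ?_ ((le_abs_self _).trans this)
    rw [ValueDistribution.characteristic, ValueDistribution.logCounting_top, Pi.add_apply,
      MeromorphicOn.divisor_inv, negPart_neg]
    have := ValueDistribution.proximity_nonneg (f := f⁻¹) (a := ⊤) (2 * R)
    simp only [Pi.zero_apply] at this
    linarith
  have e3 : ∑ ρ ∈ F, |(mult f ρ : ℝ)| = ∑ ρ ∈ F, ((D⁺ ρ : ℤ) : ℝ) + ∑ ρ ∈ F, ((D⁻ ρ : ℤ) : ℝ) := by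
    rw [← Finset.sum_add_distrib]
    refine Finset.sum_congr rfl fun ρ _ => ?_
    rw [mult_eq_divisor hf, ← hDdef, Function.locallyFinsuppWithin.posPart_apply,
      Function.locallyFinsuppWithin.negPart_apply, ← Int.cast_abs, ← posPart_add_negPart]
    push_cast
    rfl
  rw [e3, div_mul_eq_mul_div, le_div_iff₀ hlog2]
  rw [mul_pow] at t1 t2
  linarith

/-- Summability of `|n_ρ| (1 + |ρ|)^{-d}` over the divisor of `f` does not see the centre and is
equivalent to summability of `|n_ρ| |ρ - τ|^{-d}` over `ρ ≠ τ`. -/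
theorem summable_mult_iff {f : ℂ → ℂ} (hf : Meromorphic f) (τ : ℂ) (d : ℕ) :
    (Summable fun ρ : {ρ : ℂ // ρ ≠ τ} => |(mult f ρ : ℝ)| * (‖(ρ : ℂ) - τ‖ ^ d)⁻¹) ↔
      Summable fun ρ : ℂ => |(mult f ρ : ℝ)| * ((1 + ‖ρ‖) ^ d)⁻¹ := by
  have h1 : (Summable fun ρ : ℂ => |(mult f ρ : ℝ)| * ((1 + ‖ρ‖) ^ d)⁻¹) ↔
      Summable fun ρ : {ρ : ℂ // ρ ≠ τ} => |(mult f ρ : ℝ)| * ((1 + ‖(ρ : ℂ)‖) ^ d)⁻¹ :=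
    ((Set.finite_singleton τ).summable_compl_iff
      (f := fun ρ : ℂ => |(mult f ρ : ℝ)| * ((1 + ‖ρ‖) ^ d)⁻¹)).symm
  rw [h1]
  constructor
  · intro h
    refine (h.mul_left ((1 + ‖τ‖) ^ d)).of_nonneg_of_le (fun _ => by positivity) fun ρ => ?_
    have hpos : 0 < ‖(ρ : ℂ) - τ‖ := norm_pos_iff.2 (sub_ne_zero.2 ρ.2)
    rw [mul_left_comm]
    refine mul_le_mul_of_nonneg_left ?_ (abs_nonneg _)
    rw [inv_le_comm₀ (by positivity) (by positivity), mul_inv, inv_inv, inv_mul_le_iff₀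
      (by positivity), ← mul_pow]
    refine pow_le_pow_left₀ hpos.le ?_ d
    nlinarith [norm_sub_le (ρ : ℂ) τ, norm_nonneg (ρ : ℂ), norm_nonneg τ]
  · intro h
    refine Summable.of_norm_bounded_eventually (h.mul_left ((2 + ‖τ‖) ^ d)) ?_
    have hfin : {ρ : {ρ : ℂ // ρ ≠ τ} | mult f ρ ≠ 0 ∧ ‖(ρ : ℂ) - τ‖ ≤ 1}.Finite :=
      (finite_mult_ne_zero hf τ 1).preimage Subtype.val_injective.injOn
    filter_upwards [hfin.compl_mem_cofinite] with ρ hρ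
    rw [Real.norm_of_nonneg (by positivity)]
    have hpos : 0 < ‖(ρ : ℂ) - τ‖ := norm_pos_iff.2 (sub_ne_zero.2 ρ.2)
    by_cases h0 : mult f ρ = 0
    · simp [h0]
    have h1 : 1 < ‖(ρ : ℂ) - τ‖ := by
      by_contra hle
      exact hρ ⟨h0, not_lt.1 hle⟩
    rw [mul_left_comm]
    refine mul_le_mul_of_nonneg_left ?_ (abs_nonneg _)
    rw [inv_le_comm₀ (by positivity) (by positivity), mul_inv, inv_inv, inv_mul_le_iff₀
      (by positivity), ← mul_pow]
    refine pow_le_pow_left₀ (by positivity) ?_ d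
    have h2 : ‖(ρ : ℂ)‖ ≤ ‖(ρ : ℂ) - τ‖ + ‖τ‖ := by
      simpa using norm_add_le ((ρ : ℂ) - τ) τ
    nlinarith [norm_nonneg τ]

theorem mem_convergenceExponents_iff {f : ℂ → ℂ} (hf : Meromorphic f) (d : ℕ) :
    d ∈ convergenceExponents f ↔
      Summable fun ρ : ℂ => |(mult f ρ : ℝ)| * ((1 + ‖ρ‖) ^ d)⁻¹ := by
  rw [← summable_mult_iff hf 0 d]
  simp [convergenceExponents]

/-- If the divisor has `O(R ^ A)` points in the disk of radius `R`, then `A + 2` is a convergence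
exponent. -/
theorem convergenceExponents_nonempty {f : ℂ → ℂ} (hf : Meromorphic f) (h : HasFiniteOrder f) :
    (convergenceExponents f).Nonempty := by
  obtain ⟨A, C, R₀, hC⟩ := exists_sum_mult_le hf h
  refine ⟨A + 2, ?_⟩
  obtain ⟨N, hN⟩ := exists_nat_ge (max R₀ 1)
  have hN1 : 1 ≤ (N : ℝ) := (le_max_right _ _).trans hN
  have hNR : R₀ ≤ N := (le_max_left _ _).trans hN
  -- group the `ρ` by the least integer `k ≥ N` with `|ρ| ≤ k`
  set κ : ℂ → ℕ := fun ρ => max N ⌈‖ρ‖⌉₊ with hκ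
  have hκN : ∀ ρ, N ≤ κ ρ := fun ρ => le_max_left _ _
  have hκρ : ∀ ρ, ‖ρ‖ ≤ κ ρ := fun ρ =>
    (Nat.le_ceil _).trans (by exact_mod_cast le_max_right N _)
  have hκle : ∀ ρ, (κ ρ : ℝ) ≤ (N + 1) * (1 + ‖ρ‖) := fun ρ => by
    have h1 : (κ ρ : ℝ) ≤ N + ⌈‖ρ‖⌉₊ := by
      exact_mod_cast max_le (Nat.le_add_right _ _) (Nat.le_add_left _ _)
    have h2 := Nat.ceil_lt_add_one (norm_nonneg ρ)
    nlinarith [norm_nonneg ρ]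
  have hsum : Summable fun k : ℕ => |C| * ((k : ℝ) ^ 2)⁻¹ :=
    (Real.summable_nat_pow_inv.2 (by norm_num)).mul_left _
  have key : Summable fun ρ : {ρ : ℂ // ρ ≠ 0} =>
      |(mult f ρ : ℝ)| * (((κ ρ : ℕ) : ℝ) ^ (A + 2))⁻¹ := by
    refine summable_of_sum_le (c := ∑' k : ℕ, |C| * ((k : ℝ) ^ 2)⁻¹)
      (fun _ => by positivity) fun F => ?_
    classical
    rw [← Finset.sum_fiberwise_of_maps_to (s := F)
      (t := F.image fun ρ : {ρ : ℂ // ρ ≠ 0} => κ ρ)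
      (g := fun ρ : {ρ : ℂ // ρ ≠ 0} => κ ρ) (fun ρ hρ => Finset.mem_image_of_mem _ hρ)]
    refine le_trans (Finset.sum_le_sum fun k hk => ?_) (hsum.sum_le_tsum
      (F.image fun ρ : {ρ : ℂ // ρ ≠ 0} => κ ρ) fun _ _ => by positivity)
    obtain ⟨ρ₀, -, hρ₀⟩ := Finset.mem_image.1 hk
    have hkN : (N : ℝ) ≤ k := by rw [← hρ₀]; exact_mod_cast hκN ρ₀
    have hk0 : (0 : ℝ) < k := by linarith
    have h1 : ∑ ρ ∈ F.filter (fun ρ : {ρ : ℂ // ρ ≠ 0} => κ ρ = k), |(mult f ρ : ℝ)| ≤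
        C * (k : ℝ) ^ A := by
      have := hC k (hNR.trans hkN)
        ((F.filter fun ρ : {ρ : ℂ // ρ ≠ 0} => κ ρ = k).map
          (Function.Embedding.subtype _))
        (by
          intro ρ hρ
          obtain ⟨ρ', hρ', rfl⟩ := Finset.mem_map.1 hρ
          refine ⟨ρ'.2, ?_⟩
          rw [← (Finset.mem_filter.1 hρ').2]
          exact hκρ _)
      rw [Finset.sum_map] at this
      exact this
    calc ∑ ρ ∈ F.filter (fun ρ : {ρ : ℂ // ρ ≠ 0} => κ ρ = k),
          |(mult f ρ : ℝ)| * (((κ ρ : ℕ) : ℝ) ^ (A + 2))⁻¹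
        = (∑ ρ ∈ F.filter (fun ρ : {ρ : ℂ // ρ ≠ 0} => κ ρ = k), |(mult f ρ : ℝ)|) *
          ((k : ℝ) ^ (A + 2))⁻¹ := by
          rw [Finset.sum_mul]
          refine Finset.sum_congr rfl fun ρ hρ => ?_
          rw [(Finset.mem_filter.1 hρ).2]
      _ ≤ (C * (k : ℝ) ^ A) * ((k : ℝ) ^ (A + 2))⁻¹ := by gcongr
      _ = C * ((k : ℝ) ^ 2)⁻¹ := by
          rw [pow_add]
          field_simp
      _ ≤ |C| * ((k : ℝ) ^ 2)⁻¹ := by gcongr; exact le_abs_self C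
  rw [mem_convergenceExponents_iff hf]
  refine ((Set.finite_singleton (0 : ℂ)).summable_compl_iff
      (f := fun ρ : ℂ => |(mult f ρ : ℝ)| * ((1 + ‖ρ‖) ^ (A + 2))⁻¹)).1 ?_
  refine (key.mul_left (((N : ℝ) + 1) ^ (A + 2))).of_nonneg_of_le
    (fun ρ => mul_nonneg (abs_nonneg _) (inv_nonneg.2 (by positivity))) fun ρ => ?_
  have hκ0 : (0 : ℝ) < κ ρ := by
    have : (N : ℝ) ≤ κ ρ := by exact_mod_cast hκN ρ
    linarith
  rw [mul_left_comm]
  refine mul_le_mul_of_nonneg_left ?_ (abs_nonneg _)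
  have hN0 : (0 : ℝ) < N + 1 := by linarith
  have hρ0 : 0 < 1 + ‖(ρ : ℂ)‖ := by positivity
  rw [inv_le_comm₀ (pow_pos hρ0 _) (mul_pos (pow_pos hN0 _) (inv_pos.2 (pow_pos hκ0 _))),
    mul_inv, inv_inv, inv_mul_le_iff₀
    (pow_pos hN0 _), ← mul_pow]
  exact pow_le_pow_left₀ (by positivity) (hκle ρ) _


/-! ### Zero-free functions of finite order -/

open Complex in
/-- The `n`-th Taylor coefficient of an entire function, `n ≥ 1`, is controlled by the mean of the
absolute value of the real part over any circle: the mean of `z⁻ⁿ` times the conjugate of the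
function vanishes. -/
theorem norm_circleAverage_le_re {h : ℂ → ℂ} (hh : Differentiable ℂ h) {n : ℕ} (hn : n ≠ 0)
    {r : ℝ} (hr : 0 < r) :
    ‖Real.circleAverage (fun z => (z ^ n)⁻¹ * h z) 0 r‖ ≤
      2 * (r ^ n)⁻¹ * Real.circleAverage (fun z => |(h z).re|) 0 r := by
  have hsph : ∀ z ∈ Metric.sphere (0 : ℂ) |r|, ‖z‖ = r := by
    intro z hz
    rwa [mem_sphere_zero_iff_norm, abs_of_pos hr] at hz
  have hcont : Continuous h := hh.continuous
  have hint : ∀ F : ℂ → ℂ, ContinuousOn F (Metric.sphere 0 |r|) → CircleIntegrable F 0 r :=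
    fun F hF => ContinuousOn.circleIntegrable' hF
  have hne : ∀ z ∈ Metric.sphere (0 : ℂ) |r|, z ^ n ≠ 0 := fun z hz => by
    refine pow_ne_zero _ fun h0 => ?_
    have := hsph z hz
    rw [h0, norm_zero] at this
    exact hr.ne this
  have hc1 : ContinuousOn (fun z : ℂ => (z ^ n)⁻¹) (Metric.sphere 0 |r|) :=
    ContinuousOn.inv₀ (by fun_prop) hne
  have hc2 : Continuous fun z => (starRingEnd ℂ) (h z) := continuous_conj.comp hcont
  -- the mean of `z⁻ⁿ conj (h z) = r⁻²ⁿ conj (zⁿ h z)` vanishes by the mean value property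
  have hzero : Real.circleAverage (fun z => (z ^ n)⁻¹ * (starRingEnd ℂ) (h z)) 0 r = 0 := by
    have e1 : Real.circleAverage (fun z => z ^ n * h z) 0 r = 0 := by
      have hd : Differentiable ℂ fun z => z ^ n * h z := by fun_prop
      rw [hd.diffContOnCl.circleAverage]
      simp [hn]
    have e2 : Real.circleAverage (fun z => (starRingEnd ℂ) (z ^ n * h z)) 0 r = 0 := by
      have := ContinuousLinearMap.circleAverage_comp_comm (c := 0) (R := r)
        conjCLE.toContinuousLinearMap
        (f := fun z => z ^ n * h z) (hint _ (by fun_prop))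
      rw [e1, map_zero] at this
      exact this
    rw [Real.circleAverage_congr_sphere (f₂ := fun z => ((r : ℂ) ^ (2 * n))⁻¹ •
      (starRingEnd ℂ) (z ^ n * h z)), Real.circleAverage_fun_smul, e2, smul_zero]
    intro z hz
    have h1 : z * (starRingEnd ℂ) z = (r : ℂ) ^ 2 := by
      rw [mul_conj, normSq_eq_norm_sq, hsph z hz]
      push_cast
      rfl
    have h2 : z ^ n ≠ 0 := hne z hz
    have h3 : (starRingEnd ℂ) z ^ n ≠ 0 := by
      rw [← map_pow]; simpa using h2
    simp only [map_mul, map_pow, smul_eq_mul]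
    rw [pow_mul, ← h1, mul_pow]
    field_simp
  have hsum : Real.circleAverage (fun z => (z ^ n)⁻¹ * h z) 0 r =
      Real.circleAverage (fun z => (z ^ n)⁻¹ * (2 * ((h z).re : ℂ))) 0 r := by
    have h1 := Real.circleAverage_fun_add (c := 0) (R := r)
      (f₁ := fun z => (z ^ n)⁻¹ * h z) (f₂ := fun z => (z ^ n)⁻¹ * (starRingEnd ℂ) (h z))
      (hint _ (hc1.mul hcont.continuousOn)) (hint _ (hc1.mul hc2.continuousOn))
    rw [hzero, add_zero] at h1
    rw [← h1]
    congr 1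
    ext z
    rw [← mul_add, add_conj]
    push_cast
    rfl
  rw [hsum, Real.circleAverage_def, norm_smul, Real.circleAverage_def, smul_eq_mul,
    Real.norm_of_nonneg (by positivity), mul_left_comm]
  refine mul_le_mul_of_nonneg_left ?_ (by positivity)
  rw [← intervalIntegral.integral_const_mul]
  refine intervalIntegral.norm_integral_le_of_norm_le (by positivity)
    (Filter.Eventually.of_forall fun θ _ => ?_) ?_
  · have hz := circleMap_mem_sphere' (0 : ℂ) r θ
    rw [norm_mul, norm_inv, norm_pow, hsph _ hz, norm_mul, norm_real, Real.norm_eq_abs]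
    simp only [Complex.norm_ofNat]
    exact le_of_eq (by ring)
  · refine Continuous.intervalIntegrable ?_ _ _
    have : Continuous fun θ => h (circleMap 0 r θ) := hcont.comp (continuous_circleMap 0 r)
    fun_prop

/-- If `exp h` has finite order, then the entire function `h` is a polynomial. -/
theorem exists_polynomial_of_hasFiniteOrder_exp {h : ℂ → ℂ} (hh : Differentiable ℂ h)
    (hord : HasFiniteOrder fun s => Complex.exp (h s)) :
    ∃ Q : Polynomial ℂ, ∀ s, h s = Q.eval s := by
  have hexp : Differentiable ℂ fun s => Complex.exp (h s) := hh.cexp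
  have hmer : Meromorphic fun s => Complex.exp (h s) := fun z => (hexp.analyticAt z).meromorphicAt
  obtain ⟨A, hA⟩ := hord
  obtain ⟨B, hB⟩ := HasFiniteOrder.inv hmer ⟨A, hA⟩
  obtain ⟨a, ha⟩ := (hA.trans (isBigO_pow_pow_of_le (le_max_left A B))).bound
  obtain ⟨b, hb⟩ := (hB.trans (isBigO_pow_pow_of_le (le_max_right A B))).bound
  have hre : ∀ᶠ r : ℝ in Filter.atTop,
      Real.circleAverage (fun z => |(h z).re|) 0 r ≤ (a + b) * r ^ max A B := by
    filter_upwards [ha, hb, Filter.eventually_ge_atTop 1] with r hra hrb hr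
    have hr0 : (0 : ℝ) ≤ r := by linarith
    rw [Real.norm_of_nonneg (ValueDistribution.characteristic_nonneg hr), Real.norm_of_nonneg
      (by positivity)] at hra hrb
    have e1 : Real.circleAverage (fun z => |(h z).re|) 0 r =
        ValueDistribution.proximity (fun s => Complex.exp (h s)) ⊤ r +
          ValueDistribution.proximity (fun s => Complex.exp (h s))⁻¹ ⊤ r := by
      rw [ValueDistribution.proximity_top, ValueDistribution.proximity_top,
        ← Real.circleAverage_fun_add hmer.meromorphicOn.circleIntegrable_posLog_norm
          (hmer.inv.meromorphicOn.circleIntegrable_posLog_norm)]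
      congr 1
      ext z
      rw [Pi.inv_apply, norm_inv, Complex.norm_exp, Real.posLog, Real.posLog, Real.log_inv,
        Real.log_exp]
      rcases le_total 0 (h z).re with h0 | h0
      · rw [max_eq_right h0, max_eq_left (by linarith), abs_of_nonneg h0, add_zero]
      · rw [max_eq_left h0, max_eq_right (by linarith), abs_of_nonpos h0, zero_add]
    have e2 := ValueDistribution.logCounting_nonneg (f := fun s => Complex.exp (h s)) (e := ⊤) hr
    have e3 := ValueDistribution.logCounting_nonneg (f := (fun s => Complex.exp (h s))⁻¹)
      (e := ⊤) hr
    rw [ValueDistribution.characteristic, Pi.add_apply] at hra hrb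
    rw [e1]
    linarith
  have hps := hh.hasFPowerSeriesOnBall 0 (R := 1) one_pos
  set p := cauchyPowerSeries h 0 ((1 : NNReal) : ℝ) with hp
  have hcoeff : ∀ (n : ℕ) (r : ℝ), 0 < r →
      (p n fun _ => 1) = Real.circleAverage (fun z => (z ^ n)⁻¹ * h z) 0 r := by
    intro n r hr
    lift r to NNReal using hr.le
    have h1 := hh.hasFPowerSeriesOnBall 0 (R := r) (by exact_mod_cast hr)
    rw [hps.hasFPowerSeriesAt.eq_formalMultilinearSeries h1.hasFPowerSeriesAt,
      cauchyPowerSeries_apply, Real.circleAverage_eq_circleIntegral hr.ne']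
    congr 2
    ext z
    simp only [sub_zero, smul_eq_mul, one_div, inv_pow]
    ring
  have hzero : ∀ n, max A B < n → (p n fun _ => 1) = 0 := by
    intro n hn
    have hlim : Filter.Tendsto (fun r : ℝ => 2 * (a + b) * (r ^ (n - max A B))⁻¹) Filter.atTop
        (𝓝 (2 * (a + b) * 0)) :=
      (tendsto_inv_atTop_zero.comp (Filter.tendsto_pow_atTop (by omega))).const_mul _
    rw [mul_zero] at hlim
    refine norm_le_zero_iff.1 (ge_of_tendsto hlim ?_)
    filter_upwards [hre, Filter.eventually_gt_atTop 0] with r hr hr0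
    rw [hcoeff n r hr0]
    refine (norm_circleAverage_le_re hh (by omega) hr0).trans ?_
    have e : r ^ n = r ^ (n - max A B) * r ^ max A B := by rw [← pow_add]; congr 1; omega
    calc 2 * (r ^ n)⁻¹ * Real.circleAverage (fun z => |(h z).re|) 0 r
        ≤ 2 * (r ^ n)⁻¹ * ((a + b) * r ^ max A B) := by gcongr
      _ = _ := by rw [e]; field_simp
  refine ⟨∑ n ∈ Finset.range (max A B + 1), Polynomial.monomial n (p n fun _ => 1), fun s => ?_⟩
  have h1 := hps.hasSum (y := s) (by simp)
  rw [zero_add] at h1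
  have h2 : ∀ n, (p n fun _ => s) = (p n fun _ => 1) * s ^ n := by
    intro n
    have := (p n).map_smul_univ (fun _ => s) (fun _ => (1 : ℂ))
    simp only [smul_eq_mul, mul_one, Finset.prod_const, Finset.card_univ, Fintype.card_fin] at this
    rw [this, mul_comm]
  simp_rw [h2] at h1
  have h3 := hasSum_sum_of_ne_finset_zero (L := .unconditional ℕ)
    (f := fun n => (p n fun _ => 1) * s ^ n)
    (s := Finset.range (max A B + 1)) (fun n hn => by
      rw [Finset.mem_range, not_lt] at hn
      rw [hzero n (by omega), zero_mul])
  rw [h1.unique h3, Polynomial.eval_finsetSum]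
  simp only [Polynomial.eval_monomial]

/-- A zero-free entire function has an entire logarithm, a primitive of its logarithmic
derivative. -/
theorem exists_exp_eq_of_differentiable {g : ℂ → ℂ} (hg : Differentiable ℂ g)
    (h0 : ∀ z, g z ≠ 0) : ∃ h : ℂ → ℂ, Differentiable ℂ h ∧ ∀ z, g z = Complex.exp (h z) := by
  have hd : Differentiable ℂ fun z => deriv g z / g z :=
    (hg.contDiff (n := 2)|>.differentiable_deriv_two).div hg h0
  obtain ⟨H, hH0, hH⟩ := (hd.isExactOn_univ).with_val_at 0 (Complex.log (g 0))
  have hH' : ∀ z, HasDerivAt H (deriv g z / g z) z := fun z => hH z (Set.mem_univ z)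
  refine ⟨H, fun z => (hH' z).differentiableAt, fun z => ?_⟩
  have h1 : ∀ z, HasDerivAt (fun z => g z * Complex.exp (-H z)) 0 z := by
    intro z
    refine ((hg z).hasDerivAt.mul (hH' z).neg.cexp).congr_deriv ?_
    have := h0 z
    field_simp
    ring
  have h2 := is_const_of_deriv_eq_zero (fun z => (h1 z).differentiableAt)
    (fun z => (h1 z).deriv) z 0
  rw [hH0, Complex.exp_neg, Complex.exp_neg, Complex.exp_log (h0 0), mul_inv_cancel₀ (h0 0)] at h2
  exact (mul_inv_eq_one₀ (Complex.exp_ne_zero _)).1 h2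

/-! ### The Hadamard factorization -/

/-- Zeros (`ε = 1`) and poles (`ε = -1`) taken separately satisfy the summability condition. -/
theorem summable_max_mult {f : ℂ → ℂ} (hf : Meromorphic f) {m : ℕ}
    (hm : m + 1 ∈ convergenceExponents f) (τ : ℂ) (ε : ℤ) (hε : |ε| = 1) :
    Summable fun ρ : {ρ : ℂ // ρ ≠ τ} =>
      |((max (ε * mult f ρ) 0 : ℤ) : ℝ)| * (‖(ρ : ℂ) - τ‖ ^ (m + 1))⁻¹ := by
  rw [mem_convergenceExponents_iff hf, ← summable_mult_iff hf τ] at hm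
  refine hm.of_nonneg_of_le (fun _ => by positivity) fun ρ => ?_
  refine mul_le_mul_of_nonneg_right ?_ (by positivity)
  rw [← Int.cast_abs, ← Int.cast_abs]
  refine Int.cast_le.2 ?_
  rw [abs_of_nonneg (le_max_right _ _)]
  refine max_le ((le_abs_self _).trans ?_) (abs_nonneg _)
  rw [abs_mul, hε, one_mul]

theorem hasFiniteOrder_sub_const_pow (τ : ℂ) (n : ℕ) :
    HasFiniteOrder ((fun s => s - τ) ^ n) := by
  refine HasFiniteOrder.of_norm_le (C := n * (1 + ‖τ‖)) (A := 1) (by fun_prop) fun s => ?_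
  have h1 : ‖s - τ‖ ≤ Real.exp ((1 + ‖τ‖) * (1 + ‖s‖)) := by
    have h2 : ‖s - τ‖ ≤ (1 + ‖τ‖) * (1 + ‖s‖) := by
      nlinarith [norm_sub_le s τ, norm_nonneg s, norm_nonneg τ]
    refine h2.trans ?_
    linarith [Real.add_one_le_exp ((1 + ‖τ‖) * (1 + ‖s‖))]
  rw [Pi.pow_apply, norm_pow]
  refine (pow_le_pow_left₀ (norm_nonneg _) h1 n).trans (le_of_eq ?_)
  rw [← Real.exp_nat_mul, pow_one, mul_assoc]

theorem meromorphicOrderAt_sub_const_ne_top (τ z : ℂ) :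
    meromorphicOrderAt (fun s => s - τ) z ≠ ⊤ := by
  have hd : AnalyticAt ℂ (fun s => s - τ) z := by fun_prop
  rcases eq_or_ne z τ with rfl | h
  · simp
  · rw [hd.meromorphicOrderAt_eq, hd.analyticOrderAt_eq_zero.2 (sub_ne_zero.2 h)]
    simp

theorem hasFiniteOrder_sub_const_zpow (τ : ℂ) (n : ℤ) :
    HasFiniteOrder ((fun s => s - τ) ^ n) := by
  obtain ⟨k, rfl | rfl⟩ := n.eq_nat_or_neg
  · simpa using hasFiniteOrder_sub_const_pow τ k
  · rw [zpow_neg, zpow_natCast]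
    exact HasFiniteOrder.inv (fun z => by fun_prop) (hasFiniteOrder_sub_const_pow τ k)

/-- Hadamard factorization: dividing `f` by its canonical products over zeros and poles leaves a
zero-free entire function of finite order, hence the exponential of a polynomial. -/
theorem exists_hadamard {f : ℂ → ℂ} (hf : Meromorphic f)
    (h0 : ∀ z, meromorphicOrderAt f z ≠ ⊤) (hord : HasFiniteOrder f) {m : ℕ}
    (hm : m + 1 ∈ convergenceExponents f) (τ : ℂ) :
    ∃ Q : Polynomial ℂ, ∀ᶠ s in Filter.codiscrete ℂ, ∃ p : ℂ,
      HasProd (fun ρ : {ρ : ℂ // ρ ≠ τ} =>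
        weierstrassFactor m ((s - τ) / (ρ - τ)) ^ mult f ρ) p ∧
      f s = (s - τ) ^ mult f τ * Complex.exp (Q.eval s) * p := by
  set a : {ρ : ℂ // ρ ≠ τ} → ℂ := fun ρ => ρ - τ with hadef
  have ha : ∀ ρ, a ρ ≠ 0 := fun ρ => sub_ne_zero.2 ρ.2
  have hinj : Function.Injective a := fun ρ ρ' h => Subtype.ext (sub_left_injective h)
  -- the canonical product over the zeros (`ε = 1`) or over the poles (`ε = -1`)
  set k : ℤ → {ρ : ℂ // ρ ≠ τ} → ℤ := fun ε ρ => max (ε * mult f ρ) 0 with hkdef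
  set P : ℤ → ℂ → ℂ := fun ε => canonicalProduct m a (k ε) ∘ (· - τ) with hPdef
  have hk : ∀ ε ρ, 0 ≤ k ε ρ := fun ε ρ => le_max_right _ _
  have hs : ∀ ε, |ε| = 1 → Summable fun ρ => |(k ε ρ : ℝ)| * (‖a ρ‖ ^ (m + 1))⁻¹ := fun ε hε =>
    summable_max_mult hf hm τ ε hε
  have hPd : ∀ ε, |ε| = 1 → Differentiable ℂ (P ε) := fun ε hε =>
    (differentiable_canonicalProduct ha (hs ε hε) (hk ε)).comp (differentiable_id.sub_const τ)
  have hPm : ∀ ε, |ε| = 1 → Meromorphic (P ε) := fun ε hε z =>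
    ((hPd ε hε).analyticAt z).meromorphicAt
  have hPo : ∀ ε, |ε| = 1 → ∀ z, meromorphicOrderAt (P ε) z =
      ((if z = τ then 0 else max (ε * mult f z) 0 : ℤ) : WithTop ℤ) := by
    intro ε hε z
    rw [hPdef]
    simp only
    rw [meromorphicOrderAt_comp_sub_const_eq_meromorphicOrderAt]
    split_ifs with hz
    · rw [hz, sub_self, meromorphicOrderAt_canonicalProduct_of_notMem ha (hs ε hε) (hk ε)
        fun ρ => (ha ρ).symm]
      rfl
    · exact meromorphicOrderAt_canonicalProduct ha (hs ε hε) (hk ε) hinj ⟨z, hz⟩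
  have hPt : ∀ ε, |ε| = 1 → ∀ z, meromorphicOrderAt (P ε) z ≠ ⊤ := fun ε hε z => by
    rw [hPo ε hε]; exact WithTop.coe_ne_top
  have hPord : ∀ ε, |ε| = 1 → HasFiniteOrder (P ε) := by
    intro ε hε
    refine HasFiniteOrder.of_norm_le (hPd ε hε) (A := m + 1)
      (C := ((m + 2) * 2 ^ (m + 1) * (∑' ρ, |(k ε ρ : ℝ)| * (‖a ρ‖ ^ (m + 1))⁻¹)) *
        (1 + ‖τ‖) ^ (m + 1)) fun s => ?_
    refine (norm_canonicalProduct_le ha (hs ε hε) (hk ε) (s - τ)).trans (Real.exp_le_exp.2 ?_)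
    rw [mul_assoc _ ((1 + ‖τ‖) ^ (m + 1)), ← mul_pow]
    have hS : 0 ≤ ∑' ρ, |(k ε ρ : ℝ)| * (‖a ρ‖ ^ (m + 1))⁻¹ :=
      tsum_nonneg fun _ => by positivity
    gcongr
    nlinarith [norm_sub_le s τ, norm_nonneg s, norm_nonneg τ]
  have h1 : |(1 : ℤ)| = 1 := abs_one
  have h2 : |(-1 : ℤ)| = 1 := by simp
  set L : ℂ → ℂ := (fun s => s - τ) ^ (-mult f τ) with hLdef
  have hLm : Meromorphic L := fun z => by rw [hLdef]; fun_prop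
  have hidm : ∀ z, MeromorphicAt (fun s : ℂ => s - τ) z := fun z => by fun_prop
  have hLo : ∀ z, meromorphicOrderAt L z = ((if z = τ then -mult f τ else 0 : ℤ) : WithTop ℤ) := by
    intro z
    split_ifs with hz
    · rw [hLdef, hz]; exact meromorphicOrderAt_zpow_id_sub_const
    · have hd : AnalyticAt ℂ (fun s => s - τ) z := by fun_prop
      rw [hLdef, meromorphicOrderAt_zpow (hidm z), hd.meromorphicOrderAt_eq,
        hd.analyticOrderAt_eq_zero.2 (sub_ne_zero.2 hz)]
      simp
  have hLt : ∀ z, meromorphicOrderAt L z ≠ ⊤ := fun z => by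
    rw [hLo]; exact WithTop.coe_ne_top
  have hPim : Meromorphic (P 1)⁻¹ := (hPm 1 h1).inv
  have hPio : ∀ z, meromorphicOrderAt (P 1)⁻¹ z =
      ((-(if z = τ then 0 else max (1 * mult f z) 0) : ℤ) : WithTop ℤ) := fun z => by
    rw [meromorphicOrderAt_inv, hPo 1 h1]; rfl
  have hPit : ∀ z, meromorphicOrderAt (P 1)⁻¹ z ≠ ⊤ := fun z => by
    rw [hPio]; exact WithTop.coe_ne_top
  set g : ℂ → ℂ := f * P (-1) * ((P 1)⁻¹ * L) with hg
  have hgm1 : Meromorphic (f * P (-1)) := hf.mul (hPm _ h2)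
  have hgm2 : Meromorphic ((P 1)⁻¹ * L) := hPim.mul hLm
  have hgm : Meromorphic g := hgm1.mul hgm2
  have ho1 : ∀ z, meromorphicOrderAt (f * P (-1)) z =
      meromorphicOrderAt f z + meromorphicOrderAt (P (-1)) z := fun z =>
    meromorphicOrderAt_mul (hf z) (hPm _ h2 z)
  have ho2 : ∀ z, meromorphicOrderAt ((P 1)⁻¹ * L) z =
      meromorphicOrderAt (P 1)⁻¹ z + meromorphicOrderAt L z := fun z =>
    meromorphicOrderAt_mul (hPim z) (hLm z)
  have hgo : ∀ z, meromorphicOrderAt g z = 0 := by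
    intro z
    have hfz : meromorphicOrderAt f z = (mult f z : ℤ) := (WithTop.coe_untop₀_of_ne_top (h0 z)).symm
    rw [hg, meromorphicOrderAt_mul (hgm1 z) (hgm2 z), ho1, ho2, hPo _ h2, hPio, hLo, hfz]
    norm_cast
    split_ifs with hz
    · rw [hz]; omega
    · omega
  have hgord : HasFiniteOrder g := by
    refine HasFiniteOrder.mul hgm1 hgm2 (fun z => ?_) (fun z => ?_)
      (HasFiniteOrder.mul hf (hPm _ h2) h0 (hPt _ h2) hord (hPord _ h2))
      (HasFiniteOrder.mul hPim hLm hPit hLt (HasFiniteOrder.inv (hPm 1 h1) (hPord 1 h1))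
        (hasFiniteOrder_sub_const_zpow τ _))
    · rw [ho1]; exact WithTop.add_ne_top.2 ⟨h0 z, hPt _ h2 z⟩
    · rw [ho2]; exact WithTop.add_ne_top.2 ⟨hPit z, hLt z⟩
  set G := toMeromorphicNFOn g Set.univ with hG
  have hGg : g =ᶠ[Filter.codiscrete ℂ] G := toMeromorphicNFOn_eqOn_codiscrete hgm.meromorphicOn
  have hGo : ∀ z, meromorphicOrderAt G z = 0 := fun z => by
    rw [hG, meromorphicOrderAt_toMeromorphicNFOn hgm.meromorphicOn (Set.mem_univ z), hgo]
  have hGnf : ∀ z, MeromorphicNFAt G z := fun z =>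
    meromorphicNFOn_toMeromorphicNFOn g Set.univ (Set.mem_univ z)
  have hGd : Differentiable ℂ G := fun z =>
    ((hGnf z).meromorphicOrderAt_nonneg_iff_analyticAt.1 (hGo z).ge).differentiableAt
  obtain ⟨H, hHd, hH⟩ := exists_exp_eq_of_differentiable hGd fun z =>
    (hGnf z).meromorphicOrderAt_eq_zero_iff.1 (hGo z)
  obtain ⟨Q, hQ⟩ := exists_polynomial_of_hasFiniteOrder_exp hHd
    (by simpa only [← hH] using hgord.congr hGg)
  refine ⟨Q, ?_⟩
  have hne : ∀ ε, |ε| = 1 → ∀ᶠ s in Filter.codiscrete ℂ, P ε s ≠ 0 := fun ε hε =>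
    ((hPm ε hε).meromorphicOn (s := Set.univ)).eventually_codiscreteWithin_apply_ne_zero
      fun z _ => hPt ε hε z
  have hne' : ∀ᶠ s in Filter.codiscrete ℂ, s - τ ≠ 0 :=
    (MeromorphicOn.eventually_codiscreteWithin_apply_ne_zero (U := Set.univ)
      (f := fun s => s - τ) (fun z _ => hidm z)
      fun z _ => meromorphicOrderAt_sub_const_ne_top τ z)
  filter_upwards [hGg, hne 1 h1, hne (-1) h2, hne'] with s hsg hs1 hs2 hsτ
  refine ⟨P 1 s / P (-1) s, ?_, ?_⟩
  · have := (multipliable_factor ha (hs 1 h1) (s - τ)).hasProd.div₀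
      (multipliable_factor ha (hs (-1) h2) (s - τ)).hasProd hs2
    have e : (fun ρ : {ρ : ℂ // ρ ≠ τ} => weierstrassFactor m ((s - τ) / (ρ - τ)) ^ mult f ρ) =
        fun ρ => weierstrassFactor m ((s - τ) / a ρ) ^ k 1 ρ /
          weierstrassFactor m ((s - τ) / a ρ) ^ k (-1) ρ := by
      funext ρ
      rcases le_total 0 (mult f ρ) with h | h
      · have hk1 : k 1 ρ = mult f ρ := by simp [hkdef, h]
        have hk2 : k (-1) ρ = 0 := by simp [hkdef, h]
        rw [hk1, hk2, zpow_zero, div_one]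
      · have hk1 : k 1 ρ = 0 := by simp [hkdef, h]
        have hk2 : k (-1) ρ = -mult f ρ := by simp [hkdef, h]
        rw [hk1, hk2, zpow_zero, zpow_neg, one_div, inv_inv]
    rw [e]
    exact this
  · have e1 : g s = Complex.exp (Q.eval s) := by rw [hsg, hH, hQ]
    rw [← e1, hg]
    simp only [Pi.mul_apply, Pi.inv_apply, hLdef, Pi.pow_apply, zpow_neg]
    have := zpow_ne_zero (mult f τ) hsτ
    field_simp


/-! ### The logarithm of a Dirichlet series -/

/-- The term `(|k|! / ∏ k_n!) ∏ x_n^{k_n}` of the multinomial expansion of `(∑ x_n) ^ |k|`. -/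
noncomputable def multinomialTerm (x : ℕ → ℂ) (k : ℕ →₀ ℕ) : ℂ :=
  ((k.degree.factorial : ℂ) / (k.prod fun _ j => (j.factorial : ℂ))) * k.prod fun n j => x n ^ j

theorem logCoeff_eq_multinomialTerm (x : ℕ → ℂ) (k : Index) :
    logCoeff x k = (-1) ^ k.1.degree / k.1.degree * multinomialTerm x k := by
  rw [logCoeff, multinomialTerm]; ring

theorem degree_eq_sum_of_support_subset (k : ℕ →₀ ℕ) {A : Finset ℕ} (h : k.support ⊆ A) :
    k.degree = ∑ n ∈ A, k n := by
  rw [Finsupp.degree_apply]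
  exact Finset.sum_subset h fun n _ hn => Finsupp.notMem_support_iff.1 hn

/-- The multinomial theorem. -/
theorem sum_multinomialTerm (x : ℕ → ℂ) (N p : ℕ) :
    ∑ k ∈ (Finset.range N).finsuppAntidiag p, multinomialTerm x k =
      (∑ n ∈ Finset.range N, x n) ^ p := by
  rw [Finset.sum_pow_eq_sum_piAntidiag]
  refine Finset.sum_bij' (fun k _ => ⇑k) (fun k hk => Finsupp.onFinset (Finset.range N) k
    (fun n hn => (Finset.mem_piAntidiag.1 hk).2 n hn)) ?_ ?_ ?_ ?_ ?_
  · intro k hk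
    rw [Finset.mem_finsuppAntidiag] at hk
    exact Finset.mem_piAntidiag.2 ⟨hk.1, fun i hi => hk.2 (Finsupp.mem_support_iff.2 hi)⟩
  · intro k hk
    rw [Finset.mem_piAntidiag] at hk
    exact Finset.mem_finsuppAntidiag.2 ⟨hk.1, Finsupp.support_onFinset_subset⟩
  · intro k hk; ext; rfl
  · intro k hk; rfl
  · intro k hk
    rw [Finset.mem_finsuppAntidiag] at hk
    have hd : k.degree = ∑ n ∈ Finset.range N, k n := by
      exact degree_eq_sum_of_support_subset k hk.2
    rw [multinomialTerm, hd, Finsupp.prod_of_support_subset _ hk.2 _ (by simp),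
      Finsupp.prod_of_support_subset _ hk.2 _ (by simp), ← Nat.multinomial_spec]
    have h : (∏ n ∈ Finset.range N, ((k n).factorial : ℂ)) ≠ 0 :=
      Finset.prod_ne_zero_iff.2 fun n _ => by exact_mod_cast (k n).factorial_ne_zero
    push_cast
    rw [mul_div_cancel_left₀ _ h]

/-- Absolute values can be put inside a multinomial term, so that absolute convergence follows
from the multinomial theorem for the `‖x_n‖`. -/
theorem norm_multinomialTerm (x : ℕ → ℂ) (k : ℕ →₀ ℕ) :
    ((‖multinomialTerm x k‖ : ℝ) : ℂ) = multinomialTerm (fun n => (‖x n‖ : ℂ)) k := by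
  simp [multinomialTerm, Finsupp.prod, norm_prod]

/-- The finite set of the `k` supported on `{0, …, N-1}` with `|k| ≤ N`. -/
noncomputable def truncatedIndex (N : ℕ) : Finset (ℕ →₀ ℕ) :=
  (Finset.range (N + 1)).biUnion fun p => (Finset.range N).finsuppAntidiag p

theorem mem_truncatedIndex {N : ℕ} {k : ℕ →₀ ℕ} :
    k ∈ truncatedIndex N ↔ k.support ⊆ Finset.range N ∧ k.degree ≤ N := by
  rw [truncatedIndex, Finset.mem_biUnion]
  constructor
  · rintro ⟨p, hp, hk⟩
    rw [Finset.mem_finsuppAntidiag] at hk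
    refine ⟨hk.2, ?_⟩
    rw [degree_eq_sum_of_support_subset k hk.2, hk.1]
    exact Nat.lt_succ_iff.1 (Finset.mem_range.1 hp)
  · rintro ⟨h1, h2⟩
    refine ⟨k.degree, Finset.mem_range.2 (Nat.lt_succ_iff.2 h2),
      Finset.mem_finsuppAntidiag.2 ⟨?_, h1⟩⟩
    rw [degree_eq_sum_of_support_subset k h1]

/-- The truncated index sets exhaust the index set, so that they compute unconditional sums. -/
theorem tendsto_truncatedIndex : Filter.Tendsto truncatedIndex Filter.atTop Filter.atTop := by
  refine Filter.tendsto_atTop_finset_of_monotone (fun M N h k hk => ?_) fun k => ?_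
  · rw [mem_truncatedIndex] at hk ⊢
    exact ⟨hk.1.trans (Finset.range_subset_range.2 h), hk.2.trans h⟩
  · obtain ⟨N, hN⟩ := k.support.exists_nat_subset_range
    exact ⟨max N k.degree, mem_truncatedIndex.2
      ⟨hN.trans (Finset.range_subset_range.2 (le_max_left _ _)), le_max_right _ _⟩⟩

theorem sum_truncatedIndex (c : ℕ → ℂ) (x : ℕ → ℂ) (N : ℕ) :
    ∑ k ∈ truncatedIndex N, c k.degree * multinomialTerm x k =
      ∑ p ∈ Finset.range (N + 1), c p * (∑ n ∈ Finset.range N, x n) ^ p := by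
  rw [truncatedIndex, Finset.sum_biUnion]
  · refine Finset.sum_congr rfl fun p _ => ?_
    rw [← sum_multinomialTerm, Finset.mul_sum]
    refine Finset.sum_congr rfl fun k hk => ?_
    rw [Finset.mem_finsuppAntidiag] at hk
    rw [degree_eq_sum_of_support_subset k hk.2, hk.1]
  · intro p _ q _ hpq
    refine Finset.disjoint_left.2 fun k hk hk' => hpq ?_
    rw [Finset.mem_finsuppAntidiag] at hk hk'
    exact hk.1.symm.trans hk'.1

/-- The partial sum over a truncated index set is a partial sum of the geometric series of
`∑ ‖x_n‖ < 1`. -/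
theorem summable_norm_multinomialTerm {x : ℕ → ℂ} {r : ℝ} (hx : Summable fun n => ‖x n‖)
    (hr : ∑' n, ‖x n‖ ≤ r) (hr1 : r < 1) : Summable fun k => ‖multinomialTerm x k‖ := by
  have hr0 : 0 ≤ r := (tsum_nonneg fun n => norm_nonneg _).trans hr
  refine summable_of_sum_le (c := (1 - r)⁻¹) (fun k => norm_nonneg _) fun A => ?_
  obtain ⟨N, hN⟩ := (tendsto_truncatedIndex.eventually_ge_atTop A).exists
  refine (Finset.sum_le_sum_of_subset_of_nonneg hN fun _ _ _ => norm_nonneg _).trans ?_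
  have h1 := sum_truncatedIndex (fun _ => 1) (fun n => (‖x n‖ : ℂ)) N
  simp only [one_mul, ← norm_multinomialTerm] at h1
  have h2 : ∑ k ∈ truncatedIndex N, ‖multinomialTerm x k‖ =
      ∑ p ∈ Finset.range (N + 1), (∑ n ∈ Finset.range N, ‖x n‖) ^ p := by exact_mod_cast h1
  rw [h2]
  calc _ ≤ ∑ p ∈ Finset.range (N + 1), r ^ p := by
        gcongr
        exact (hx.sum_le_tsum _ fun _ _ => norm_nonneg _).trans hr
    _ ≤ ∑' p, r ^ p := (summable_geometric_of_lt_one hr0 hr1).sum_le_tsum _ fun _ _ => by positivity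
    _ = _ := tsum_geometric_of_lt_one hr0 hr1

theorem norm_logCoeff_le (x : ℕ → ℂ) (k : Index) : ‖logCoeff x k‖ ≤ ‖multinomialTerm x k‖ := by
  rw [logCoeff_eq_multinomialTerm, norm_mul]
  refine mul_le_of_le_one_left (norm_nonneg _) ?_
  rw [norm_div, norm_pow, norm_neg, norm_one, one_pow, Complex.norm_natCast]
  have : 1 ≤ k.1.degree := Nat.one_le_iff_ne_zero.2 fun h =>
    k.2 ((Finsupp.degree_eq_zero_iff _).1 h)
  exact div_le_one_of_le₀ (by exact_mod_cast this) (by positivity)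

theorem summable_norm_logCoeff {x : ℕ → ℂ} {r : ℝ} (hx : Summable fun n => ‖x n‖)
    (hr : ∑' n, ‖x n‖ ≤ r) (hr1 : r < 1) : Summable fun k => ‖logCoeff x k‖ :=
  Summable.of_nonneg_of_le (fun _ => norm_nonneg _) (norm_logCoeff_le x)
    ((summable_norm_multinomialTerm hx hr hr1).comp_injective Subtype.val_injective)

/-- The expansion of `-log (1 + ∑ x_n)` in monomials in the `x_n`. -/
theorem hasSum_logCoeff {x : ℕ → ℂ} {r : ℝ} (hx : Summable fun n => ‖x n‖)
    (hr : ∑' n, ‖x n‖ ≤ r) (hr1 : r < 1) :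
    HasSum (logCoeff x) (-Complex.log (1 + ∑' n, x n)) := by
  have hr0 : 0 ≤ r := (tsum_nonneg fun n => norm_nonneg _).trans hr
  set c : ℕ → ℂ := fun p => (-1) ^ p / p with hc
  set F : (ℕ →₀ ℕ) → ℂ := fun k => c k.degree * multinomialTerm x k with hF
  have hlF : logCoeff x = F ∘ Subtype.val := funext fun k => logCoeff_eq_multinomialTerm x k
  have hsupp : Function.support F ⊆ {k | k ≠ 0} := by
    intro k hk h0
    rw [h0] at hk
    simp [hF, hc] at hk
  have hc1 : ∀ p, ‖c p‖ ≤ 1 := by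
    intro p
    rw [hc, norm_div, norm_pow, norm_neg, norm_one, one_pow, Complex.norm_natCast]
    rcases Nat.eq_zero_or_pos p with rfl | h
    · simp
    · exact div_le_one_of_le₀ (by exact_mod_cast h) (by positivity)
  have hsF : Summable F := by
    refine Summable.of_norm (Summable.of_nonneg_of_le (fun _ => norm_nonneg _) (fun k => ?_)
      (summable_norm_multinomialTerm hx hr hr1))
    rw [norm_mul]
    exact mul_le_of_le_one_left (norm_nonneg _) (hc1 _)
  have hxs : Summable x := hx.of_norm
  have hS : ‖∑' n, x n‖ ≤ r := (norm_tsum_le_tsum_norm hx).trans hr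
  rw [hlF]
  refine (hasSum_subtype_iff_of_support_subset hsupp).2 ?_
  have h1 := hsF.hasSum.comp tendsto_truncatedIndex
  have h2 : Filter.Tendsto (fun N => ∑' p, if p ∈ Finset.range (N + 1) then
      c p * (∑ n ∈ Finset.range N, x n) ^ p else 0) Filter.atTop
      (𝓝 (∑' p, c p * (∑' n, x n) ^ p)) := by
    refine tendsto_tsum_of_dominated_convergence (bound := fun p => r ^ p)
      (summable_geometric_of_lt_one hr0 hr1) (fun p => ?_)
      (Filter.Eventually.of_forall fun N p => ?_)
    · refine Filter.Tendsto.congr' ?_ ((hxs.hasSum.tendsto_sum_nat.pow p).const_mul (c p))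
      filter_upwards [Filter.eventually_ge_atTop p] with N hN
      rw [if_pos (Finset.mem_range.2 (by omega))]
    · split_ifs
      · rw [norm_mul, norm_pow]
        refine (mul_le_of_le_one_left (by positivity) (hc1 _)).trans ?_
        gcongr
        exact (norm_sum_le _ _).trans ((hx.sum_le_tsum _ fun _ _ => norm_nonneg _).trans hr)
      · simpa using pow_nonneg hr0 p
  have h3 := (Complex.hasSum_taylorSeries_log (z := ∑' n, x n) (hS.trans_lt hr1)).neg
  have h4 : ∑' p, c p * (∑' n, x n) ^ p = -Complex.log (1 + ∑' n, x n) := by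
    rw [← h3.tsum_eq]
    refine tsum_congr fun p => ?_
    rw [hc, pow_succ]; ring
  rw [h4] at h2
  have h5 := tendsto_nhds_unique (h1.congr fun N => ?_) h2
  · rw [← h5]; exact hsF.hasSum
  · rw [Function.comp_apply, hF, sum_truncatedIndex]
    refine ((tsum_eq_sum fun p hp => if_neg hp).trans (Finset.sum_congr rfl fun p hp => ?_)).symm
    exact if_pos hp

theorem pairing_eq_sum (lam : ℕ → ℝ) (k : Index) :
    pairing lam k = ∑ n ∈ k.1.support, lam n * k.1 n := rfl

theorem le_pairing {lam : ℕ → ℝ} (hpos : 0 < lam 0) (hmono : StrictMono lam) (k : Index) :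
    lam 0 ≤ pairing lam k := by
  have h0 : ∀ n, lam 0 ≤ lam n := fun n => hmono.monotone (Nat.zero_le n)
  obtain ⟨n, hn⟩ := Finsupp.support_nonempty_iff.2 k.2
  rw [pairing_eq_sum]
  refine le_trans ?_ (Finset.single_le_sum (f := fun n => lam n * (k.1 n : ℝ))
    (fun i _ => mul_nonneg (hpos.le.trans (h0 i)) (Nat.cast_nonneg _)) hn)
  have : (1 : ℝ) ≤ k.1 n := by
    exact_mod_cast Nat.one_le_iff_ne_zero.2 (Finsupp.mem_support_iff.1 hn)
  nlinarith [h0 n]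

/-- `logCoeff` is homogeneous: inserting the exponentials into the coefficients produces the
exponential of the pairing. -/
theorem logCoeff_mul_exp (lam : ℕ → ℝ) (a : ℕ → ℂ) (s : ℂ) (k : Index) :
    logCoeff (fun n => a n * Complex.exp (-lam n * s)) k =
      logCoeff a k * Complex.exp (-pairing lam k * s) := by
  have h : Complex.exp (-pairing lam k * s) =
      ∏ n ∈ k.1.support, Complex.exp (-lam n * s) ^ k.1 n := by
    rw [pairing_eq_sum]
    push_cast
    rw [← Finset.sum_neg_distrib, Finset.sum_mul, Complex.exp_sum]
    refine Finset.prod_congr rfl fun n _ => ?_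
    rw [← Complex.exp_nat_mul]
    ring_nf
  rw [h, logCoeff, logCoeff, mul_assoc (_ * _)]
  congr 1
  rw [Finsupp.prod, Finsupp.prod, ← Finset.prod_mul_distrib]
  exact Finset.prod_congr rfl fun n _ => mul_pow _ _ _

/-- `x e^{-x} ≤ 1`, used to absorb the factor `⟨λ, k⟩` of the logarithmic derivative. -/
theorem mul_exp_neg_le_one (x : ℝ) : x * Real.exp (-x) ≤ 1 := by
  rw [Real.exp_neg, ← div_eq_mul_inv, div_le_one (Real.exp_pos x)]
  linarith [Real.add_one_le_exp x]

section DirichletSeries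

variable {lam : ℕ → ℝ} {a : ℕ → ℂ} {σbar : ℝ}

theorem norm_mul_exp_eq (lam : ℕ → ℝ) (a : ℕ → ℂ) (s : ℂ) (n : ℕ) :
    ‖a n * Complex.exp (-lam n * s)‖ = ‖a n‖ * Real.exp (-lam n * s.re) := by
  rw [norm_mul, Complex.norm_exp]
  congr 2
  simp

/-- Moving to the right from `c` to `x`, the terms from the `m`-th on gain at least the factor
`e^{-λ_m (x - c)}`. -/
theorem mul_exp_le_of_le (hmono : StrictMono lam) {c x : ℝ} (h : c ≤ x)
    (n m : ℕ) (hm : m ≤ n) : ‖a n‖ * Real.exp (-lam n * x) ≤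
      Real.exp (-lam m * (x - c)) * (‖a n‖ * Real.exp (-lam n * c)) := by
  have h1 : lam m ≤ lam n := hmono.monotone hm
  rw [mul_left_comm, ← Real.exp_add]
  gcongr
  nlinarith

theorem summable_mul_exp (hmono : StrictMono lam)
    (hsum : Summable fun n => ‖a n‖ * Real.exp (-lam n * σbar)) {x : ℝ} (h : σbar ≤ x) :
    Summable fun n => ‖a n‖ * Real.exp (-lam n * x) :=
  Summable.of_nonneg_of_le (fun n => by positivity)
    (fun n => mul_exp_le_of_le hmono h n 0 (Nat.zero_le n)) (hsum.mul_left _)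

theorem exists_tsum_mul_exp_le (hpos : 0 < lam 0) (hmono : StrictMono lam)
    (hsum : Summable fun n => ‖a n‖ * Real.exp (-lam n * σbar)) :
    ∃ c, σbar ≤ c ∧ ∑' n, ‖a n‖ * Real.exp (-lam n * c) ≤ 1 / 2 := by
  have h1 : Filter.Tendsto (fun x : ℝ => Real.exp (-lam 0 * (x - σbar)) *
      ∑' n, ‖a n‖ * Real.exp (-lam n * σbar)) Filter.atTop
      (𝓝 (0 * ∑' n, ‖a n‖ * Real.exp (-lam n * σbar))) := by
    refine Filter.Tendsto.mul_const _ (Real.tendsto_exp_atBot.comp ?_)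
    exact (Filter.tendsto_atTop_add_const_right _ (-σbar) Filter.tendsto_id).const_mul_atTop_of_neg
      (by linarith)
  rw [zero_mul] at h1
  obtain ⟨c, h2, h3⟩ := ((h1.eventually_le_const (by norm_num : (0 : ℝ) < 1 / 2)).and
    (Filter.eventually_ge_atTop σbar)).exists
  refine ⟨c, h3, le_trans ?_ h2⟩
  rw [← tsum_mul_left]
  exact (summable_mul_exp hmono hsum h3).tsum_le_tsum
    (fun n => mul_exp_le_of_le hmono h3 n 0 (Nat.zero_le n)) (hsum.mul_left _)

/-- On a suitable half plane `f` is holomorphic without zeros, and `-log f` and `f' / f` have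
absolutely convergent Dirichlet expansions over the index set `Λ`. -/
theorem exists_halfPlane (hpos : 0 < lam 0) (hmono : StrictMono lam)
    (hsum : Summable fun n => ‖a n‖ * Real.exp (-lam n * σbar)) {f : ℂ → ℂ}
    (hf : ∀ s : ℂ, σbar < s.re → f s = 1 + ∑' n, a n * Complex.exp (-lam n * s)) :
    ∃ c, σbar ≤ c ∧ (∀ s : ℂ, c < s.re → DifferentiableAt ℂ f s ∧ f s ≠ 0 ∧
      HasSum (fun k : Index => logCoeff a k * Complex.exp (-pairing lam k * s))
        (-Complex.log (f s)) ∧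
      HasSum (fun k : Index => pairing lam k * logCoeff a k * Complex.exp (-pairing lam k * s))
        (logDeriv f s)) ∧
      Summable fun k : Index => ‖pairing lam k * logCoeff a k‖ * Real.exp (-pairing lam k * c) := by
  obtain ⟨c, hc, hc2⟩ := exists_tsum_mul_exp_le hpos hmono hsum
  have hsc := summable_mul_exp hmono hsum hc
  have hxc : ∀ s : ℂ, c ≤ s.re → (Summable fun n => ‖a n * Complex.exp (-lam n * s)‖) ∧
      ∑' n, ‖a n * Complex.exp (-lam n * s)‖ ≤ 1 / 2 := by
    intro s hs
    simp_rw [norm_mul_exp_eq]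
    have hs' := summable_mul_exp hmono hsum (hc.trans hs)
    refine ⟨hs', (hs'.tsum_le_tsum (fun n => ?_) hsc).trans hc2⟩
    have : 0 < lam n := hpos.trans_le (hmono.monotone (Nat.zero_le n))
    gcongr ‖a n‖ * Real.exp ?_
    nlinarith
  have hopen : IsOpen {s : ℂ | c < s.re} := isOpen_lt continuous_const Complex.continuous_re
  have hlog : ∀ s : ℂ, c < s.re →
      HasSum (fun k : Index => logCoeff a k * Complex.exp (-pairing lam k * s))
        (-Complex.log (f s)) := by
    intro s hs
    rw [hf s (hc.trans_lt hs)]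
    exact (hasSum_logCoeff (hxc s hs.le).1 (hxc s hs.le).2 (by norm_num)).congr_fun fun k =>
      (logCoeff_mul_exp lam a s k).symm
  have hfd : DifferentiableOn ℂ f {s | c < s.re} := by
    have h1 : DifferentiableOn ℂ (fun s => ∑' n, a n * Complex.exp (-lam n * s))
        {s | c < s.re} := by
      refine Complex.differentiableOn_tsum_of_summable_norm hsc (fun n => by fun_prop) hopen
        fun n s hs => ?_
      rw [norm_mul_exp_eq]
      have : 0 < lam n := hpos.trans_le (hmono.monotone (Nat.zero_le n))
      have hs : c < s.re := hs
      gcongr ‖a n‖ * Real.exp ?_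
      nlinarith
    exact (h1.const_add 1).congr fun s hs => hf s (hc.trans_lt hs)
  have hslit : ∀ s : ℂ, c < s.re → f s ∈ Complex.slitPlane := by
    intro s hs
    rw [hf s (hc.trans_lt hs)]
    refine Complex.mem_slitPlane_of_norm_lt_one (lt_of_le_of_lt ?_ (by norm_num : (1 / 2 : ℝ) < 1))
    exact (norm_tsum_le_tsum_norm (hxc s hs.le).1).trans (hxc s hs.le).2
  have hu : Summable fun k : Index => ‖logCoeff a k‖ * Real.exp (-pairing lam k * c) := by
    have := summable_norm_logCoeff (hxc c (by simp)).1 (hxc c (by simp)).2 (by norm_num)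
    simp_rw [logCoeff_mul_exp, norm_mul, Complex.norm_exp] at this
    simpa using this
  have hp : ∀ k, 0 < pairing lam k := fun k => hpos.trans_le (le_pairing hpos hmono k)
  -- at `c + 1` the additional factor `e^{-⟨λ, k⟩}` absorbs the `⟨λ, k⟩` of the derivative
  refine ⟨c + 1, by linarith, fun s hs => ?_, ?_⟩
  · have hs : c < s.re := by linarith
    have hfs := hfd.differentiableAt (hopen.mem_nhds hs)
    refine ⟨hfs, Complex.slitPlane_ne_zero (hslit s hs), hlog s hs, ?_⟩
    -- differentiate the expansion of `-log f` term by term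
    have h1 := Complex.hasSum_deriv_of_summable_norm (z := s) hu
      (F := fun k s => logCoeff a k * Complex.exp (-pairing lam k * s)) (fun k => by fun_prop) hopen
      (fun k w hw => by
        have hw : c < w.re := hw
        rw [norm_mul, Complex.norm_exp]
        have := hp k
        gcongr
        simp
        nlinarith) hs
    have h2 : deriv (fun w => ∑' k : Index, logCoeff a k * Complex.exp (-pairing lam k * w)) s =
        -logDeriv f s := by
      have : (fun w => ∑' k : Index, logCoeff a k * Complex.exp (-pairing lam k * w)) =ᶠ[𝓝 s]
          fun w => -Complex.log (f w) := by
        filter_upwards [hopen.mem_nhds hs] with w hw using (hlog w hw).tsum_eq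
      rw [this.deriv_eq, logDeriv_apply]
      exact (hfs.hasDerivAt.clog (hslit s hs)).neg.deriv
    rw [h2] at h1
    have h3 := h1.neg
    rw [neg_neg] at h3
    refine h3.congr_fun fun k => ?_
    have h4 : HasDerivAt (fun w : ℂ => logCoeff a k * Complex.exp (-pairing lam k * w))
      (logCoeff a k * (Complex.exp (-pairing lam k * s) * (-pairing lam k * 1))) s :=
      (((hasDerivAt_id s).const_mul _).cexp).const_mul _
    rw [h4.deriv]
    ring
  · refine Summable.of_nonneg_of_le (fun _ => by positivity) (fun k => ?_) hu
    rw [norm_mul, Complex.norm_real, Real.norm_eq_abs, abs_of_pos (hp k)]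
    have h1 : Real.exp (-pairing lam k * (c + 1)) =
        Real.exp (-pairing lam k * c) * Real.exp (-pairing lam k) := by
      rw [← Real.exp_add]; ring_nf
    rw [h1]
    have h2 := mul_exp_neg_le_one (pairing lam k)
    have h3 : 0 ≤ ‖logCoeff a k‖ * Real.exp (-pairing lam k * c) := by positivity
    nlinarith

/-- Uniqueness of Dirichlet coefficients: if all coefficients before `a_n` vanish, then `a_n` is the
limit of the series multiplied by `e^{λ_n x}` as `x → +∞`. -/
theorem eq_zero_of_tsum_mul_exp_eq_zero (hmono : StrictMono lam)
    (hsum : Summable fun n => ‖a n‖ * Real.exp (-lam n * σbar)) {c : ℝ} (hc : σbar ≤ c)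
    (h : ∀ x : ℝ, c < x → ∑' n, a n * Complex.exp (-lam n * x) = 0) (n : ℕ) : a n = 0 := by
  induction n using Nat.strong_induction_on with
  | _ n ih =>
  set B := ∑' n, ‖a n‖ * Real.exp (-lam n * σbar) with hB
  have h1 : ∀ x : ℝ, c < x → ‖a n‖ ≤
      Real.exp (-(lam (n + 1) - lam n) * x) * (Real.exp (lam (n + 1) * σbar) * B) := by
    intro x hx
    have hs := summable_mul_exp hmono hsum (hc.trans hx.le)
    have hs' : Summable fun n => a n * Complex.exp (-lam n * (x : ℂ)) :=
      Summable.of_norm (by simpa only [norm_mul_exp_eq, Complex.ofReal_re] using hs)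
    have e1 := hs'.sum_add_tsum_nat_add (n + 1)
    rw [h x hx, Finset.sum_range_succ, Finset.sum_eq_zero (fun i hi => by
      rw [ih i (Finset.mem_range.1 hi), zero_mul]), zero_add] at e1
    have e2 : ‖a n * Complex.exp (-lam n * (x : ℂ))‖ ≤
        Real.exp (-lam (n + 1) * (x - σbar)) * B := by
      rw [eq_neg_of_add_eq_zero_left e1, norm_neg, hB, ← tsum_mul_left]
      have hs3 := (summable_nat_add_iff (n + 1)).2 hs
      have hs4 := hsum.mul_left (Real.exp (-lam (n + 1) * (x - σbar)))
      refine (tsum_of_norm_bounded hs3.hasSum fun i => by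
        rw [norm_mul_exp_eq, Complex.ofReal_re]).trans ?_
      refine (hs3.tsum_le_tsum (fun i => mul_exp_le_of_le hmono (hc.trans hx.le) _ (n + 1)
        (by omega)) ((summable_nat_add_iff (n + 1)).2 hs4)).trans ?_
      rw [← hs4.sum_add_tsum_nat_add (n + 1)]
      have : 0 ≤ ∑ i ∈ Finset.range (n + 1), Real.exp (-lam (n + 1) * (x - σbar)) *
        (‖a i‖ * Real.exp (-lam i * σbar)) := Finset.sum_nonneg fun _ _ => by positivity
      linarith
    rw [norm_mul_exp_eq, Complex.ofReal_re] at e2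
    have e3 : ‖a n‖ = ‖a n‖ * Real.exp (-lam n * x) * Real.exp (lam n * x) := by
      rw [mul_assoc, ← Real.exp_add]; simp
    rw [e3]
    refine (mul_le_mul_of_nonneg_right e2 (Real.exp_pos _).le).trans_eq ?_
    have e4 : Real.exp (-lam (n + 1) * (x - σbar)) * Real.exp (lam n * x) =
      Real.exp (-(lam (n + 1) - lam n) * x) * Real.exp (lam (n + 1) * σbar) := by
      rw [← Real.exp_add, ← Real.exp_add]; ring_nf
    linear_combination B * e4
  have h2 : Filter.Tendsto (fun x : ℝ => Real.exp (-(lam (n + 1) - lam n) * x) *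
      (Real.exp (lam (n + 1) * σbar) * B)) Filter.atTop
      (𝓝 (0 * (Real.exp (lam (n + 1) * σbar) * B))) := by
    refine Filter.Tendsto.mul_const _ (Real.tendsto_exp_atBot.comp ?_)
    exact Filter.tendsto_id.const_mul_atTop_of_neg (by linarith [hmono (Nat.lt_succ_self n)])
  rw [zero_mul] at h2
  have h3 := ge_of_tendsto h2 ((Filter.eventually_gt_atTop c).mono h1)
  exact norm_le_zero_iff.1 h3

end DirichletSeries


/-! ### The logarithmic derivative on a half plane -/

section HalfPlane

variable {f : ℂ → ℂ} {c : ℝ}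

theorem isOpen_re_gt (c : ℝ) : IsOpen {s : ℂ | c < s.re} :=
  isOpen_lt continuous_const Complex.continuous_re

theorem infinite_re_gt (c : ℝ) : {s : ℂ | c < s.re}.Infinite := by
  refine Set.infinite_of_injective_forall_mem (f := fun n : ℕ => ((c + 1 + n : ℝ) : ℂ))
    (fun m n h => ?_) fun n => ?_
  · have : c + 1 + (m : ℝ) = c + 1 + n := Complex.ofReal_injective h
    exact_mod_cast add_left_cancel this
  · have : (0 : ℝ) ≤ n := n.cast_nonneg
    change c < ((c + 1 + n : ℝ) : ℂ).re
    rw [Complex.ofReal_re]; linarith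

theorem meromorphicOrderAt_eq_zero_of_re_gt
    (hfd : ∀ s : ℂ, c < s.re → DifferentiableAt ℂ f s ∧ f s ≠ 0) {s : ℂ} (hs : c < s.re) :
    meromorphicOrderAt f s = 0 := by
  have han : AnalyticAt ℂ f s := by
    refine DifferentiableOn.analyticAt (s := {s : ℂ | c < s.re}) (fun z hz => ?_)
      ((isOpen_re_gt c).mem_nhds hs)
    exact (hfd z hz).1.differentiableWithinAt
  rw [han.meromorphicOrderAt_eq, han.analyticOrderAt_eq_zero.2 (hfd s hs).2]
  rfl

theorem re_le_of_mult_ne_zero (hfd : ∀ s : ℂ, c < s.re → DifferentiableAt ℂ f s ∧ f s ≠ 0)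
    {ρ : ℂ} (h : mult f ρ ≠ 0) : ρ.re ≤ c := by
  by_contra! hlt
  exact h (by rw [mult, meromorphicOrderAt_eq_zero_of_re_gt hfd hlt]; rfl)

/-- As the plane is connected, a meromorphic function without zeros on a half plane vanishes
identically near no point. -/
theorem meromorphicOrderAt_ne_top (hf : Meromorphic f)
    (hfd : ∀ s : ℂ, c < s.re → DifferentiableAt ℂ f s ∧ f s ≠ 0) (z : ℂ) :
    meromorphicOrderAt f z ≠ ⊤ := by
  refine hf.exists_meromorphicOrderAt_ne_top_iff_forall.1 ⟨((c + 1 : ℝ) : ℂ), ?_⟩ z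
  rw [meromorphicOrderAt_eq_zero_of_re_gt hfd (by simp)]
  simp

theorem hasSum_of_hasSum_subtype_ne {F : ℂ → ℂ} {τ v : ℂ}
    (h : HasSum (fun ρ : {ρ : ℂ // ρ ≠ τ} => F ρ) v) : HasSum F (v + F τ) := by
  have h1 := (hasSum_subtype_iff_indicator (s := {ρ : ℂ | ρ ≠ τ}) (f := F)).1 h
  refine (h1.add (hasSum_ite_eq τ (F τ))).congr_fun fun ρ => ?_
  by_cases hρ : ρ = τ
  · simp [hρ]
  · simp [hρ]

/-- The partial fraction expansion of `f' / f`, obtained by taking the logarithmic derivative of a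
Hadamard factorization centred at `τ`. In the term `ρ = τ` the convention `1 / 0 = 0` turns the
subtracted polynomial into `0`. -/
theorem hasSum_logDeriv (hf : Meromorphic f)
    (hfd : ∀ s : ℂ, c < s.re → DifferentiableAt ℂ f s ∧ f s ≠ 0) {m : ℕ}
    (hm : m + 1 ∈ convergenceExponents f) {τ : ℂ} {Q : Polynomial ℂ}
    (hQ : ∀ᶠ s in Filter.codiscrete ℂ, ∃ p : ℂ,
      HasProd (fun ρ : {ρ : ℂ // ρ ≠ τ} =>
        weierstrassFactor m ((s - τ) / (ρ - τ)) ^ mult f ρ) p ∧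
      f s = (s - τ) ^ mult f τ * Complex.exp (Q.eval s) * p) {s : ℂ} (hs : c < s.re) :
    HasSum (fun ρ : ℂ => mult f ρ * ((s - ρ)⁻¹ +
      ∑ j ∈ Finset.range m, (s - τ) ^ j / (ρ - τ) ^ (j + 1)))
      (logDeriv f s - Q.derivative.eval s) := by
  set b : {ρ : ℂ // ρ ≠ τ} → ℂ := fun ρ => ρ - τ with hb
  set k : {ρ : ℂ // ρ ≠ τ} → ℤ := fun ρ => mult f ρ with hk
  have hb0 : ∀ ρ, b ρ ≠ 0 := fun ρ => sub_ne_zero.2 ρ.2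
  have hbs : Summable fun ρ => |(k ρ : ℝ)| * (‖b ρ‖ ^ (m + 1))⁻¹ :=
    (summable_mult_iff hf τ (m + 1)).2 ((mem_convergenceExponents_iff hf _).1 hm)
  set U : Set ℂ := {w | c < (w + τ).re} with hU
  have hUo : IsOpen U := isOpen_lt continuous_const (by fun_prop)
  have hUk : ∀ ρ, k ρ ≠ 0 → ∀ w ∈ U, w ≠ b ρ := by
    intro ρ hρ w hw h
    have := re_le_of_mult_ne_zero hfd hρ
    have h2 : c < (w + τ).re := hw
    rw [h, hb] at h2
    simp only [sub_add_cancel] at h2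
    linarith
  have hsU : s - τ ∈ U := by simpa [hU] using hs
  have hCd : DifferentiableAt ℂ (canonicalProduct m b k) (s - τ) :=
    differentiableAt_canonicalProduct hb0 hbs hUo (fun ρ hρ => hUk ρ hρ.ne) hsU
  have hC0 : canonicalProduct m b k (s - τ) ≠ 0 :=
    canonicalProduct_ne_zero hb0 hbs fun ρ hρ => hUk ρ hρ _ hsU
  have hτ : s - τ ≠ 0 ∨ 0 ≤ mult f τ := by
    by_cases h : mult f τ = 0
    · exact Or.inr h.ge
    · refine Or.inl fun h0 => ?_
      have := re_le_of_mult_ne_zero hfd h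
      rw [sub_eq_zero.1 h0] at hs
      linarith
  have hid : DifferentiableAt ℂ (fun s => s - τ) s := by fun_prop
  have hz : DifferentiableAt ℂ (fun s => (s - τ) ^ mult f τ) s := hid.zpow hτ
  have hz0 : (s - τ) ^ mult f τ ≠ 0 := by
    by_cases h : mult f τ = 0
    · simp [h]
    · refine zpow_ne_zero _ fun h0 => ?_
      have := re_le_of_mult_ne_zero hfd h
      rw [sub_eq_zero.1 h0] at hs
      linarith
  have he : DifferentiableAt ℂ (fun s => Complex.exp (Q.eval s)) s := by fun_prop
  have hCs : DifferentiableAt ℂ (fun s => canonicalProduct m b k (s - τ)) s :=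
    hCd.comp (f := fun s => s - τ) s hid
  have hze := hz.fun_mul he
  have heq : f =ᶠ[𝓝[≠] s] fun s => (s - τ) ^ mult f τ * Complex.exp (Q.eval s) *
      canonicalProduct m b k (s - τ) := by
    have := mem_codiscreteWithin_iff_forall_mem_nhdsNE.1 hQ s (Set.mem_univ s)
    simp only [Set.compl_univ, Set.union_empty] at this
    filter_upwards [this] with w ⟨p, hp, hw⟩
    rw [hw, canonicalProduct, ← hp.tprod_eq]
  have heq' := ((hfd s hs).1.continuousAt.eventuallyEq_nhds_iff_eventuallyEq_nhdsNE
    (hze.fun_mul hCs).continuousAt).1 heq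
  have hl := logDeriv_congr_nhds heq'
  have hl' : logDeriv f s = mult f τ * (s - τ)⁻¹ + Q.derivative.eval s +
      logDeriv (canonicalProduct m b k) (s - τ) := by
    rw [hl.eq_of_nhds, logDeriv_mul (f := fun s => (s - τ) ^ mult f τ * Complex.exp (Q.eval s))
      (g := fun s => canonicalProduct m b k (s - τ)) s (mul_ne_zero hz0 (Complex.exp_ne_zero _))
      hC0 hze hCs, logDeriv_mul (f := fun s => (s - τ) ^ mult f τ)
      (g := fun s => Complex.exp (Q.eval s)) s hz0 (Complex.exp_ne_zero _) hz he,
      logDeriv_fun_zpow hid]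
    have e1 : logDeriv (fun s => s - τ) s = (s - τ)⁻¹ := by
      rw [logDeriv_apply, deriv_sub_const, deriv_id'', one_div]
    have e2 : logDeriv (fun s => Complex.exp (Q.eval s)) s = Q.derivative.eval s := by
      rw [logDeriv_apply, ((Q.hasDerivAt s).cexp).deriv, mul_comm,
        mul_div_cancel_right₀ _ (Complex.exp_ne_zero _)]
    have e3 : logDeriv (fun s => canonicalProduct m b k (s - τ)) s =
        logDeriv (canonicalProduct m b k) (s - τ) := by
      rw [logDeriv_apply, logDeriv_apply, deriv_comp_sub_const]
    rw [e1, e2, e3]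
  have h1 := hasSum_logDeriv_canonicalProduct hb0 hbs hUo hUk hsU
  have h2 : (fun ρ : {ρ : ℂ // ρ ≠ τ} => (k ρ : ℂ) * ((s - τ - b ρ)⁻¹ +
      ∑ j ∈ Finset.range m, (s - τ) ^ j / b ρ ^ (j + 1))) =
      fun ρ : {ρ : ℂ // ρ ≠ τ} => (mult f ρ : ℂ) *
        ((s - ρ)⁻¹ + ∑ j ∈ Finset.range m, (s - τ) ^ j / ((ρ : ℂ) - τ) ^ (j + 1)) := by
    funext ρ
    rw [hb, hk]
    simp only [sub_sub_sub_cancel_right]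
  rw [h2] at h1
  have h3 := hasSum_of_hasSum_subtype_ne (F := fun ρ : ℂ => (mult f ρ : ℂ) *
      ((s - ρ)⁻¹ + ∑ j ∈ Finset.range m, (s - τ) ^ j / (ρ - τ) ^ (j + 1))) h1
  have h4 : logDeriv f s - Q.derivative.eval s = logDeriv (canonicalProduct m b k) (s - τ) +
      mult f τ * ((s - τ)⁻¹ + ∑ j ∈ Finset.range m, (s - τ) ^ j / (τ - τ) ^ (j + 1)) := by
    rw [hl']
    simp
    ring
  rw [h4]
  exact h3

/-- A pointwise unconditional sum of polynomials of degree less than `m`, on an infinite set, is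
a polynomial of degree less than `m`: it agrees with its Lagrange interpolation polynomial. -/
theorem degree_lt_of_hasSum_eval {ι : Type*} {S : Set ℂ} (hS : S.Infinite) {m : ℕ}
    {R : ι → Polynomial ℂ} (hR : ∀ i, (R i).degree < m) {P : Polynomial ℂ}
    (h : ∀ s ∈ S, HasSum (fun i => (R i).eval s) (P.eval s)) : P.degree < m := by
  obtain ⟨A, hAS, hA⟩ := hS.exists_subset_card_eq m
  have hinj : Set.InjOn (id : ℂ → ℂ) (A : Set ℂ) := Function.injective_id.injOn
  have hI : ∀ s, (Lagrange.interpolate A id fun v => P.eval v).eval s =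
      ∑ v ∈ A, P.eval v * (Lagrange.basis A id v).eval s := fun s => by
    simp [Lagrange.interpolate_apply, Polynomial.eval_finsetSum]
  have hPI : P = Lagrange.interpolate A id fun v => P.eval v := by
    refine Polynomial.eq_of_infinite_eval_eq _ _ (hS.mono fun s hs => ?_)
    change P.eval s = _
    rw [hI]
    refine (h s hs).unique ?_
    have h1 : HasSum (fun i => ∑ v ∈ A, (R i).eval v * (Lagrange.basis A id v).eval s)
        (∑ v ∈ A, P.eval v * (Lagrange.basis A id v).eval s) :=
      hasSum_sum fun v hv => (h v (hAS hv)).mul_right _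
    refine h1.congr_fun fun i => ?_
    conv_lhs => rw [Lagrange.eq_interpolate hinj (f := R i) (by rw [hA]; exact hR i)]
    simp [Lagrange.interpolate_apply, Polynomial.eval_finsetSum]
  rw [hPI, ← hA]
  exact Lagrange.degree_interpolate_lt _ hinj

/-- Changing the centre of the Hadamard factorization changes `Q'` by a polynomial of degree
less than `m`. -/
theorem degree_derivative_sub_lt (hf : Meromorphic f)
    (hfd : ∀ s : ℂ, c < s.re → DifferentiableAt ℂ f s ∧ f s ≠ 0) {m : ℕ}
    (hm : m + 1 ∈ convergenceExponents f) {τ τ' : ℂ} {Q Q' : Polynomial ℂ}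
    (hQ : ∀ᶠ s in Filter.codiscrete ℂ, ∃ p : ℂ,
      HasProd (fun ρ : {ρ : ℂ // ρ ≠ τ} =>
        weierstrassFactor m ((s - τ) / (ρ - τ)) ^ mult f ρ) p ∧
      f s = (s - τ) ^ mult f τ * Complex.exp (Q.eval s) * p)
    (hQ' : ∀ᶠ s in Filter.codiscrete ℂ, ∃ p : ℂ,
      HasProd (fun ρ : {ρ : ℂ // ρ ≠ τ'} =>
        weierstrassFactor m ((s - τ') / (ρ - τ')) ^ mult f ρ) p ∧
      f s = (s - τ') ^ mult f τ' * Complex.exp (Q'.eval s) * p) :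
    (Q'.derivative - Q.derivative).degree < m := by
  let R : ℂ → ℂ → Polynomial ℂ := fun τ ρ => Polynomial.C (mult f ρ : ℂ) *
    ∑ j ∈ Finset.range m, Polynomial.C (((ρ - τ) ^ (j + 1))⁻¹) *
      (Polynomial.X - Polynomial.C τ) ^ j
  have hR : ∀ τ ρ, R τ ρ ∈ Polynomial.degreeLT ℂ m := by
    intro τ ρ
    simp only [R, ← Polynomial.smul_eq_C_mul]
    refine Submodule.smul_mem _ _ (Submodule.sum_mem _ fun j hj => Submodule.smul_mem _ _ ?_)
    rw [Polynomial.mem_degreeLT, Polynomial.degree_pow, Polynomial.degree_X_sub_C, nsmul_one]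
    exact_mod_cast Finset.mem_range.1 hj
  refine degree_lt_of_hasSum_eval (infinite_re_gt c) (R := fun ρ => R τ ρ - R τ' ρ) (fun ρ =>
    Polynomial.mem_degreeLT.1 (Submodule.sub_mem _ (hR _ _) (hR _ _))) fun s hs => ?_
  have h1 := (hasSum_logDeriv hf hfd hm hQ hs).sub (hasSum_logDeriv hf hfd hm hQ' hs)
  have h2 : (Q'.derivative - Q.derivative).eval s = logDeriv f s - Q.derivative.eval s -
    (logDeriv f s - Q'.derivative.eval s) := by rw [Polynomial.eval_sub]; ring
  rw [h2]
  refine h1.congr_fun fun ρ => ?_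
  simp only [R, Polynomial.eval_sub, Polynomial.eval_mul, Polynomial.eval_C,
    Polynomial.eval_finsetSum, Polynomial.eval_pow, Polynomial.eval_X, div_eq_inv_mul]
  ring

/-- If the divisor of `f` is finite, `f = R e^Q` with `R` rational, and an exponential decay of
`f' / f = R' / R + Q'` on a half plane is only possible when `f' / f = 0` there. -/
theorem logDeriv_eq_zero_of_zero_mem_convergenceExponents (hf : Meromorphic f)
    (hfd : ∀ s : ℂ, c < s.re → DifferentiableAt ℂ f s ∧ f s ≠ 0) (hord : HasFiniteOrder f)
    (h0 : 0 ∈ convergenceExponents f) {B δ : ℝ} (hδ : 0 < δ)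
    (hB : ∀ x : ℝ, c < x → ‖logDeriv f x‖ ≤ B * Real.exp (-δ * x)) {s : ℂ} (hs : c < s.re) :
    logDeriv f s = 0 := by
  have hsum0 : Summable fun ρ : ℂ => |(mult f ρ : ℝ)| := by
    simpa using (mem_convergenceExponents_iff hf 0).1 h0
  have hfin : (Function.support fun ρ : ℂ => |(mult f ρ : ℝ)|).Finite := by
    have h1 := hsum0.tendsto_cofinite_zero.eventually_lt_const (by norm_num : (0 : ℝ) < 1)
    refine (Filter.eventually_cofinite.1 h1).subset fun ρ hρ => ?_
    have h2 : mult f ρ ≠ 0 := by simpa using hρ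
    simpa using (by exact_mod_cast Int.one_le_abs h2 : (1 : ℝ) ≤ |(mult f ρ : ℝ)|)
  set S := hfin.toFinset with hS
  have hSmem : ∀ ρ, ρ ∈ S ↔ mult f ρ ≠ 0 := fun ρ => by simp [hS]
  have h1 : 0 + 1 ∈ convergenceExponents f := by
    rw [mem_convergenceExponents_iff hf]
    refine Summable.of_nonneg_of_le (fun ρ => by positivity) (fun ρ => ?_) hsum0
    refine mul_le_of_le_one_right (abs_nonneg _) (inv_le_one_of_one_le₀ ?_)
    simp
  obtain ⟨Q, hQ⟩ := exists_hadamard hf (meromorphicOrderAt_ne_top hf hfd) hord h1 0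
  have hL : ∀ s : ℂ, c < s.re →
      logDeriv f s = ∑ ρ ∈ S, (mult f ρ : ℂ) * (s - ρ)⁻¹ + Q.derivative.eval s := by
    intro s hs
    have h2 := hasSum_logDeriv hf hfd h1 hQ hs
    simp only [Finset.range_zero, Finset.sum_empty, add_zero] at h2
    have h3 := h2.unique (hasSum_sum_of_ne_finset_zero (s := S) fun ρ hρ => by
      rw [hSmem, not_not] at hρ
      rw [hρ]; simp)
    rw [← h3]; ring
  -- the rational part and the left side vanish at `+∞`, hence `Q' = 0`
  have hofReal : Filter.Tendsto (fun x : ℝ => ‖(x : ℂ)‖) Filter.atTop Filter.atTop := by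
    simpa using Filter.tendsto_abs_atTop_atTop
  have hcob : Filter.Tendsto (fun x : ℝ => (x : ℂ)) Filter.atTop (Bornology.cobounded ℂ) :=
    tendsto_norm_atTop_iff_cobounded.1 hofReal
  have hexp : Filter.Tendsto (fun x : ℝ => B * Real.exp (-δ * x)) Filter.atTop (𝓝 (B * 0)) :=
    (Real.tendsto_exp_atBot.comp
      (Filter.tendsto_id.const_mul_atTop_of_neg (by linarith))).const_mul B
  rw [mul_zero] at hexp
  have hlog0 : Filter.Tendsto (fun x : ℝ => logDeriv f x) Filter.atTop (𝓝 0) :=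
    squeeze_zero_norm' ((Filter.eventually_gt_atTop c).mono hB) hexp
  have hrat0 : Filter.Tendsto (fun x : ℝ => ∑ ρ ∈ S, (mult f ρ : ℂ) * ((x : ℂ) - ρ)⁻¹)
      Filter.atTop (𝓝 (∑ ρ ∈ S, (mult f ρ : ℂ) * 0)) := by
    refine tendsto_finsetSum _ fun ρ _ => Filter.Tendsto.const_mul _ ?_
    refine Filter.tendsto_inv₀_cobounded.comp
      (Filter.Tendsto.comp (g := fun z : ℂ => z - ρ) ?_ hcob)
    exact tendsto_sub_const_cobounded ρ
  simp only [mul_zero, Finset.sum_const_zero] at hrat0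
  have hQ0 : Q.derivative = 0 := by
    have h2 : Filter.Tendsto (fun x : ℝ => Q.derivative.eval (x : ℂ)) Filter.atTop (𝓝 0) := by
      have h3 := hlog0.sub hrat0
      rw [sub_zero] at h3
      refine h3.congr' ((Filter.eventually_gt_atTop c).mono fun x hx => ?_)
      rw [hL x (by simpa using hx)]
      ring
    have h4 : ¬ 0 < Q.derivative.degree := fun h =>
      not_tendsto_atTop_of_tendsto_nhds h2.norm (Q.derivative.tendsto_norm_atTop h hofReal)
    rw [Polynomial.eq_C_of_degree_le_zero (not_lt.1 h4)] at h2 ⊢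
    simp only [Polynomial.eval_C] at h2
    rw [tendsto_nhds_unique tendsto_const_nhds h2, Polynomial.C_0]
  -- clearing denominators, the rational part becomes a polynomial that decays exponentially
  set P : Polynomial ℂ := ∑ ρ ∈ S, Polynomial.C (mult f ρ : ℂ) *
    ∏ ρ' ∈ S.erase ρ, (Polynomial.X - Polynomial.C ρ') with hP
  set D : Polynomial ℂ := ∏ ρ' ∈ S, (Polynomial.X - Polynomial.C ρ') with hD
  have hne : ∀ s : ℂ, c < s.re → ∀ ρ ∈ S, s - ρ ≠ 0 := by
    intro s hs ρ hρ h
    have := re_le_of_mult_ne_zero hfd ((hSmem ρ).1 hρ)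
    rw [sub_eq_zero.1 h] at hs
    linarith
  have hPD : ∀ s : ℂ, c < s.re → P.eval s = D.eval s * logDeriv f s := by
    intro s hs
    rw [hL s hs, hQ0, Polynomial.eval_zero, add_zero, hP, hD, Polynomial.eval_finsetSum,
      Finset.mul_sum]
    refine Finset.sum_congr rfl fun ρ hρ => ?_
    rw [Polynomial.eval_mul, Polynomial.eval_C, ← Finset.mul_prod_erase S _ hρ,
      Polynomial.eval_mul, Polynomial.eval_sub, Polynomial.eval_X, Polynomial.eval_C]
    have := hne s hs ρ hρ
    field_simp
  have hP0 : P = 0 := by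
    have h2 : Filter.Tendsto (fun x : ℝ => ‖D.eval (x : ℂ)‖ * (B * Real.exp (-δ * x)))
        Filter.atTop (𝓝 0) := by
      have h3 : Filter.Tendsto (fun x : ℝ => ∑ i ∈ Finset.range (D.natDegree + 1),
          ‖D.coeff i‖ * (B * (x ^ i * Real.exp (-δ * x)))) Filter.atTop
          (𝓝 (∑ i ∈ Finset.range (D.natDegree + 1), ‖D.coeff i‖ * (B * 0))) := by
        refine tendsto_finsetSum _ fun i _ => Filter.Tendsto.const_mul _
          (Filter.Tendsto.const_mul _ ?_)
        have h3 := ((Real.tendsto_pow_mul_exp_neg_atTop_nhds_zero i).comp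
          (Filter.tendsto_id.const_mul_atTop hδ)).const_mul ((δ ^ i)⁻¹)
        rw [mul_zero] at h3
        refine h3.congr fun x => ?_
        have := hδ.ne'
        simp only [Function.comp_apply, id_eq, mul_pow, neg_mul]
        field_simp
      simp only [mul_zero, Finset.sum_const_zero] at h3
      refine squeeze_zero' ((Filter.eventually_gt_atTop c).mono fun x hx => ?_) ?_ h3
      · exact mul_nonneg (norm_nonneg _) ((norm_nonneg _).trans (hB x hx))
      · filter_upwards [Filter.eventually_gt_atTop c, Filter.eventually_ge_atTop 0] with x hx hx0
        rw [Polynomial.eval_eq_sum_range]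
        refine (mul_le_mul_of_nonneg_right (norm_sum_le _ _)
          ((norm_nonneg _).trans (hB x hx))).trans_eq ?_
        rw [Finset.sum_mul]
        refine Finset.sum_congr rfl fun i _ => ?_
        rw [norm_mul, norm_pow, Complex.norm_real, Real.norm_eq_abs, abs_of_nonneg hx0]
        ring
    have h5 : Filter.Tendsto (fun x : ℝ => P.eval (x : ℂ)) Filter.atTop (𝓝 0) := by
      refine squeeze_zero_norm' ((Filter.eventually_gt_atTop c).mono fun x hx => ?_) h2
      rw [hPD x (by simpa using hx), norm_mul]
      gcongr
      exact hB x hx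
    have h4 : ¬ 0 < P.degree := fun h =>
      not_tendsto_atTop_of_tendsto_nhds h5.norm (P.tendsto_norm_atTop h hofReal)
    rw [Polynomial.eq_C_of_degree_le_zero (not_lt.1 h4)] at h5 ⊢
    simp only [Polynomial.eval_C] at h5
    rw [tendsto_nhds_unique tendsto_const_nhds h5, Polynomial.C_0]
  have h6 := hPD s hs
  rw [hP0, Polynomial.eval_zero, eq_comm, mul_eq_zero] at h6
  refine h6.resolve_left ?_
  rw [hD, Polynomial.eval_prod]
  refine Finset.prod_ne_zero_iff.2 fun ρ hρ => ?_
  simpa using hne s hs ρ hρ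

end HalfPlane

/-- A Dirichlet series over `Λ` decays like `e^{-λ_0 Re s}`, because all its frequencies are at
least `λ_0`. -/
theorem norm_tsum_mul_exp_le {lam : ℕ → ℝ} (hpos : 0 < lam 0) (hmono : StrictMono lam)
    {β : Index → ℂ} {c : ℝ} (hβ : Summable fun k => ‖β k‖ * Real.exp (-pairing lam k * c))
    {s : ℂ} (hs : c ≤ s.re) {v : ℂ}
    (hv : HasSum (fun k => β k * Complex.exp (-pairing lam k * s)) v) :
    ‖v‖ ≤ Real.exp (-lam 0 * (s.re - c)) * ∑' k, ‖β k‖ * Real.exp (-pairing lam k * c) := by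
  rw [← hv.tsum_eq, ← tsum_mul_left]
  refine tsum_of_norm_bounded (hβ.mul_left _).hasSum fun k => ?_
  have h1 : ‖β k * Complex.exp (-pairing lam k * s)‖ =
      ‖β k‖ * Real.exp (-pairing lam k * s.re) := by
    rw [norm_mul, Complex.norm_exp]; simp
  rw [h1, mul_left_comm, ← Real.exp_add]
  have h2 := le_pairing hpos hmono k
  gcongr
  nlinarith

/-- A non-constant Dirichlet series has an infinite divisor, since its logarithmic derivative
decays exponentially. Consequently the convergence exponent is positive, and the truncated `d - 1`
in `IsHadamardExponent` is a genuine subtraction. -/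
theorem zero_notMem_convergenceExponents {lam : ℕ → ℝ} (hpos : 0 < lam 0) (hmono : StrictMono lam)
    {a : ℕ → ℂ} (ha : ∃ n, a n ≠ 0) {σbar : ℝ}
    (hsum : Summable fun n => ‖a n‖ * Real.exp (-lam n * σbar)) {f : ℂ → ℂ}
    (hmero : Meromorphic f) (hord : HasFiniteOrder f)
    (hf : ∀ s : ℂ, σbar < s.re → f s = 1 + ∑' n, a n * Complex.exp (-lam n * s)) :
    0 ∉ convergenceExponents f := by
  intro h0
  obtain ⟨c, hc, h1, h2⟩ := exists_halfPlane hpos hmono hsum hf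
  have hfd : ∀ s : ℂ, c < s.re → DifferentiableAt ℂ f s ∧ f s ≠ 0 :=
    fun s hs => ⟨(h1 s hs).1, (h1 s hs).2.1⟩
  set B := ∑' k, ‖pairing lam k * logCoeff a k‖ * Real.exp (-pairing lam k * c) with hB
  have h3 : ∀ s : ℂ, c < s.re → logDeriv f s = 0 := fun s hs => by
    refine logDeriv_eq_zero_of_zero_mem_convergenceExponents hmero hfd hord h0
      (B := Real.exp (lam 0 * c) * B) hpos (fun x hx => ?_) hs
    have hx' : c < (x : ℂ).re := by simpa using hx
    refine (norm_tsum_mul_exp_le hpos hmono h2 hx'.le (h1 x hx').2.2.2).trans_eq ?_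
    have : Real.exp (-lam 0 * ((x : ℂ).re - c)) =
        Real.exp (lam 0 * c) * Real.exp (-lam 0 * x) := by
      rw [← Real.exp_add, Complex.ofReal_re]; ring_nf
    rw [this]; ring
  have hexp : ∀ s : ℂ, c < s.re → ∑' n, a n * Complex.exp (-lam n * s) = f s - 1 := fun s hs => by
    rw [hf s (hc.trans_lt hs)]; ring
  -- `f` is constant on the half plane, and its value there is its limit `1` at `+∞`
  have hconst : ∀ s : ℂ, c < s.re → ∀ w : ℂ, c < w.re → f s = f w := by
    intro s hs w hw
    refine (isOpen_re_gt c).is_const_of_deriv_eq_zero (convex_halfSpace_re_gt c).isPreconnected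
      (fun z hz => (hfd z hz).1.differentiableWithinAt) (fun z hz => ?_) hs hw
    exact (div_eq_zero_iff.1 (h3 z hz)).resolve_right (hfd z hz).2
  have hlim : Filter.Tendsto (fun x : ℝ => ∑' n, a n * Complex.exp (-lam n * x)) Filter.atTop
      (𝓝 0) := by
    have hdec : Filter.Tendsto (fun x : ℝ => Real.exp (-lam 0 * (x - c)) *
        ∑' n, ‖a n‖ * Real.exp (-lam n * c)) Filter.atTop
        (𝓝 (0 * ∑' n, ‖a n‖ * Real.exp (-lam n * c))) := by
      refine Filter.Tendsto.mul_const _ (Real.tendsto_exp_atBot.comp ?_)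
      exact (Filter.tendsto_atTop_add_const_right _ (-c)
        Filter.tendsto_id).const_mul_atTop_of_neg (by linarith)
    rw [zero_mul] at hdec
    refine squeeze_zero_norm' ((Filter.eventually_gt_atTop c).mono fun x hx => ?_) hdec
    rw [← tsum_mul_left]
    refine tsum_of_norm_bounded ((summable_mul_exp hmono hsum hc).mul_left _).hasSum fun n => ?_
    rw [norm_mul_exp_eq, Complex.ofReal_re]
    exact mul_exp_le_of_le hmono hx.le n 0 (Nat.zero_le n)
  have hzero : ∀ x : ℝ, c < x → ∑' n, a n * Complex.exp (-lam n * x) = 0 := by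
    intro x hx
    refine tendsto_nhds_unique (tendsto_const_nhds.congr' ?_) hlim
    filter_upwards [Filter.eventually_gt_atTop c] with y hy
    rw [hexp x (by simpa using hx), hexp y (by simpa using hy),
      hconst x (by simpa using hx) y (by simpa using hy)]
  obtain ⟨n, hn⟩ := ha
  exact hn (eq_zero_of_tsum_mul_exp_eq_zero hmono hsum hc hzero n)


/-! ### The two-sided Laplace transform of a test function -/

section LaplaceTransform

open MeasureTheory
open scoped FourierTransform

/-- The two-sided Laplace transform `∫ e^{st} ψ(t) dt`. -/
noncomputable def laplace (ψ : ℝ → ℂ) (s : ℂ) : ℂ := ∫ t : ℝ, Complex.exp (s * t) * ψ t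

/-- The point `s + 2πiξ` of the vertical line through `s`. -/
noncomputable def vline (s : ℂ) (ξ : ℝ) : ℂ := s + 2 * Real.pi * ξ * Complex.I

theorem vline_re (s : ℂ) (ξ : ℝ) : (vline s ξ).re = s.re := by simp [vline]

theorem continuous_vline (s : ℂ) : Continuous (vline s) := by unfold vline; fun_prop

theorem contDiff_exp_mul (s : ℂ) : ContDiff ℝ ∞ fun t : ℝ => Complex.exp (s * t) :=
  Complex.contDiff_exp.comp (contDiff_const.mul Complex.ofRealCLM.contDiff)

theorem hasDerivAt_exp_mul (s : ℂ) (t : ℝ) :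
    HasDerivAt (fun t : ℝ => Complex.exp (s * t)) (s * Complex.exp (s * t)) t := by
  have := ((hasDerivAt_id (t : ℂ)).const_mul s).cexp.comp_ofReal
  simpa [mul_comm] using this

variable {ψ : ℝ → ℂ}

theorem integrable_exp_mul (hψ : ContDiff ℝ ∞ ψ) (hc : HasCompactSupport ψ) (s : ℂ) :
    Integrable fun t : ℝ => Complex.exp (s * t) * ψ t :=
  ((contDiff_exp_mul s).continuous.mul hψ.continuous).integrable_of_hasCompactSupport hc.mul_left

theorem contDiff_deriv (hψ : ContDiff ℝ ∞ ψ) : ContDiff ℝ ∞ (deriv ψ) :=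
  hψ.iterate_deriv 1

theorem contDiff_iteratedDeriv (hψ : ContDiff ℝ ∞ ψ) (n : ℕ) :
    ContDiff ℝ ∞ (iteratedDeriv n ψ) := by
  rw [iteratedDeriv_eq_iterate]; exact hψ.iterate_deriv n

theorem hasCompactSupport_iteratedDeriv (hc : HasCompactSupport ψ) (n : ℕ) :
    HasCompactSupport (iteratedDeriv n ψ) := by
  induction n with
  | zero => simpa using hc
  | succ n ih => rw [iteratedDeriv_succ]; exact ih.deriv

theorem tsupport_iteratedDeriv_subset (n : ℕ) : tsupport (iteratedDeriv n ψ) ⊆ tsupport ψ := by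
  induction n with
  | zero => simp
  | succ n ih => rw [iteratedDeriv_succ]; exact tsupport_deriv_subset.trans ih

theorem integral_mul_deriv_of_hasCompactSupport {u u' : ℝ → ℂ} (hu : ∀ t, HasDerivAt u (u' t) t)
    (hu' : Continuous u') (hψ : ContDiff ℝ ∞ ψ) (hc : HasCompactSupport ψ) :
    ∫ t, u t * deriv ψ t = -∫ t, u' t * ψ t := by
  have hcu : Continuous u := continuous_iff_continuousAt.2 fun t => (hu t).continuousAt
  refine integral_mul_deriv_eq_deriv_mul_of_integrable (fun t _ => hu t)
    (fun t _ => ((hψ.differentiable (by simp)) t).hasDerivAt) ?_ ?_ ?_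
  · exact (hcu.mul (contDiff_deriv hψ).continuous).integrable_of_hasCompactSupport hc.deriv.mul_left
  · exact (hu'.mul hψ.continuous).integrable_of_hasCompactSupport hc.mul_left
  · exact (hcu.mul hψ.continuous).integrable_of_hasCompactSupport hc.mul_left

theorem laplace_deriv (hψ : ContDiff ℝ ∞ ψ) (hc : HasCompactSupport ψ) (s : ℂ) :
    laplace (deriv ψ) s = -s * laplace ψ s := by
  rw [laplace, integral_mul_deriv_of_hasCompactSupport (hasDerivAt_exp_mul s) (by fun_prop) hψ hc,
    laplace, neg_mul, ← integral_const_mul]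
  simp only [mul_assoc]

theorem laplace_iteratedDeriv (hψ : ContDiff ℝ ∞ ψ) (hc : HasCompactSupport ψ) (n : ℕ) (s : ℂ) :
    laplace (iteratedDeriv n ψ) s = (-s) ^ n * laplace ψ s := by
  induction n with
  | zero => simp
  | succ n ih =>
    rw [iteratedDeriv_succ, laplace_deriv (contDiff_iteratedDeriv hψ n)
      (hasCompactSupport_iteratedDeriv hc n), ih, pow_succ]
    ring

theorem laplace_exp_mul (s z : ℂ) :
    laplace (fun t => Complex.exp (s * t) * ψ t) z = laplace ψ (z + s) := by
  simp only [laplace, ← mul_assoc, ← Complex.exp_add, add_mul]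

/-- The Schwartz function `t ↦ e^{st} ψ(t)`. -/
noncomputable def expMulSchwartz (hψ : ContDiff ℝ ∞ ψ) (hc : HasCompactSupport ψ) (s : ℂ) :
    𝓢(ℝ, ℂ) :=
  HasCompactSupport.toSchwartzMap (f := fun t => Complex.exp (s * t) * ψ t) hc.mul_left
    ((contDiff_exp_mul s).mul hψ)

theorem expMulSchwartz_apply (hψ : ContDiff ℝ ∞ ψ) (hc : HasCompactSupport ψ) (s : ℂ) (t : ℝ) :
    expMulSchwartz hψ hc s t = Complex.exp (s * t) * ψ t := rfl

/-- Along a vertical line the Laplace transform is an inverse Fourier transform. -/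
theorem laplace_vline (hψ : ContDiff ℝ ∞ ψ) (hc : HasCompactSupport ψ) (s : ℂ) :
    (fun ξ => laplace ψ (vline s ξ)) = ⇑(𝓕⁻ (expMulSchwartz hψ hc s) : 𝓢(ℝ, ℂ)) := by
  funext ξ
  rw [SchwartzMap.fourierInv_coe, Real.fourierInv_eq']
  refine integral_congr_ae (Filter.Eventually.of_forall fun t => ?_)
  simp only [expMulSchwartz_apply, smul_eq_mul, ← mul_assoc, ← Complex.exp_add, vline]
  congr 2
  simp
  ring

theorem integrable_laplace_vline (hψ : ContDiff ℝ ∞ ψ) (hc : HasCompactSupport ψ) (s : ℂ) :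
    Integrable fun ξ => laplace ψ (vline s ξ) := by
  rw [laplace_vline hψ hc]; exact SchwartzMap.integrable _

/-- Fourier inversion along a vertical line. -/
theorem laplace_inversion (hψ : ContDiff ℝ ∞ ψ) (hc : HasCompactSupport ψ) (s : ℂ) (t : ℝ) :
    ∫ ξ, laplace ψ (vline s ξ) * Complex.exp (-vline s ξ * t) = ψ t := by
  have h1 : (𝓕 (𝓕⁻ (expMulSchwartz hψ hc s) : 𝓢(ℝ, ℂ)) : 𝓢(ℝ, ℂ)) t =
      Complex.exp (s * t) * ψ t := by
    rw [FourierTransform.fourier_fourierInv_eq, expMulSchwartz_apply]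
  rw [SchwartzMap.fourier_coe, ← laplace_vline, Real.fourier_eq'] at h1
  have h2 : ψ t = Complex.exp (-s * t) * (Complex.exp (s * t) * ψ t) := by
    rw [← mul_assoc, ← Complex.exp_add]; simp
  rw [h2, ← h1, ← integral_const_mul]
  refine integral_congr_ae (Filter.Eventually.of_forall fun ξ => ?_)
  simp only [smul_eq_mul, ← mul_assoc, ← Complex.exp_add]
  rw [mul_comm]
  congr 2
  simp [vline]
  ring

/-- The integral of `s ^ n` against the Laplace transform along a vertical line is the pairing with
`δ_0^{(n)}`. -/
theorem integral_pow_mul_laplace (hψ : ContDiff ℝ ∞ ψ) (hc : HasCompactSupport ψ) (s : ℂ) (n : ℕ) :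
    Integrable (fun ξ => vline s ξ ^ n * laplace ψ (vline s ξ)) ∧
      ∫ ξ, vline s ξ ^ n * laplace ψ (vline s ξ) = (-1) ^ n * iteratedDeriv n ψ 0 := by
  have e : (fun ξ => vline s ξ ^ n * laplace ψ (vline s ξ)) =
      fun ξ => (-1) ^ n * laplace (iteratedDeriv n ψ) (vline s ξ) := by
    funext ξ
    rw [laplace_iteratedDeriv hψ hc, neg_pow (vline s ξ), ← mul_assoc, ← mul_assoc, ← mul_pow]
    simp
  have h1 := contDiff_iteratedDeriv hψ n
  have h2 := hasCompactSupport_iteratedDeriv hc n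
  rw [e]
  refine ⟨(integrable_laplace_vline h1 h2 s).const_mul _, ?_⟩
  rw [integral_const_mul]
  have h3 := laplace_inversion h1 h2 s 0
  simp only [Complex.ofReal_zero, mul_zero, Complex.exp_zero, mul_one] at h3
  rw [h3]

/-- Parseval's formula along a vertical line. -/
theorem integral_mul_eq_integral_laplace (hψ : ContDiff ℝ ∞ ψ) (hc : HasCompactSupport ψ) (s : ℂ)
    {F : ℝ → ℂ} (hF : Integrable fun t : ℝ => F t * Complex.exp (-s * t)) :
    ∫ t, F t * ψ t =
      ∫ ξ, (∫ t, F t * Complex.exp (-vline s ξ * t)) * laplace ψ (vline s ξ) := by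
  have h1 := VectorFourier.integral_fourierIntegral_smul_eq_flip (L := innerₗ ℝ)
    (μ := volume) (ν := volume) Real.continuous_fourierChar continuous_inner hF
    (integrable_laplace_vline hψ hc s)
  have e1 : ∀ ξ, VectorFourier.fourierIntegral Real.fourierChar volume (innerₗ ℝ)
      (fun t : ℝ => F t * Complex.exp (-s * t)) ξ = ∫ t, F t * Complex.exp (-vline s ξ * t) := by
    intro ξ
    have : VectorFourier.fourierIntegral Real.fourierChar volume (innerₗ ℝ)
      (fun t : ℝ => F t * Complex.exp (-s * t)) ξ =
        𝓕 (fun t : ℝ => F t * Complex.exp (-s * t)) ξ := rfl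
    rw [this, Real.fourier_eq']
    refine integral_congr_ae (Filter.Eventually.of_forall fun t => ?_)
    simp only [smul_eq_mul]
    rw [mul_left_comm, ← Complex.exp_add]
    congr 2
    simp [vline]
    ring
  have e2 : ∀ t, VectorFourier.fourierIntegral Real.fourierChar volume (innerₗ ℝ).flip
      (fun ξ : ℝ => laplace ψ (vline s ξ)) t = Complex.exp (s * t) * ψ t := by
    intro t
    have : VectorFourier.fourierIntegral Real.fourierChar volume (innerₗ ℝ).flip
      (fun ξ : ℝ => laplace ψ (vline s ξ)) t = 𝓕 (fun ξ : ℝ => laplace ψ (vline s ξ)) t := by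
        rw [flip_innerₗ]; rfl
    rw [this, laplace_vline hψ hc, ← SchwartzMap.fourier_coe,
      FourierTransform.fourier_fourierInv_eq, expMulSchwartz_apply]
  simp only [e1, e2, smul_eq_mul] at h1
  rw [h1]
  refine integral_congr_ae (Filter.Eventually.of_forall fun t => ?_)
  simp only
  have : Complex.exp (-s * t) * Complex.exp (s * t) = 1 := by rw [← Complex.exp_add]; simp
  linear_combination (-F t * ψ t) * this

end LaplaceTransform


/-! ### Integrals against the primitive `K_{d,σ}` -/

section Primitive

open MeasureTheory

/-- Termwise integration of a series dominated by `A i * b t`, over an index set of any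
cardinality. -/
theorem hasSum_integral_of_norm_le_mul {α ι : Type*} [MeasurableSpace α] {μ : Measure α} {T : Set α}
    (hT : ∀ᵐ t ∂μ, t ∈ T) {F : ι → α → ℂ} {A : ι → ℝ} {b : α → ℝ} (hA : Summable A)
    (hF : ∀ i, AEStronglyMeasurable (F i) μ) (hb : Integrable b μ)
    (h : ∀ i, ∀ t ∈ T, ‖F i t‖ ≤ A i * b t) :
    Integrable (fun t => ∑' i, F i t) μ ∧
      HasSum (fun i => ∫ t, F i t ∂μ) (∫ t, ∑' i, F i t ∂μ) := by
  have hFs : ∀ t ∈ T, Summable fun i => ‖F i t‖ := fun t ht =>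
    Summable.of_nonneg_of_le (fun _ => norm_nonneg _) (fun i => h i t ht) (hA.mul_right _)
  -- only countably many terms are not identically zero on `T`
  set S : Set ι := Function.support A with hS
  have hSc : S.Countable := hA.countable_support
  have : Countable S := hSc.to_subtype
  have hF0 : ∀ i ∉ S, ∀ t ∈ T, F i t = 0 := fun i hi t ht => by
    have h1 := h i t ht
    rw [Function.notMem_support.1 hi, zero_mul] at h1
    exact norm_le_zero_iff.1 h1
  have hts : ∀ t ∈ T, ∑' i : S, F i t = ∑' i, F i t := fun t ht =>
    tsum_subtype_eq_of_support_subset fun i hi => by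
      by_contra hiS
      exact hi (hF0 i hiS t ht)
  have hbd : ∀ t ∈ T, ‖∑' i, F i t‖ ≤ (∑' i, A i) * b t := fun t ht => by
    rw [← tsum_mul_right]
    exact tsum_of_norm_bounded (hA.mul_right _).hasSum fun i => h i t ht
  have hint : ∀ i, Integrable (F i) μ := fun i =>
    (hb.const_mul (A i)).mono' (hF i) (hT.mono fun t ht => h i t ht)
  have hmeas : AEStronglyMeasurable (fun t => ∑' i, F i t) μ := by
    refine aestronglyMeasurable_of_tendsto_ae Filter.atTop
      (f := fun (B : Finset S) t => ∑ i ∈ B, F i t)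
      (fun B => ?_) (hT.mono fun t ht => ?_)
    · exact Finset.aestronglyMeasurable_fun_sum _ fun i _ => hF i
    · rw [← hts t ht]
      exact ((hFs t ht).of_norm.subtype S).hasSum
  refine ⟨(hb.const_mul _).mono' hmeas (hT.mono hbd), ?_⟩
  have hsum : Summable fun i : S => ∫ t, ‖F i t‖ ∂μ := by
    refine Summable.of_nonneg_of_le (fun _ => integral_nonneg fun _ => norm_nonneg _) (fun i => ?_)
      ((hA.subtype S).mul_right (∫ t, b t ∂μ))
    rw [← integral_const_mul]
    exact integral_mono_ae (hint i).norm (hb.const_mul _) (hT.mono fun t ht => h i t ht)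
  have h1 := hasSum_integral_of_summable_integral_norm (fun i : S => hint i) hsum
  rw [integral_congr_ae (hT.mono hts)] at h1
  refine (hasSum_subtype_iff_of_support_subset (s := S) (f := fun i => ∫ t, F i t ∂μ)
    fun i hi => ?_).1 h1
  by_contra hiS
  exact hi (integral_eq_zero_of_ae (hT.mono fun t ht => hF0 i hiS t ht))

variable {f : ℂ → ℂ} {c M : ℝ} {σ : ℂ}

theorem norm_mult_div_mul_exp_le (hM : ∀ ρ, mult f ρ ≠ 0 → (ρ - σ).re ≤ M) (d : ℕ) (ρ : ℂ) {t : ℝ}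
    (ht : 0 ≤ t) : ‖mult f ρ / (ρ - σ) ^ d * Complex.exp ((ρ - σ) * t)‖ ≤
      |(mult f ρ : ℝ)| * (‖ρ - σ‖ ^ d)⁻¹ * Real.exp (M * t) := by
  by_cases h0 : mult f ρ = 0
  · simp [h0]
  rw [norm_mul, norm_div, norm_pow, Complex.norm_intCast, Complex.norm_exp, div_eq_mul_inv]
  gcongr
  have h1 := hM ρ h0
  have h2 : ((ρ - σ) * (t : ℂ)).re = (ρ - σ).re * t := by simp
  rw [h2]
  gcongr

theorem summable_mult_div_mul_exp (hf : Meromorphic f)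
    (hM : ∀ ρ, mult f ρ ≠ 0 → (ρ - σ).re ≤ M) {d : ℕ} (hd : d ∈ convergenceExponents f) {t : ℝ}
    (ht : 0 ≤ t) : Summable fun ρ : {ρ : ℂ // ρ ≠ σ} =>
      mult f ρ / ((ρ : ℂ) - σ) ^ d * Complex.exp ((ρ - σ) * t) :=
  Summable.of_norm_bounded
    (((summable_mult_iff hf σ d).2 ((mem_convergenceExponents_iff hf d).1 hd)).mul_right _)
    fun ρ => norm_mult_div_mul_exp_le hM d ρ ht

/-- Subtracting `K_{d,σ}(0)` term by term; here `d ≠ 0` removes the contribution of the term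
`n_σ t^d / d!` at `t = 0`. -/
theorem newtonCramerPrimitive_sub (hf : Meromorphic f)
    (hM : ∀ ρ, mult f ρ ≠ 0 → (ρ - σ).re ≤ M)
    (hd : convergenceExponent f ∈ convergenceExponents f) (hd0 : convergenceExponent f ≠ 0) {t : ℝ}
    (ht : 0 ≤ t) : newtonCramerPrimitive f σ t - newtonCramerPrimitive f σ 0 =
      mult f σ * (t : ℂ) ^ convergenceExponent f / (convergenceExponent f).factorial +
        ∑' ρ : {ρ : ℂ // ρ ≠ σ}, mult f ρ / ((ρ : ℂ) - σ) ^ convergenceExponent f *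
          (Complex.exp ((ρ - σ) * t) - 1) := by
  have h1 := summable_mult_div_mul_exp hf hM hd ht
  have h2 := summable_mult_div_mul_exp hf hM hd le_rfl
  simp only [Complex.ofReal_zero, mul_zero, Complex.exp_zero, mul_one] at h2
  simp only [newtonCramerPrimitive, Complex.ofReal_zero, mul_zero, Complex.exp_zero, mul_one,
    zero_pow hd0, zero_div, zero_add, mul_sub]
  rw [add_sub_assoc, h1.tsum_sub h2]

/-- Termwise integration of `K_{d,σ} - K_{d,σ}(0)` on the half line. -/
theorem hasSum_integral_newtonCramerPrimitive (hf : Meromorphic f) (hM0 : 0 ≤ M)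
    (hM : ∀ ρ, mult f ρ ≠ 0 → (ρ - σ).re ≤ M)
    (hd : convergenceExponent f ∈ convergenceExponents f) (hd0 : convergenceExponent f ≠ 0)
    {h : ℝ → ℂ} (hh : Continuous h)
    (h1 : IntegrableOn (fun t => Real.exp (M * t) * ‖h t‖) (Set.Ici 0))
    (h2 : IntegrableOn (fun t : ℝ => (t : ℂ) ^ convergenceExponent f * h t) (Set.Ici 0)) :
    IntegrableOn (fun t => (newtonCramerPrimitive f σ t - newtonCramerPrimitive f σ 0) * h t)
      (Set.Ici 0) ∧
    HasSum (fun ρ : {ρ : ℂ // ρ ≠ σ} => mult f ρ / ((ρ : ℂ) - σ) ^ convergenceExponent f *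
      ∫ t in Set.Ici (0 : ℝ), (Complex.exp ((ρ - σ) * t) - 1) * h t)
      ((∫ t in Set.Ici (0 : ℝ), (newtonCramerPrimitive f σ t - newtonCramerPrimitive f σ 0) * h t) -
        mult f σ / (convergenceExponent f).factorial *
          ∫ t in Set.Ici (0 : ℝ), (t : ℂ) ^ convergenceExponent f * h t) := by
  set d := convergenceExponent f with hdd
  set F : {ρ : ℂ // ρ ≠ σ} → ℝ → ℂ := fun ρ t => mult f ρ / ((ρ : ℂ) - σ) ^ d *
    ((Complex.exp ((ρ - σ) * t) - 1) * h t) with hF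
  have hA := (summable_mult_iff hf σ d).2 ((mem_convergenceExponents_iff hf d).1 hd)
  have hb := hasSum_integral_of_norm_le_mul (μ := volume.restrict (Set.Ici (0 : ℝ)))
    (T := Set.Ici 0) (ae_restrict_mem measurableSet_Ici) (F := F)
    (b := fun t => 2 * (Real.exp (M * t) * ‖h t‖)) hA
    (fun ρ => (by fun_prop : Continuous (F ρ)).aestronglyMeasurable) (h1.const_mul 2)
    (fun ρ t ht => by
      have e1 := norm_mult_div_mul_exp_le hM d ρ ht
      have e2 := norm_mult_div_mul_exp_le hM d ρ le_rfl
      simp only [Complex.ofReal_zero, mul_zero, Complex.exp_zero, mul_one, Real.exp_zero] at e2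
      have e3 : 1 ≤ Real.exp (M * t) := Real.one_le_exp (mul_nonneg hM0 ht)
      have e4 : F ρ t = (mult f ρ / ((ρ : ℂ) - σ) ^ d * Complex.exp ((ρ - σ) * t) -
        mult f ρ / ((ρ : ℂ) - σ) ^ d) * h t := by rw [hF]; ring
      rw [e4, norm_mul]
      have e5 : 0 ≤ |(mult f ρ : ℝ)| * (‖(ρ : ℂ) - σ‖ ^ d)⁻¹ := by positivity
      calc _ ≤ (|(mult f ρ : ℝ)| * (‖(ρ : ℂ) - σ‖ ^ d)⁻¹ * Real.exp (M * t) +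
              |(mult f ρ : ℝ)| * (‖(ρ : ℂ) - σ‖ ^ d)⁻¹) * ‖h t‖ := by
            gcongr
            exact (norm_sub_le _ _).trans (add_le_add e1 e2)
        _ ≤ (|(mult f ρ : ℝ)| * (‖(ρ : ℂ) - σ‖ ^ d)⁻¹ * Real.exp (M * t) +
              |(mult f ρ : ℝ)| * (‖(ρ : ℂ) - σ‖ ^ d)⁻¹ * Real.exp (M * t)) * ‖h t‖ := by
            have e6 := le_mul_of_one_le_right e5 e3
            exact mul_le_mul_of_nonneg_right (by linarith) (norm_nonneg _)
        _ = _ := by ring)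
  have heq : Set.EqOn (fun t => (newtonCramerPrimitive f σ t - newtonCramerPrimitive f σ 0) * h t)
      (fun t => mult f σ / d.factorial * ((t : ℂ) ^ d * h t) + ∑' ρ, F ρ t) (Set.Ici 0) := by
    intro t ht
    simp only [hF]
    rw [newtonCramerPrimitive_sub hf hM hd hd0 ht, add_mul, ← tsum_mul_right]
    congr 1
    · ring
    · exact tsum_congr fun ρ => by ring
  have hi := (h2.const_mul (mult f σ / d.factorial : ℂ)).add hb.1
  refine ⟨IntegrableOn.congr_fun hi heq.symm measurableSet_Ici, ?_⟩
  rw [setIntegral_congr_fun measurableSet_Ici heq, integral_add (h2.const_mul _) hb.1,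
    integral_const_mul, add_sub_cancel_left]
  refine hb.2.congr_fun fun ρ => ?_
  rw [hF, integral_const_mul]

theorem integrableOn_exp_neg_mul {z : ℂ} (hz : 0 < z.re) :
    IntegrableOn (fun t : ℝ => Complex.exp (-z * t)) (Set.Ici 0) := by
  rw [integrableOn_Ici_iff_integrableOn_Ioi]
  exact integrableOn_exp_mul_complex_Ioi (by simpa using hz) 0

theorem integral_exp_neg_mul {z : ℂ} (hz : 0 < z.re) :
    ∫ t in Set.Ici (0 : ℝ), Complex.exp (-z * t) = z⁻¹ := by
  rw [integral_Ici_eq_integral_Ioi, integral_exp_mul_complex_Ioi (by simpa using hz)]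
  simp [neg_div_neg_eq]

theorem integrableOn_pow_mul_exp_neg_mul (d : ℕ) {z : ℂ} (hz : 0 < z.re) :
    IntegrableOn (fun t : ℝ => (t : ℂ) ^ d * Complex.exp (-z * t)) (Set.Ici 0) := by
  rw [integrableOn_Ici_iff_integrableOn_Ioi]
  have h1 := integrableOn_rpow_mul_exp_neg_mul_rpow (p := 1) (s := d)
    (by have := (Nat.cast_nonneg d : (0 : ℝ) ≤ d); linarith) one_pos hz
  refine Integrable.mono' h1 (by fun_prop) ((ae_restrict_mem measurableSet_Ioi).mono fun t ht => ?_)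
  have ht : 0 < t := ht
  rw [norm_mul, norm_pow, Complex.norm_real, Complex.norm_exp, Real.norm_of_nonneg ht.le,
    Real.rpow_natCast, Real.rpow_one]
  simp

theorem integral_pow_mul_exp_neg_mul (d : ℕ) {z : ℂ} (hz : 0 < z.re) :
    ∫ t in Set.Ici (0 : ℝ), (t : ℂ) ^ d * Complex.exp (-z * t) = d.factorial / z ^ (d + 1) := by
  have hz0 : z ≠ 0 := fun h => by simp [h] at hz
  induction d with
  | zero => simpa using integral_exp_neg_mul hz
  | succ d ih =>
    have h1 := (integrableOn_pow_mul_exp_neg_mul d hz).const_mul ((d : ℂ) + 1)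
    have h2 := (integrableOn_pow_mul_exp_neg_mul (d + 1) hz).const_mul z
    have hder : ∀ t : ℝ, HasDerivAt (fun t : ℝ => (t : ℂ) ^ (d + 1) * Complex.exp (-z * t))
        (((d : ℂ) + 1) * ((t : ℂ) ^ d * Complex.exp (-z * t)) -
          z * ((t : ℂ) ^ (d + 1) * Complex.exp (-z * t))) t := fun t => by
      have := ((hasDerivAt_pow (d + 1) (t : ℂ)).comp_ofReal).fun_mul (hasDerivAt_exp_mul (-z) t)
      refine this.congr_deriv ?_
      push_cast
      ring
    have h12 := Integrable.sub h1 h2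
    have hlim := tendsto_zero_of_hasDerivAt_of_integrableOn_Ioi (a := 0) (fun t _ => hder t)
      (IntegrableOn.mono_set h12 Set.Ioi_subset_Ici_self)
      ((integrableOn_pow_mul_exp_neg_mul (d + 1) hz).mono_set Set.Ioi_subset_Ici_self)
    have h3 := integral_Ioi_of_hasDerivAt_of_tendsto' (a := 0) (fun t _ => hder t)
      (IntegrableOn.mono_set h12 Set.Ioi_subset_Ici_self) hlim
    rw [← integral_Ici_eq_integral_Ioi, integral_sub h1 h2, integral_const_mul, integral_const_mul,
      ih] at h3
    simp only [Complex.ofReal_zero, zero_pow (Nat.succ_ne_zero d), zero_mul, sub_zero] at h3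
    have h4 := sub_eq_zero.1 h3
    rw [← mul_right_inj' hz0, ← h4, Nat.factorial_succ]
    push_cast
    field_simp
    ring

/-- The elementary partial fraction identity behind the Laplace transform of `K_{d,σ}`. -/
theorem pow_mul_inv_sub_identity {z w : ℂ} (hz : z ≠ 0) (hw : w ≠ 0) (hzw : z ≠ w) (m : ℕ) :
    z ^ (m + 1) / w ^ (m + 1) * ((z - w)⁻¹ - z⁻¹) =
      (z - w)⁻¹ + ∑ j ∈ Finset.range m, z ^ j / w ^ (j + 1) := by
  have h : z - w ≠ 0 := sub_ne_zero.2 hzw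
  induction m with
  | zero => simp; field_simp; ring
  | succ m ih =>
    rw [Finset.sum_range_succ, ← add_assoc, ← ih]
    field_simp
    ring

/-- The Laplace transform of `K_{d,σ} - K_{d,σ}(0)`, multiplied by `z ^ d`, is `f' / f - Q'` at
`z + σ`: termwise integration reproduces the partial fraction expansion of `f' / f`. -/
theorem pow_mul_integral_newtonCramerPrimitive (hf : Meromorphic f)
    (hfd : ∀ s : ℂ, c < s.re → DifferentiableAt ℂ f s ∧ f s ≠ 0) (hM0 : 0 ≤ M)
    (hMc : c ≤ M + σ.re)
    (hd : convergenceExponent f ∈ convergenceExponents f) (hd0 : convergenceExponent f ≠ 0)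
    {Q : Polynomial ℂ} (hQ : IsHadamardExponent f σ Q) {z : ℂ} (hz : M < z.re) :
    IntegrableOn (fun t : ℝ => (newtonCramerPrimitive f σ t - newtonCramerPrimitive f σ 0) *
      Complex.exp (-z * t)) (Set.Ici 0) ∧
    z ^ convergenceExponent f * ∫ t in Set.Ici (0 : ℝ),
      (newtonCramerPrimitive f σ t - newtonCramerPrimitive f σ 0) * Complex.exp (-z * t) =
      logDeriv f (z + σ) - Q.derivative.eval (z + σ) := by
  obtain ⟨m, hm⟩ := Nat.exists_eq_succ_of_ne_zero hd0
  have hz0 : 0 < z.re := hM0.trans_lt hz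
  have hzne : z ≠ 0 := fun h => by simp [h] at hz0
  have hM : ∀ ρ, mult f ρ ≠ 0 → (ρ - σ).re ≤ M := fun ρ hρ => by
    have := re_le_of_mult_ne_zero hfd hρ
    rw [Complex.sub_re]; linarith
  have h1 : IntegrableOn (fun t : ℝ => Real.exp (M * t) * ‖Complex.exp (-z * t)‖) (Set.Ici 0) := by
    have := (integrableOn_exp_neg_mul (z := z - M) (by simpa using hz)).norm
    refine this.congr (Filter.Eventually.of_forall fun t => ?_)
    simp only [Complex.norm_exp, ← Real.exp_add]
    congr 1
    simp
    ring
  obtain ⟨h2, h3⟩ := hasSum_integral_newtonCramerPrimitive hf hM0 hM hd hd0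
    (h := fun t => Complex.exp (-z * t)) (by fun_prop) h1
    (integrableOn_pow_mul_exp_neg_mul _ hz0)
  refine ⟨h2, ?_⟩
  have hQ' := hQ
  rw [IsHadamardExponent, hm, Nat.succ_sub_one] at hQ'
  have h4 := hasSum_logDeriv hf hfd (m := m) (by rw [← Nat.succ_eq_add_one, ← hm]; exact hd) hQ'
    (s := z + σ) (by rw [Complex.add_re]; linarith)
  rw [integral_pow_mul_exp_neg_mul _ hz0] at h3
  have h5 : ∀ ρ : {ρ : ℂ // ρ ≠ σ}, (mult f ρ : ℂ) ≠ 0 →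
      ∫ t in Set.Ici (0 : ℝ), (Complex.exp ((ρ - σ) * t) - 1) * Complex.exp (-z * t) =
        (z - (ρ - σ))⁻¹ - z⁻¹ := by
    intro ρ hρ
    have hre : 0 < (z - (ρ - σ)).re := by
      have := hM ρ (by exact_mod_cast hρ)
      rw [Complex.sub_re]; linarith
    rw [← integral_exp_neg_mul hre, ← integral_exp_neg_mul hz0,
      ← integral_sub (integrableOn_exp_neg_mul hre) (integrableOn_exp_neg_mul hz0)]
    refine integral_congr_ae (Filter.Eventually.of_forall fun t => ?_)
    simp only
    rw [sub_mul, one_mul, ← Complex.exp_add]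
    congr 2
    ring
  set I := ∫ t in Set.Ici (0 : ℝ),
      (newtonCramerPrimitive f σ t - newtonCramerPrimitive f σ 0) * Complex.exp (-z * t) with hI
  have h6 := h3.mul_left (z ^ (m + 1))
  have h7 : (fun ρ : {ρ : ℂ // ρ ≠ σ} => z ^ (m + 1) *
      (mult f ρ / ((ρ : ℂ) - σ) ^ convergenceExponent f *
      ∫ t in Set.Ici (0 : ℝ), (Complex.exp ((ρ - σ) * t) - 1) * Complex.exp (-z * t))) =
      fun ρ : {ρ : ℂ // ρ ≠ σ} => (mult f ρ : ℂ) * ((z + σ - ρ)⁻¹ +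
        ∑ j ∈ Finset.range m, (z + σ - σ) ^ j / ((ρ : ℂ) - σ) ^ (j + 1)) := by
    funext ρ
    by_cases hρ : (mult f ρ : ℂ) = 0
    · simp [hρ]
    have hne : z ≠ ρ - σ := fun h => by
      have := hM ρ (by exact_mod_cast hρ)
      rw [← h] at this
      linarith
    rw [h5 ρ hρ, hm, add_sub_cancel_right, show z + σ - (ρ : ℂ) = z - (ρ - σ) by ring,
      ← pow_mul_inv_sub_identity hzne (sub_ne_zero.2 ρ.2) hne, Nat.succ_eq_add_one]
    ring
  rw [h7] at h6
  have h8 := hasSum_of_hasSum_subtype_ne (F := fun ρ : ℂ => (mult f ρ : ℂ) * ((z + σ - ρ)⁻¹ +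
        ∑ j ∈ Finset.range m, (z + σ - σ) ^ j / (ρ - σ) ^ (j + 1))) h6
  rw [h4.unique h8, hm, Nat.succ_eq_add_one]
  have hfac : ((m + 1).factorial : ℂ) ≠ 0 := by exact_mod_cast (m + 1).factorial_ne_zero
  simp
  field_simp
  ring

end Primitive


/-! ### Evaluation of the distributions on test functions -/

section Evaluation

open MeasureTheory

/-- The test functions on the real line. -/
noncomputable abbrev Test : Type := 𝓓((⊤ : TopologicalSpace.Opens ℝ), ℝ)

/-- A real test function, seen as a complex-valued function. -/
noncomputable def complexify (φ : Test) (t : ℝ) : ℂ := (φ t : ℂ)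

theorem contDiff_complexify (φ : Test) : ContDiff ℝ ∞ (complexify φ) :=
  Complex.ofRealCLM.contDiff.comp φ.contDiff

theorem hasCompactSupport_complexify (φ : Test) : HasCompactSupport (complexify φ) :=
  φ.hasCompactSupport.comp_left Complex.ofReal_zero

theorem tsupport_complexify_subset (φ : Test) : tsupport (complexify φ) ⊆ tsupport φ :=
  tsupport_comp_subset Complex.ofReal_zero φ

/-- The derivative of a test function. -/
noncomputable def testDeriv (φ : Test) : Test := TestFunction.lineDerivCLM ℝ (1 : ℝ) φ

theorem coe_testDeriv (φ : Test) : ⇑(testDeriv φ) = deriv φ := by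
  funext t
  rw [testDeriv, TestFunction.lineDerivCLM_apply_of_le (by simp)]
  rw [((φ.contDiff.differentiable (by simp)) t).lineDeriv_eq_fderiv, fderiv_apply_one_eq_deriv]

theorem coe_iterate_testDeriv (n : ℕ) (φ : Test) : ⇑(testDeriv^[n] φ) = iteratedDeriv n φ := by
  induction n with
  | zero => simp
  | succ n ih => rw [Function.iterate_succ_apply', coe_testDeriv, ih, iteratedDeriv_succ]

theorem distDeriv_apply (W : Dist) (φ : Test) : distDeriv W φ = -W (testDeriv φ) := rfl

theorem iterate_distDeriv_apply (n : ℕ) (W : Dist) (φ : Test) :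
    distDeriv^[n] W φ = (-1) ^ n * W (testDeriv^[n] φ) := by
  induction n generalizing φ with
  | zero => simp
  | succ n ih =>
    rw [Function.iterate_succ_apply', distDeriv_apply, ih, Function.iterate_succ_apply, pow_succ]
    ring

theorem dirac_apply (x : ℝ) (φ : Test) : dirac x φ = φ x := rfl

theorem ofFun_apply {F : ℝ → ℂ} (hF : LocallyIntegrable F) (φ : Test) :
    ofFun F φ = ∫ t, φ t • F t := by
  have : LocallyIntegrableOn F ((⊤ : TopologicalSpace.Opens ℝ) : Set ℝ) volume :=
    hF.locallyIntegrableOn _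
  exact TestFunction.integralAgainstBilinCLM_eq_integral this

/-- Test functions are real, so a complex-valued one is differentiated through its real and
imaginary parts. -/
theorem iteratedDeriv_ofReal_add_I_mul {u v : ℝ → ℝ} (hu : ContDiff ℝ ∞ u) (hv : ContDiff ℝ ∞ v)
    (n : ℕ) : iteratedDeriv n (fun t => (u t : ℂ) + Complex.I * v t) =
      fun t => ((iteratedDeriv n u t : ℝ) : ℂ) + Complex.I * (iteratedDeriv n v t : ℝ) := by
  induction n with
  | zero => simp
  | succ n ih =>
    rw [iteratedDeriv_succ, ih]
    funext t
    have h1 : ∀ {w : ℝ → ℝ}, ContDiff ℝ ∞ w →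
        HasDerivAt (iteratedDeriv n w) (iteratedDeriv (n + 1) w t) t := fun {w} hw => by
      rw [iteratedDeriv_succ]
      exact ((hw.differentiable_iteratedDeriv n
        (by exact_mod_cast WithTop.coe_lt_top n)) t).hasDerivAt
    exact ((h1 hu).ofReal_comp.add ((h1 hv).ofReal_comp.const_mul Complex.I)).deriv

theorem iteratedDeriv_complexify (n : ℕ) (φ : Test) (t : ℝ) :
    iteratedDeriv n (complexify φ) t = (iteratedDeriv n φ t : ℝ) := by
  have h := congrFun (iteratedDeriv_ofReal_add_I_mul φ.contDiff (contDiff_const (c := (0 : ℝ))) n) t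
  have e : (fun t => (φ t : ℂ) + Complex.I * ((0 : ℝ) : ℂ)) = complexify φ := by
    funext t; simp [complexify]
  rw [e] at h
  rw [h]
  have : iteratedDeriv n (fun _ : ℝ => (0 : ℝ)) t = 0 := by
    rw [iteratedDeriv_const]; simp
  simp [this]

/-- For a locally integrable `F`, the derivatives and the factor `e^{σt}` are moved to the test
function. -/
theorem expMul_iterate_distDeriv_ofFun (σ : ℂ) (n : ℕ) {F : ℝ → ℂ} (hF : LocallyIntegrable F)
    (φ : Test) : expMul σ (distDeriv^[n] (ofFun F)) φ =
      (-1) ^ n * ∫ t, F t *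
        iteratedDeriv n (fun t : ℝ => Complex.exp (σ * t) * complexify φ t) t := by
  have hint : ∀ φ : Test, Integrable fun t => φ t • F t := fun φ =>
    hF.integrable_smul_left_of_hasCompactSupport φ.continuous φ.hasCompactSupport
  rw [expMul_apply, iterate_distDeriv_apply, iterate_distDeriv_apply, ofFun_apply hF,
    ofFun_apply hF, mul_left_comm, ← mul_add, ← integral_const_mul,
    ← integral_add (hint _) ((hint _).const_mul _)]
  congr 1
  refine integral_congr_ae (Filter.Eventually.of_forall fun t => ?_)
  have h1 := iteratedDeriv_ofReal_add_I_mul (mulTest _ (contDiff_re_exp σ) φ).contDiff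
    (mulTest _ (contDiff_im_exp σ) φ).contDiff n
  have h2 : (fun t : ℝ => Complex.exp (σ * t) * complexify φ t) = fun t =>
      ((mulTest _ (contDiff_re_exp σ) φ t : ℝ) : ℂ) +
        Complex.I * (mulTest _ (contDiff_im_exp σ) φ t : ℝ) := by
    funext t
    rw [mulTest_apply, mulTest_apply, complexify]
    conv_lhs => rw [← Complex.re_add_im (Complex.exp (σ * t))]
    push_cast
    ring
  simp only [h2, h1, coe_iterate_testDeriv, Complex.real_smul]
  ring

theorem integral_pow_mul_iteratedDeriv {ψ : ℝ → ℂ} (hψ : ContDiff ℝ ∞ ψ) (hc : HasCompactSupport ψ)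
    (n : ℕ) : ∫ t : ℝ, (t : ℂ) ^ n * iteratedDeriv n ψ t = (-1) ^ n * n.factorial * ∫ t, ψ t := by
  induction n with
  | zero => simp
  | succ n ih =>
    have hder : ∀ t : ℝ, HasDerivAt (fun t : ℝ => (t : ℂ) ^ (n + 1))
        (((n : ℂ) + 1) * (t : ℂ) ^ n) t := fun t => by
      simpa using (hasDerivAt_pow (n + 1) (t : ℂ)).comp_ofReal
    rw [iteratedDeriv_succ, integral_mul_deriv_of_hasCompactSupport hder (by fun_prop)
      (contDiff_iteratedDeriv hψ n) (hasCompactSupport_iteratedDeriv hc n)]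
    simp only [mul_assoc]
    rw [integral_const_mul, ih, Nat.factorial_succ]
    push_cast
    ring

end Evaluation


/-! ### The Newton-Cramer distribution on test functions -/

section NewtonCramer

open MeasureTheory

variable {f : ℂ → ℂ} {c : ℝ} {σ : ℂ}

theorem complexify_exp_contDiff (σ : ℂ) (φ : Test) :
    ContDiff ℝ ∞ fun t : ℝ => Complex.exp (σ * t) * complexify φ t :=
  (contDiff_exp_mul σ).mul (contDiff_complexify φ)

theorem complexify_exp_hasCompactSupport (σ : ℂ) (φ : Test) :
    HasCompactSupport fun t : ℝ => Complex.exp (σ * t) * complexify φ t :=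
  (hasCompactSupport_complexify φ).mul_left

/-- The definition of the Newton-Cramer distribution, evaluated on a test function. -/
theorem newtonCramer_eq_integral
    (hF : LocallyIntegrable ((Set.Ici (0 : ℝ)).indicator fun t =>
      newtonCramerPrimitive f σ t - newtonCramerPrimitive f σ 0)) (φ : Test) :
    newtonCramer f σ φ = (-1) ^ convergenceExponent f * ∫ t in Set.Ici (0 : ℝ),
      (newtonCramerPrimitive f σ t - newtonCramerPrimitive f σ 0) *
        iteratedDeriv (convergenceExponent f)
          (fun t : ℝ => Complex.exp (σ * t) * complexify φ t) t := by
  rw [newtonCramer, expMul_iterate_distDeriv_ofFun σ _ hF, ← integral_indicator measurableSet_Ici]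
  congr 1
  refine integral_congr_ae (Filter.Eventually.of_forall fun t => ?_)
  simp only [Set.indicator_apply]
  split_ifs <;> simp

theorem locallyIntegrable_of_integrable_mul_exp {G : ℝ → ℂ} {z : ℂ}
    (h : Integrable fun t : ℝ => G t * Complex.exp (-z * t)) : LocallyIntegrable G := by
  have h1 := h.locallyIntegrable.locallyIntegrableOn Set.univ
  have h2 := h1.mul_continuousOn (g := fun t : ℝ => Complex.exp (z * t)) (by fun_prop)
    isOpen_univ.isLocallyClosed
  rw [locallyIntegrableOn_univ] at h2
  refine h2.congr (Filter.Eventually.of_forall fun t => ?_)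
  simp only
  rw [mul_assoc, ← Complex.exp_add]
  simp

/-- The hypotheses on `f` under which the Newton-Cramer distribution is evaluated: `f` is
meromorphic, holomorphic without zeros on `Re s > c`, and its convergence exponent is attained and
positive. -/
structure IsAdmissible (f : ℂ → ℂ) (c : ℝ) : Prop where
  meromorphic : Meromorphic f
  regular : ∀ s : ℂ, c < s.re → DifferentiableAt ℂ f s ∧ f s ≠ 0
  mem : convergenceExponent f ∈ convergenceExponents f
  ne_zero : convergenceExponent f ≠ 0

theorem IsAdmissible.re_sub_le (hf : IsAdmissible f c) (σ : ℂ) (ρ : ℂ) (hρ : mult f ρ ≠ 0) :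
    (ρ - σ).re ≤ max 0 (c - σ.re) := by
  refine le_trans ?_ (le_max_right _ _)
  have := re_le_of_mult_ne_zero hf.regular hρ
  rw [Complex.sub_re]; linarith

theorem IsAdmissible.laplace_primitive (hf : IsAdmissible f c) {Q : Polynomial ℂ}
    (hQ : IsHadamardExponent f σ Q) {z : ℂ} (hz : max 0 (c - σ.re) < z.re) :
    IntegrableOn (fun t : ℝ => (newtonCramerPrimitive f σ t - newtonCramerPrimitive f σ 0) *
      Complex.exp (-z * t)) (Set.Ici 0) ∧
    z ^ convergenceExponent f * ∫ t in Set.Ici (0 : ℝ),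
      (newtonCramerPrimitive f σ t - newtonCramerPrimitive f σ 0) * Complex.exp (-z * t) =
      logDeriv f (z + σ) - Q.derivative.eval (z + σ) :=
  pow_mul_integral_newtonCramerPrimitive hf.meromorphic hf.regular (le_max_left _ _)
    (by linarith [le_max_right 0 (c - σ.re)]) hf.mem hf.ne_zero hQ hz

theorem IsAdmissible.locallyIntegrable (hf : IsAdmissible f c) {Q : Polynomial ℂ}
    (hQ : IsHadamardExponent f σ Q) : LocallyIntegrable ((Set.Ici (0 : ℝ)).indicator fun t =>
      newtonCramerPrimitive f σ t - newtonCramerPrimitive f σ 0) := by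
  have h1 := (hf.laplace_primitive (z := ((max 0 (c - σ.re) + 1 : ℝ) : ℂ)) hQ
    (by rw [Complex.ofReal_re]; linarith)).1
  refine locallyIntegrable_of_integrable_mul_exp (z := ((max 0 (c - σ.re) + 1 : ℝ) : ℂ)) ?_
  refine ((integrable_indicator_iff measurableSet_Ici).2 h1).congr
    (Filter.Eventually.of_forall fun t => ?_)
  simp only [Set.indicator_apply]
  split_ifs <;> simp

/-- The Newton-Cramer distribution as an integral along a vertical line: Parseval's formula turns
its definition into the integral of `f' / f - Q'` against the Laplace transform. -/
theorem IsAdmissible.newtonCramer_eq_integral_laplace (hf : IsAdmissible f c) {Q : Polynomial ℂ}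
    (hQ : IsHadamardExponent f σ Q) {x : ℝ} (hx : max 0 (c - σ.re) < x) (φ : Test) :
    newtonCramer f σ φ = ∫ ξ, (logDeriv f (vline (x + σ) ξ) - Q.derivative.eval (vline (x + σ) ξ)) *
      laplace (complexify φ) (vline (x + σ) ξ) := by
  set G : ℝ → ℂ := (Set.Ici (0 : ℝ)).indicator fun t =>
      newtonCramerPrimitive f σ t - newtonCramerPrimitive f σ 0 with hG
  have hGmul : ∀ h : ℝ → ℂ, (fun t => G t * h t) = (Set.Ici (0 : ℝ)).indicator fun t =>
      (newtonCramerPrimitive f σ t - newtonCramerPrimitive f σ 0) * h t := by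
    intro h; funext t
    simp only [hG, Set.indicator_apply]
    split_ifs <;> simp
  have hGint : ∀ h : ℝ → ℂ, ∫ t in Set.Ici (0 : ℝ),
      (newtonCramerPrimitive f σ t - newtonCramerPrimitive f σ 0) * h t = ∫ t, G t * h t := by
    intro h
    rw [hGmul, integral_indicator measurableSet_Ici]
  have h1 := (hf.laplace_primitive (z := x) hQ (by simpa using hx)).1
  rw [← integrable_indicator_iff measurableSet_Ici, ← hGmul] at h1
  set χ : ℝ → ℂ := fun t : ℝ => Complex.exp (σ * t) * complexify φ t with hχ
  have hχc := complexify_exp_contDiff σ φ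
  have hχs := complexify_exp_hasCompactSupport σ φ
  rw [newtonCramer_eq_integral (hf.locallyIntegrable hQ), hGint,
    integral_mul_eq_integral_laplace (contDiff_iteratedDeriv hχc (convergenceExponent f))
      (hasCompactSupport_iteratedDeriv hχs (convergenceExponent f)) x h1, ← integral_const_mul]
  refine integral_congr_ae (Filter.Eventually.of_forall fun ξ => ?_)
  have hv : vline (x + σ) ξ = vline x ξ + σ := by simp [vline]; ring
  have h2 := (hf.laplace_primitive (z := vline x ξ) hQ (by rw [vline_re]; simpa using hx)).2
  simp only
  rw [hv, ← h2, hGint, laplace_iteratedDeriv hχc hχs, laplace_exp_mul, neg_pow (vline _ _)]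
  have h3 : (-1 : ℂ) ^ convergenceExponent f * (-1) ^ convergenceExponent f = 1 := by
    rw [← mul_pow]; simp
  linear_combination (∫ t, G t * Complex.exp (-vline x ξ * t)) * vline x ξ ^ convergenceExponent f *
    laplace (complexify φ) (vline x ξ + σ) * h3

theorem eval_eq_sum_range_of_degree_lt {P : Polynomial ℂ} {g : ℕ} (h : P.degree < g) (s : ℂ) :
    P.eval s = ∑ k ∈ Finset.range g, P.coeff k * s ^ k := by
  rcases eq_or_ne P 0 with rfl | hP
  · simp
  · exact Polynomial.eval_eq_sum_range' ((Polynomial.natDegree_lt_iff_degree_lt hP).2 h) s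

/-- A Dirichlet expansion of `f' / f` gives the expansion of its integral against the Laplace
transform of a test function in point evaluations. -/
theorem hasSum_integral_laplace {ι : Type*} {β : ι → ℂ} {μ : ι → ℝ} (hμ : ∀ k, 0 ≤ μ k)
    (hβ : Summable fun k => ‖β k‖ * Real.exp (-μ k * c)) {L : ℂ → ℂ}
    (hL : ∀ s : ℂ, c < s.re → HasSum (fun k => β k * Complex.exp (-μ k * s)) (L s))
    {s : ℂ} (hs : c < s.re) (φ : Test) :
    Integrable (fun ξ => L (vline s ξ) * laplace (complexify φ) (vline s ξ)) ∧
    HasSum (fun k => β k * φ (μ k))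
      (∫ ξ, L (vline s ξ) * laplace (complexify φ) (vline s ξ)) := by
  have hi := integrable_laplace_vline (contDiff_complexify φ) (hasCompactSupport_complexify φ) s
  have h1 := hasSum_integral_of_norm_le_mul (T := Set.univ) (μ := volume)
    (Filter.Eventually.of_forall fun _ => Set.mem_univ _)
    (F := fun k ξ => β k * (laplace (complexify φ) (vline s ξ) * Complex.exp (-vline s ξ * μ k)))
    hβ (fun k => ((hi.aestronglyMeasurable.mul (Continuous.aestronglyMeasurable
      (by have := continuous_vline s; fun_prop))).const_mul _)) hi.norm (fun k ξ _ => by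
        rw [norm_mul, norm_mul, Complex.norm_exp, mul_comm ‖laplace _ _‖, ← mul_assoc]
        have : (-vline s ξ * (μ k : ℂ)).re = -μ k * s.re := by
          rw [Complex.mul_re]; simp [vline_re, mul_comm]
        rw [this]
        exact mul_le_mul_of_nonneg_right (mul_le_mul_of_nonneg_left
          (Real.exp_le_exp.2 (by nlinarith [hμ k])) (norm_nonneg _)) (norm_nonneg _))
  have h2 : (fun ξ => ∑' k, β k * (laplace (complexify φ) (vline s ξ) *
      Complex.exp (-vline s ξ * μ k))) =
      fun ξ => L (vline s ξ) * laplace (complexify φ) (vline s ξ) := by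
    funext ξ
    rw [← (hL (vline s ξ) (by rwa [vline_re])).tsum_eq, ← tsum_mul_right]
    refine tsum_congr fun k => ?_
    rw [show -vline s ξ * (μ k : ℂ) = -μ k * vline s ξ by ring]
    ring
  rw [h2] at h1
  refine ⟨h1.1, h1.2.congr_fun fun k => ?_⟩
  rw [integral_const_mul,
    laplace_inversion (contDiff_complexify φ) (hasCompactSupport_complexify φ)]
  rfl

/-- The Poisson-Newton formula tested against `φ`, with the polynomial part moved to the other
side. The integral along a vertical line is split into that of `f' / f`, which gives the Dirac
masses, and that of `-Q'`, which gives the derivatives of `δ_0`. -/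
theorem IsAdmissible.hasSum_newtonCramer (hf : IsAdmissible f c) {Q : Polynomial ℂ}
    (hQ : IsHadamardExponent f σ Q) {g : ℕ} (hg : (-Q.derivative).degree < g)
    {ι : Type*} {β : ι → ℂ} {μ : ι → ℝ} (hμ : ∀ k, 0 ≤ μ k)
    (hβ : Summable fun k => ‖β k‖ * Real.exp (-μ k * c))
    (hL : ∀ s : ℂ, c < s.re → HasSum (fun k => β k * Complex.exp (-μ k * s)) (logDeriv f s))
    (φ : Test) : HasSum (fun k => β k * φ (μ k)) (newtonCramer f σ φ -
      ∑ k ∈ Finset.range g, (-Q.derivative).coeff k *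
        ((-1) ^ k * iteratedDeriv k (complexify φ) 0)) := by
  have hφ := contDiff_complexify φ
  have hφc := hasCompactSupport_complexify φ
  set x := max 0 (c - σ.re) + 1 with hx
  have hre : c < ((x : ℂ) + σ).re := by
    rw [Complex.add_re, Complex.ofReal_re]; linarith [le_max_right 0 (c - σ.re)]
  have h1 := hasSum_integral_laplace hμ hβ hL hre φ
  have h2 : (fun ξ => -Q.derivative.eval (vline (x + σ) ξ) *
      laplace (complexify φ) (vline (x + σ) ξ)) = fun ξ => ∑ k ∈ Finset.range g,
      (-Q.derivative).coeff k * (vline (x + σ) ξ ^ k *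
        laplace (complexify φ) (vline (x + σ) ξ)) := by
    funext ξ
    rw [← Polynomial.eval_neg, eval_eq_sum_range_of_degree_lt hg, Finset.sum_mul]
    exact Finset.sum_congr rfl fun k _ => by ring
  have h3 : ∀ k ∈ Finset.range g, Integrable fun ξ => (-Q.derivative).coeff k *
      (vline (x + σ) ξ ^ k * laplace (complexify φ) (vline (x + σ) ξ)) := fun k _ =>
    (integral_pow_mul_laplace hφ hφc (x + σ) k).1.const_mul _
  have h4 : newtonCramer f σ φ =
      (∫ ξ, logDeriv f (vline (x + σ) ξ) * laplace (complexify φ) (vline (x + σ) ξ)) +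
      ∑ k ∈ Finset.range g, (-Q.derivative).coeff k *
        ((-1) ^ k * iteratedDeriv k (complexify φ) 0) := by
    rw [hf.newtonCramer_eq_integral_laplace hQ (x := x) (by linarith)]
    simp only [sub_eq_add_neg, add_mul]
    rw [integral_add h1.1 (by rw [h2]; exact integrable_finsetSum _ h3), h2,
      integral_finsetSum _ h3]
    congr 1
    refine Finset.sum_congr rfl fun k _ => ?_
    rw [integral_const_mul, (integral_pow_mul_laplace hφ hφc (x + σ) k).2]
  rw [h4, add_sub_cancel_right]
  exact h1.2

/-- On the open half line, integration by parts in each term of `K_{d,σ}` turns the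
Newton-Cramer distribution into the sum of the `n_ρ e^{ρt}`. -/
theorem IsAdmissible.hasSum_mult_mul_laplace (hf : IsAdmissible f c) {Q : Polynomial ℂ}
    (hQ : IsHadamardExponent f σ Q) (φ : Test) (hφ : tsupport φ ⊆ Set.Ioi 0) :
    HasSum (fun ρ : ℂ => (mult f ρ : ℂ) * laplace (complexify φ) ρ) (newtonCramer f σ φ) := by
  set χ : ℝ → ℂ := fun t : ℝ => Complex.exp (σ * t) * complexify φ t with hχ
  have hχc : ContDiff ℝ ∞ χ := complexify_exp_contDiff σ φ
  have hχs : HasCompactSupport χ := complexify_exp_hasCompactSupport σ φ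
  set h : ℝ → ℂ := iteratedDeriv (convergenceExponent f) χ with hh
  have hhc : Continuous h := (contDiff_iteratedDeriv hχc (convergenceExponent f)).continuous
  have hhs : HasCompactSupport h := hasCompactSupport_iteratedDeriv hχs (convergenceExponent f)
  have hsupp : ∀ t ∉ Set.Ici (0 : ℝ), h t = 0 := by
    intro t ht
    by_contra h0
    have h1 : t ∈ tsupport φ := tsupport_complexify_subset φ
      (closure_mono (Function.support_mul_subset_right _ _)
        (tsupport_iteratedDeriv_subset (convergenceExponent f) (subset_tsupport _ h0)))
    exact ht (Set.mem_Ici.2 (Set.mem_Ioi.1 (hφ h1)).le)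
  have hint : ∀ u : ℝ → ℂ, ∫ t in Set.Ici (0 : ℝ), u t * h t = ∫ t, u t * h t := fun u =>
    setIntegral_eq_integral_of_forall_compl_eq_zero fun t ht => by rw [hsupp t ht, mul_zero]
  have h1 := (hasSum_integral_newtonCramerPrimitive hf.meromorphic (le_max_left 0 (c - σ.re))
    (hf.re_sub_le σ) hf.mem hf.ne_zero hhc
    (((by fun_prop : Continuous fun t => Real.exp (max 0 (c - σ.re) * t) * ‖h t‖)
      ).integrable_of_hasCompactSupport hhs.norm.mul_left).integrableOn
    (((by fun_prop : Continuous fun t : ℝ => (t : ℂ) ^ convergenceExponent f * h t)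
      ).integrable_of_hasCompactSupport hhs.mul_left).integrableOn).2
  rw [hint fun t : ℝ => (t : ℂ) ^ convergenceExponent f, hh,
    integral_pow_mul_iteratedDeriv hχc hχs] at h1
  have hsign : (-1 : ℂ) ^ convergenceExponent f * (-1) ^ convergenceExponent f = 1 := by
    rw [← mul_pow]; simp
  have h2 := h1.mul_left ((-1 : ℂ) ^ convergenceExponent f)
  have h3 : (fun ρ : {ρ : ℂ // ρ ≠ σ} => (-1 : ℂ) ^ convergenceExponent f *
      (mult f ρ / ((ρ : ℂ) - σ) ^ convergenceExponent f * ∫ t in Set.Ici (0 : ℝ),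
        (Complex.exp ((ρ - σ) * t) - 1) * h t)) =
      fun ρ : {ρ : ℂ // ρ ≠ σ} => (mult f ρ : ℂ) * laplace (complexify φ) ρ := by
    funext ρ
    have hρ : ((ρ : ℂ) - σ) ^ convergenceExponent f ≠ 0 := pow_ne_zero _ (sub_ne_zero.2 ρ.2)
    have e1 : ∫ t : ℝ, (Complex.exp (((ρ : ℂ) - σ) * t) - 1) * h t =
        laplace h (ρ - σ) - laplace h 0 := by
      rw [laplace, laplace, ← integral_sub
        (integrable_exp_mul (contDiff_iteratedDeriv hχc (convergenceExponent f)) hhs _)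
        (integrable_exp_mul (contDiff_iteratedDeriv hχc (convergenceExponent f)) hhs _)]
      refine integral_congr_ae (Filter.Eventually.of_forall fun t => ?_)
      simp [sub_mul, hh]
    rw [hint, e1, hh, laplace_iteratedDeriv hχc hχs, laplace_iteratedDeriv hχc hχs, neg_zero,
      zero_pow hf.ne_zero, zero_mul, sub_zero, hχ, laplace_exp_mul, sub_add_cancel,
      neg_pow (_ - _ : ℂ)]
    field_simp
    linear_combination (mult f ρ : ℂ) * laplace (complexify φ) ρ * hsign
  rw [h3] at h2
  have h4 := hasSum_of_hasSum_subtype_ne (F := fun ρ : ℂ => (mult f ρ : ℂ) *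
    laplace (complexify φ) ρ) h2
  have hfac : ((convergenceExponent f).factorial : ℂ) ≠ 0 := by
    exact_mod_cast (convergenceExponent f).factorial_ne_zero
  have h5 : ∫ t, χ t = laplace (complexify φ) σ := rfl
  rw [newtonCramer_eq_integral (hf.locallyIntegrable hQ)]
  have h6 : (-1 : ℂ) ^ convergenceExponent f * (mult f σ / (convergenceExponent f).factorial *
      ((-1) ^ convergenceExponent f * (convergenceExponent f).factorial *
        laplace (complexify φ) σ)) = mult f σ * laplace (complexify φ) σ := by
    field_simp
    linear_combination (mult f σ : ℂ) * laplace (complexify φ) σ * hsign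
  rw [h5, mul_sub, h6, sub_add_cancel] at h4
  exact h4

end NewtonCramer


/-! ### Tempered distributions and supports -/

section Tempered

/-- Evaluation of Schwartz functions at `x`. -/
noncomputable def schwartzEval (x : ℝ) : 𝓢(ℝ, ℂ) →L[ℂ] ℂ :=
  (BoundedContinuousFunction.evalCLM ℂ x).comp
    (SchwartzMap.toBoundedContinuousFunctionCLM ℂ ℝ ℂ)

/-- The functional `∑ b_k δ_{μ_k}` on Schwartz functions, for an absolutely summable family of
weights. -/
noncomputable def weightedEval {ι : Type*} (b : ι → ℂ) (hb : Summable fun k => ‖b k‖) (μ : ι → ℝ) :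
    𝓢(ℝ, ℂ) →L[ℂ] ℂ :=
  (LinearMap.mkContinuous
    { toFun := fun u : BoundedContinuousFunction ℝ ℂ => ∑' k, b k * u (μ k)
      map_add' := fun u v => by
        have h : ∀ w : BoundedContinuousFunction ℝ ℂ, Summable fun k => b k * w (μ k) := fun w =>
          Summable.of_norm_bounded (hb.mul_right ‖w‖) fun k => by
            rw [norm_mul]
            exact mul_le_mul_of_nonneg_left (w.norm_coe_le_norm _) (norm_nonneg _)
        rw [← (h u).tsum_add (h v)]
        exact tsum_congr fun k => by simp [mul_add]
      map_smul' := fun c u => by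
        rw [RingHom.id_apply, smul_eq_mul, ← tsum_mul_left]
        exact tsum_congr fun k => by simp [mul_left_comm] }
    (∑' k, ‖b k‖) fun u => by
      refine (tsum_of_norm_bounded (hb.mul_right ‖u‖).hasSum fun k => ?_).trans_eq tsum_mul_right
      rw [norm_mul]
      exact mul_le_mul_of_nonneg_left (u.norm_coe_le_norm _) (norm_nonneg _)).comp
    (SchwartzMap.toBoundedContinuousFunctionCLM ℂ ℝ ℂ)

theorem hasSum_weightedEval {ι : Type*} (b : ι → ℂ) (hb : Summable fun k => ‖b k‖) (μ : ι → ℝ)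
    (ψ : 𝓢(ℝ, ℂ)) : HasSum (fun k => b k * ψ (μ k)) (weightedEval b hb μ ψ) := by
  refine (Summable.of_norm_bounded (hb.mul_right
    ‖SchwartzMap.toBoundedContinuousFunctionCLM ℂ ℝ ℂ ψ‖) fun k => ?_).hasSum
  rw [norm_mul]
  exact mul_le_mul_of_nonneg_left
    ((SchwartzMap.toBoundedContinuousFunctionCLM ℂ ℝ ℂ ψ).norm_coe_le_norm (μ k)) (norm_nonneg _)

/-- The operator `ψ ↦ ψ' - c ψ`, which is the derivative conjugated by `e^{ct}`. -/
noncomputable def twistedDeriv (c : ℝ) : 𝓢(ℝ, ℂ) →L[ℂ] 𝓢(ℝ, ℂ) :=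
  SchwartzMap.derivCLM ℂ ℂ - (c : ℂ) • ContinuousLinearMap.id ℂ 𝓢(ℝ, ℂ)

theorem twistedDeriv_apply (c : ℝ) (ψ : 𝓢(ℝ, ℂ)) (t : ℝ) :
    twistedDeriv c ψ t = deriv ψ t - c * ψ t := rfl

/-- Conjugation by `e^{ct}` carries `d/dt` to `twistedDeriv c`; this makes `e^{-ct} δ_0^{(n)}` a
tempered distribution. -/
theorem iteratedDeriv_exp_mul_schwartz (c : ℝ) (n : ℕ) (ψ : 𝓢(ℝ, ℂ)) :
    iteratedDeriv n (fun t : ℝ => Complex.exp (-c * t) * ψ t) =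
      fun t : ℝ => Complex.exp (-c * t) * (twistedDeriv c ^ n) ψ t := by
  induction n with
  | zero => simp
  | succ n ih =>
    rw [iteratedDeriv_succ, ih]
    funext t
    have h1 := (hasDerivAt_exp_mul (-c) t).mul (((twistedDeriv c ^ n) ψ).hasDerivAt t)
    rw [pow_succ', mul_apply_eq_comp, twistedDeriv_apply]
    refine h1.deriv.trans ?_
    ring

/-- For a real exponent, multiplication by `e^{-ct}` needs only the real part. -/
theorem expMul_neg_ofReal_apply (c : ℝ) (W : Dist) (φ : Test) :
    expMul (-c) W φ = W (mulTest _ (contDiff_re_exp (-c)) φ) := by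
  have h : mulTest _ (contDiff_im_exp (-c)) φ = 0 := by
    ext t
    rw [mulTest_apply, ← Complex.ofReal_neg, ← Complex.ofReal_mul, Complex.exp_ofReal_im, mul_zero]
    rfl
  rw [expMul_apply, h, map_zero, mul_zero, add_zero]

theorem complexify_mulTest_re_exp (c : ℝ) (φ : Test) (t : ℝ) :
    complexify (mulTest _ (contDiff_re_exp (-c)) φ) t = Complex.exp (-c * t) * toSchwartz φ t := by
  have h : toSchwartz φ t = (φ t : ℂ) := rfl
  rw [complexify, mulTest_apply, h, ← Complex.ofReal_neg, ← Complex.ofReal_mul,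
    Complex.exp_ofReal_re]
  push_cast
  ring

/-- Criterion for `e^{-ct} W` to be the restriction of a continuous functional on Schwartz
functions. -/
theorem isTemperedBy_expMul_of_eq {c : ℝ} {W : Dist} {T : 𝓢(ℝ, ℂ) →L[ℂ] ℂ}
    (h : ∀ φ : Test, T (toSchwartz φ) = W (mulTest _ (contDiff_re_exp (-c)) φ)) :
    IsTemperedBy (expMul (-c) W) (ContinuousLinearMap.toPointwiseConvergenceCLM _ _ _ _ T) :=
  fun φ => (h φ).trans (expMul_neg_ofReal_apply c W φ).symm

/-- A distribution that vanishes on `]-∞, 0[` has support in `[0, ∞[`, a subset of `]-1, ∞[`. -/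
theorem dsupport_subset_Ioi {W : Dist} (h : ∀ φ : Test, tsupport φ ⊆ Set.Iio 0 → W φ = 0) :
    Distribution.dsupport W ⊆ Set.Ioi (-1) := by
  intro x hx
  by_contra hx1
  refine (Distribution.notMem_dsupport_iff x).2 ⟨Set.Iio 0, h, isOpen_Iio, ?_⟩ hx
  rw [Set.mem_Ioi, not_lt] at hx1
  exact hx1.trans_lt (by norm_num)

theorem apply_eq_zero_of_notMem_tsupport {φ : Test} {t : ℝ} (h : t ∉ tsupport φ) : φ t = 0 := by
  by_contra h0
  exact h (subset_tsupport _ h0)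

theorem iteratedDeriv_complexify_eq_zero {φ : Test} {t : ℝ} (h : t ∉ tsupport φ) (n : ℕ) :
    iteratedDeriv n (complexify φ) t = 0 := by
  by_contra h0
  exact h (tsupport_complexify_subset φ (tsupport_iteratedDeriv_subset n (subset_tsupport _ h0)))

theorem sum_smul_distDeriv_dirac_apply (g : ℕ) (p : ℕ → ℂ) (φ : Test) :
    (∑ k ∈ Finset.range g, p k • distDeriv^[k] (dirac 0)) φ =
      ∑ k ∈ Finset.range g, p k * ((-1) ^ k * iteratedDeriv k (complexify φ) 0) := by
  rw [sum_apply]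
  refine Finset.sum_congr rfl fun k _ => ?_
  rw [smul_apply, smul_eq_mul, iterate_distDeriv_apply, dirac_apply, iteratedDeriv_complexify,
    coe_iterate_testDeriv]

theorem sum_smul_dirac_apply {ι : Type*} (A : Finset ι) (β : ι → ℂ) (μ : ι → ℝ) (φ : Test) :
    (∑ k ∈ A, β k • dirac (μ k)) φ = ∑ k ∈ A, β k * φ (μ k) := by
  rw [sum_apply]
  exact Finset.sum_congr rfl fun k _ => rfl

variable {ι : Type*} {β : ι → ℂ} {μ : ι → ℝ} {c : ℝ}

theorem summable_norm_mul_exp (hβ : Summable fun k => ‖β k‖ * Real.exp (-μ k * c)) :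
    Summable fun k => ‖β k * Complex.exp (-c * μ k)‖ := by
  refine hβ.congr fun k => ?_
  rw [norm_mul, Complex.norm_exp]
  congr 2
  simp [mul_comm]

theorem mul_mulTest_re_exp (c : ℝ) (φ : Test) (b : ℂ) (t : ℝ) :
    b * (mulTest _ (contDiff_re_exp (-c)) φ t : ℝ) =
      b * Complex.exp (-c * t) * toSchwartz φ t := by
  rw [mul_assoc, ← complexify_mulTest_re_exp]
  rfl

/-- A series of Dirac distributions with exponentially bounded weights converges as Laplace
transformable distributions. -/
theorem hasLaplaceSum_dirac (hμ : ∀ k, 0 ≤ μ k)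
    (hβ : Summable fun k => ‖β k‖ * Real.exp (-μ k * c)) {V : Dist}
    (hV : ∀ φ : Test, HasSum (fun k => β k * φ (μ k)) (V φ)) :
    HasLaplaceSum (fun k => β k • dirac (μ k)) V := by
  have hzero : ∀ φ : Test, tsupport φ ⊆ Set.Iio 0 → ∀ k, φ (μ k) = 0 := fun φ hφ k =>
    apply_eq_zero_of_notMem_tsupport fun h => (hμ k).not_gt (hφ h)
  refine ⟨1, c, fun A => dsupport_subset_Ioi fun φ hφ => ?_, dsupport_subset_Ioi fun φ hφ => ?_,
    fun A => ContinuousLinearMap.toPointwiseConvergenceCLM _ _ _ _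
      (∑ k ∈ A, (β k * Complex.exp (-c * μ k)) • schwartzEval (μ k)),
    ContinuousLinearMap.toPointwiseConvergenceCLM _ _ _ _ (weightedEval _
      (summable_norm_mul_exp hβ) μ), fun A => isTemperedBy_expMul_of_eq fun φ => ?_,
    isTemperedBy_expMul_of_eq fun φ => ?_, ?_⟩
  · rw [sum_smul_dirac_apply]
    exact Finset.sum_eq_zero fun k _ => by rw [hzero φ hφ k, Complex.ofReal_zero, mul_zero]
  · refine (hV φ).unique ((hasSum_zero).congr_fun fun k => ?_)
    rw [hzero φ hφ k, Complex.ofReal_zero, mul_zero]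
  · rw [sum_smul_dirac_apply, sum_apply]
    exact Finset.sum_congr rfl fun k _ => (mul_mulTest_re_exp c φ (β k) (μ k)).symm
  · refine (hasSum_weightedEval _ _ μ _).unique ((hV _).congr_fun fun k => ?_)
    exact (mul_mulTest_re_exp c φ (β k) (μ k)).symm
  · refine PointwiseConvergenceCLM.tendsto_iff_forall_tendsto.2 fun ψ => ?_
    refine (hasSum_weightedEval _ (summable_norm_mul_exp hβ) μ ψ).congr fun A => ?_
    change _ = (∑ k ∈ A, (β k * Complex.exp (-c * μ k)) • schwartzEval (μ k)) ψ
    rw [sum_apply]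
    rfl

/-- A distribution that is the sum of a series of Dirac masses with exponentially bounded weights
and of a combination of derivatives of `δ_0` is Laplace transformable. -/
theorem isLaplaceTransformable_of_hasSum (hμ : ∀ k, 0 ≤ μ k)
    (hβ : Summable fun k => ‖β k‖ * Real.exp (-μ k * c)) {W : Dist} {g : ℕ} {p : ℕ → ℂ}
    (hW : ∀ φ : Test, HasSum (fun k => β k * φ (μ k))
      (W φ - ∑ k ∈ Finset.range g, p k * ((-1) ^ k * iteratedDeriv k (complexify φ) 0))) :
    IsLaplaceTransformable W := by
  refine ⟨⟨1, dsupport_subset_Ioi fun φ hφ => ?_⟩, c,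
    ContinuousLinearMap.toPointwiseConvergenceCLM _ _ _ _
      (weightedEval _ (summable_norm_mul_exp hβ) μ + ∑ k ∈ Finset.range g,
        (p k * (-1) ^ k) • (schwartzEval 0).comp (twistedDeriv c ^ k)),
    isTemperedBy_expMul_of_eq fun φ => ?_⟩
  · have h0 : (0 : ℝ) ∉ tsupport φ := fun h => (Set.mem_Iio.1 (hφ h)).false
    have h1 := hW φ
    simp only [iteratedDeriv_complexify_eq_zero h0, mul_zero, Finset.sum_const_zero, sub_zero] at h1
    refine h1.unique (hasSum_zero.congr_fun fun k => ?_)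
    rw [apply_eq_zero_of_notMem_tsupport fun h => (hμ k).not_gt (hφ h), Complex.ofReal_zero,
      mul_zero]
  · have h1 := (hasSum_weightedEval _ (summable_norm_mul_exp hβ) μ (toSchwartz φ)).unique
      ((hW (mulTest _ (contDiff_re_exp (-c)) φ)).congr_fun fun k =>
        (mul_mulTest_re_exp c φ (β k) (μ k)).symm)
    rw [add_apply, h1, sum_apply]
    have h2 : ∀ k, iteratedDeriv k (complexify (mulTest _ (contDiff_re_exp (-c)) φ)) 0 =
        (twistedDeriv c ^ k) (toSchwartz φ) 0 := fun k => by
      have e : complexify (mulTest _ (contDiff_re_exp (-c)) φ) =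
          fun t : ℝ => Complex.exp (-c * t) * toSchwartz φ t :=
        funext (complexify_mulTest_re_exp c φ)
      rw [e, iteratedDeriv_exp_mul_schwartz]
      simp
    have h3 : ∀ k ∈ Finset.range g, ((p k * (-1) ^ k) •
        (schwartzEval 0).comp (twistedDeriv c ^ k)) (toSchwartz φ) = p k * ((-1) ^ k *
        iteratedDeriv k (complexify (mulTest _ (contDiff_re_exp (-c)) φ)) 0) := fun k _ => by
      rw [h2, ← mul_assoc]
      rfl
    rw [Finset.sum_congr rfl h3]
    exact sub_add_cancel _ _

end Tempered


/-! ### The Poisson-Newton formula -/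

/-- The discrepancy polynomial at any centre `σ` has degree less than the genus, although the genus
is defined through the centre `0`: the two differ by a polynomial of degree less than `d - 1`. -/
theorem IsAdmissible.degree_discrepancyPolynomial_lt {f : ℂ → ℂ} {c : ℝ} (hf : IsAdmissible f c)
    (hhad : ∀ τ, IsHadamardExponent f τ (hadamardPolynomial f τ)) (σ : ℂ) :
    (-Polynomial.derivative (hadamardPolynomial f σ)).degree < genus f := by
  obtain ⟨m, hm⟩ := Nat.exists_eq_succ_of_ne_zero hf.ne_zero
  have h1 : (Polynomial.derivative (hadamardPolynomial f σ) -
      Polynomial.derivative (hadamardPolynomial f 0)).degree < m := by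
    have hQ := hhad σ
    have hQ0 := hhad 0
    rw [IsHadamardExponent, hm, Nat.succ_sub_one] at hQ hQ0
    have hmem := hf.mem
    rw [hm] at hmem
    exact degree_derivative_sub_lt hf.meromorphic hf.regular hmem hQ0 hQ
  have h2 : (m : WithBot ℕ) ≤ genus f := by
    rw [genus, hm, Nat.succ_sub_one]
    exact_mod_cast le_max_right _ _
  have h3 : (Polynomial.derivative (hadamardPolynomial f 0)).degree < genus f := by
    rcases Nat.eq_zero_or_pos (hadamardPolynomial f 0).natDegree with h0 | h0
    · rw [Polynomial.derivative_of_natDegree_zero h0, Polynomial.degree_zero]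
      exact WithBot.bot_lt_coe _
    · have hne : hadamardPolynomial f 0 ≠ 0 := fun h => by simp [h] at h0
      refine (Polynomial.degree_derivative_lt hne).trans_le ?_
      rw [Polynomial.degree_eq_natDegree hne]
      exact_mod_cast le_max_left _ _
  rw [Polynomial.degree_neg, ← Polynomial.mem_degreeLT,
    ← sub_add_cancel (Polynomial.derivative (hadamardPolynomial f σ))
      (Polynomial.derivative (hadamardPolynomial f 0))]
  exact Submodule.add_mem _ (Polynomial.mem_degreeLT.2 (h1.trans_le h2))
    (Polynomial.mem_degreeLT.2 h3)

end PoissonNewton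

theorem mainTheorem2
    -- the frequencies `0 < λ_1 < λ_2 < ⋯ → ∞`, and the coefficients, not all zero
    (lam : ℕ → ℝ) (hpos : 0 < lam 0) (hmono : StrictMono lam)
    (htop : Filter.Tendsto lam Filter.atTop Filter.atTop)
    (a : ℕ → ℂ) (ha : ∃ n, a n ≠ 0)
    -- a half plane of absolute convergence
    (σbar : ℝ) (hsum : Summable fun n => ‖a n‖ * Real.exp (-lam n * σbar))
    -- `f` is a meromorphic extension of finite order of the Dirichlet series
    (f : ℂ → ℂ) (hmero : Meromorphic f) (hord : PoissonNewton.HasFiniteOrder f)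
    (hf : ∀ s : ℂ, σbar < s.re → f s = 1 + ∑' n, a n * Complex.exp (-lam n * s))
    (σ : ℂ) :
    -- the objects in the formula are well defined
    (PoissonNewton.convergenceExponents f).Nonempty ∧
    (∀ τ : ℂ, ∃ Q : Polynomial ℂ, PoissonNewton.IsHadamardExponent f τ Q) ∧
    (∀ t : ℝ, 0 ≤ t → Summable fun ρ : {ρ : ℂ // ρ ≠ σ} =>
      PoissonNewton.mult f ρ / ((ρ : ℂ) - σ) ^ PoissonNewton.convergenceExponent f *
        Complex.exp ((ρ - σ) * t)) ∧
    (∃ σ₀ : ℝ, ∀ s : ℂ, σ₀ < s.re →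
      HasSum (fun k : PoissonNewton.Index =>
        PoissonNewton.logCoeff a k * Complex.exp (-PoissonNewton.pairing lam k * s))
        (-Complex.log (f s))) ∧
    -- the Poisson-Newton formula on the real line
    PoissonNewton.IsLaplaceTransformable (PoissonNewton.newtonCramer f σ) ∧
    (∃ V : PoissonNewton.Dist,
      PoissonNewton.HasLaplaceSum (fun k : PoissonNewton.Index =>
        (PoissonNewton.pairing lam k * PoissonNewton.logCoeff a k) •
          PoissonNewton.dirac (PoissonNewton.pairing lam k)) V ∧
      PoissonNewton.newtonCramer f σ =
        (∑ k ∈ Finset.range (PoissonNewton.genus f),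
          (PoissonNewton.discrepancyPolynomial f σ).coeff k •
            PoissonNewton.distDeriv^[k] (PoissonNewton.dirac 0)) + V) ∧
    -- the Poisson-Newton formula on the open half line
    (∀ φ : 𝓓((⊤ : TopologicalSpace.Opens ℝ), ℝ), tsupport φ ⊆ Set.Ioi 0 →
      HasSum (fun ρ : ℂ => (PoissonNewton.mult f ρ : ℂ) * ∫ t : ℝ, Complex.exp (ρ * t) * φ t)
        (PoissonNewton.newtonCramer f σ φ) ∧
      HasSum (fun k : PoissonNewton.Index =>
        PoissonNewton.pairing lam k * PoissonNewton.logCoeff a k *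
          (φ (PoissonNewton.pairing lam k) : ℂ))
        (PoissonNewton.newtonCramer f σ φ)) := by
  obtain ⟨c, hc, hhalf, hβ⟩ := PoissonNewton.exists_halfPlane hpos hmono hsum hf
  have hfd : ∀ s : ℂ, c < s.re → DifferentiableAt ℂ f s ∧ f s ≠ 0 :=
    fun s hs => ⟨(hhalf s hs).1, (hhalf s hs).2.1⟩
  have hne : (PoissonNewton.convergenceExponents f).Nonempty :=
    PoissonNewton.convergenceExponents_nonempty hmero hord
  have hmem : PoissonNewton.convergenceExponent f ∈ PoissonNewton.convergenceExponents f :=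
    Nat.sInf_mem hne
  have hadm : PoissonNewton.IsAdmissible f c := ⟨hmero, hfd, hmem, fun h =>
    PoissonNewton.zero_notMem_convergenceExponents hpos hmono ha hsum hmero hord hf (h ▸ hmem)⟩
  have hexists : ∀ τ : ℂ, ∃ Q : Polynomial ℂ, PoissonNewton.IsHadamardExponent f τ Q := fun τ =>
    PoissonNewton.exists_hadamard hmero (PoissonNewton.meromorphicOrderAt_ne_top hmero hfd) hord
      (by rwa [Nat.sub_add_cancel (Nat.one_le_iff_ne_zero.2 hadm.ne_zero)]) τ
  have hhad : ∀ τ, PoissonNewton.IsHadamardExponent f τ (PoissonNewton.hadamardPolynomial f τ) :=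
    fun τ => Classical.epsilon_spec (hexists τ)
  have hμ : ∀ k, 0 ≤ PoissonNewton.pairing lam k := fun k =>
    hpos.le.trans (PoissonNewton.le_pairing hpos hmono k)
  have hsumW := hadm.hasSum_newtonCramer (hhad σ) (hadm.degree_discrepancyPolynomial_lt hhad σ)
    hμ hβ fun s hs => (hhalf s hs).2.2.2
  refine ⟨hne, hexists, fun t ht => PoissonNewton.summable_mult_div_mul_exp hmero
      (hadm.re_sub_le σ) hmem ht, ⟨c, fun s hs => (hhalf s hs).2.2.1⟩,
    PoissonNewton.isLaplaceTransformable_of_hasSum hμ hβ hsumW,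
    -- the series of Dirac masses is identified by its values on test functions
    ⟨PoissonNewton.newtonCramer f σ - ∑ k ∈ Finset.range (PoissonNewton.genus f),
      (PoissonNewton.discrepancyPolynomial f σ).coeff k •
        PoissonNewton.distDeriv^[k] (PoissonNewton.dirac 0),
      PoissonNewton.hasLaplaceSum_dirac hμ hβ fun φ => ?_, (add_sub_cancel _ _).symm⟩,
    fun φ hφ => ⟨hadm.hasSum_mult_mul_laplace (hhad σ) φ hφ, ?_⟩⟩
  · rw [sub_apply, PoissonNewton.sum_smul_distDeriv_dirac_apply]
    exact hsumW φ
  · have h0 : (0 : ℝ) ∉ tsupport φ := fun h => (Set.mem_Ioi.1 (hφ h)).false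
    have h1 := hsumW φ
    simp only [PoissonNewton.iteratedDeriv_complexify_eq_zero h0, mul_zero, Finset.sum_const_zero,
      sub_zero] at h1
    exact h1
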